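/- **Setting.** Let $n,m\ge 0$ be integers. A *real hyperquadric* in $\mathbb C^{n+m+1}$ is a set $\{\operatorname{Im} w'=h(z',\bar z')\}$ in some linear coordinates $(z',w')\in\mathbb C^{n+m}\times\mathbb C$, where $h$ is a (possibly degenerate) hermitian form. A real hypersurface $M\subset\mathbb C^{n+1}$ is *transversally holomorphically embeddable* into a hyperquadric $M'$ if there is a holomorphic embedding $H$ of a neighbourhood of $M$ into $\mathbb C^{n+m+1}$ with $H(M)\subset M'$ and $H_*(T_x\mathbb C^{n+1})+T_{H(x)}M'=T_{H(x)}\mathbb C^{n+m+1}$ for all $x\in M$. Let $M\subset\mathbb C^{n+1}$ be a real-analytic hypersurface and $p\in M$. Fix local holomorphic coordinates $Z=(z,w)\in\mathbb C^n\times\mathbb C$ near $p$ (points are identified with their coordinates), an open neighbourhood $U$ of $p$ in the coordinate domain, and a function $\rho(Z,\chi)$ holomorphic on $\{(Z,\chi): Z\in U,\ \bar\chi\in U\}$ such that near $p$ the function $\rho(Z,\bar Z)$ is real-valued and $M$ is given by $\rho(Z,\bar Z)=0$, and such that $\rho_w(p,\bar p)\neq 0$. Let $S_p=\{Z\in U:\rho(Z,\bar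 p)=0\}$ be the Segre variety of $p$. For $\beta\in\mathbb N^n$, $s\in\mathbb N$ let $\rho_{z^\beta w^s}=\partial^{|\beta|+s}\rho/\partial z_1^{\beta_1}\cdots\partial z_n^{\beta_n}\partial w^s$ (derivatives in the first argument $Z=(z,w)$). For $(\beta,s)\ne(0,0)$ give the formal variable $\rho_{z^\beta w^s}$ the weight $\operatorname{wt}\rho_{z^\beta w^s}=2|\beta|+s-1$. For a complex polynomial $P$ in these variables, $\operatorname{wt}P$ is the maximal weight of its monomials and $\deg_{\rho_w}P$ its degree in the variable $\rho_w$. **Theorem 5.1.** Suppose that $M$ is transversally holomorphically embeddable into a hyperquadric in $\mathbb C^{n+m+1}$. Then for every irreducible complex-analytic subvariety $\mathcal S$ of $U$ with $p\in\mathcal S\subset S_p$ and all multiindices $\alpha_1,\dots,\alpha_{m+1}\in\mathbb N^n$ with $|\alpha_j|\ge 2$, there exist an integer $k$ with $K:=\{j:|\alpha_j|=k\}\neq\emptyset$ and complex polynomials $P_j$ ($j\in K$) and $R$ in the variables $\rho_{z^\beta w^s}$ with $0<|\beta|+s\le k$, $|\beta|<k$, such that $$\sum_{j\in K}P_j\big(\rho_{z^\beta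 w^s}(p,\bar\zeta)\big)\,\rho_{z^{\alpha_j}}(p,\bar\zeta)=R\big(\rho_{z^\beta w^s}(p,\bar\zeta)\big)\qquad\text{for all }\zeta\in\mathcal S,$$ not all of the functions $\zeta\mapsto P_j(\rho_{z^\beta w^s}(p,\bar\zeta))$, $j\in K$, vanish identically on $\mathcal S$, and, with $l$ the number of all $j$ with $|\alpha_j|\le k$, $$\operatorname{wt}P_j\le(2k-2)(l-1),\quad \operatorname{wt}R\le(2k-2)l+1,\quad \deg_{\rho_w}P_j\le(2k-2)l,\quad \deg_{\rho_w}R\le(2k-2)l+1 .$$ -/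

import Mathlib

open scoped Topology

/-- The coordinate space `ℂⁿ × ℂ`, with points `Z = (z, w)`. Its `star` is the componentwise
complex conjugation `Z ↦ Z̄`. -/
abbrev ZW (n : ℕ) : Type := (Fin n → ℂ) × ℂ

/-! ### Real-analytic hypersurfaces and hyperquadrics -/

/-- `M ⊆ ℂᴺ` is an (embedded) real-analytic hypersurface: near each of its points it is the zero
set of a real-analytic real-valued function with non-zero differential. -/
def IsRealAnalyticHypersurface {N : ℕ} (M : Set (Fin N → ℂ)) : Prop :=
  ∀ q ∈ M, ∃ V : Set (Fin N → ℂ), IsOpen V ∧ q ∈ V ∧ ∃ r : (Fin N → ℂ) → ℝ,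
    AnalyticOnNhd ℝ r V ∧ fderiv ℝ r q ≠ 0 ∧ M ∩ V = {x ∈ V | r x = 0}

/-- A real hyperquadric in `ℂᴺ⁺¹`: linear coordinates `(z, w) ∈ ℂᴺ × ℂ` on `ℂᴺ⁺¹` together with a
hermitian form `h` (given by a hermitian matrix, possibly degenerate). The hyperquadric is the
set `Im w = h(z, z̄)`. -/
structure Hyperquadric (N : ℕ) where
  coords : (Fin (N + 1) → ℂ) ≃ₗ[ℂ] ZW N
  form : Matrix (Fin N) (Fin N) ℂ
  form_hermitian : form.IsHermitian

namespace Hyperquadric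

variable {N : ℕ}

/-- The defining function `Im w - h(z, z̄)`, where `h(z, z̄) = ∑ h_{ab} z̄_a z_b` is real. -/
def defFun (X : Hyperquadric N) (x : Fin (N + 1) → ℂ) : ℝ :=
  (X.coords x).2.im - (star (X.coords x).1 ⬝ᵥ X.form.mulVec (X.coords x).1).re

/-- The set of points of the hyperquadric. -/
def carrier (X : Hyperquadric N) : Set (Fin (N + 1) → ℂ) := {x | X.defFun x = 0}

/-- The real tangent space of the hyperquadric at a point `x`. -/
noncomputable def tangentSpace (X : Hyperquadric N) (x : Fin (N + 1) → ℂ) :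
    Submodule ℝ (Fin (N + 1) → ℂ) :=
  LinearMap.ker (fderiv ℝ X.defFun x : (Fin (N + 1) → ℂ) →ₗ[ℝ] ℝ)

end Hyperquadric

/-- `H` is a holomorphic embedding of the open set `W` into `ℂᴺ'`: holomorphic, immersive and a
homeomorphism onto its image. -/
structure IsHolomorphicEmbeddingOn {N N' : ℕ} (H : (Fin N → ℂ) → (Fin N' → ℂ))
    (W : Set (Fin N → ℂ)) : Prop where
  isOpen : IsOpen W
  holomorphic : DifferentiableOn ℂ H W
  immersion : ∀ x ∈ W, Function.Injective (fderiv ℂ H x)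
  isEmbedding : Topology.IsEmbedding (W.domRestrict H)

/-- `M` is transversally holomorphically embeddable into the hyperquadric `X`: there is a
holomorphic embedding `H` of a neighbourhood of `M` with `H(M) ⊆ X` and
`H_*(T_x ℂᴺ) + T_{H(x)} X = T_{H(x)} ℂᴺ'⁺¹` for all `x ∈ M`. -/
def TransversallyEmbeddable {N N' : ℕ} (M : Set (Fin N → ℂ)) (X : Hyperquadric N') : Prop :=
  ∃ (W : Set (Fin N → ℂ)) (H : (Fin N → ℂ) → (Fin (N' + 1) → ℂ)),
    M ⊆ W ∧ IsHolomorphicEmbeddingOn H W ∧ Set.MapsTo H M X.carrier ∧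
    ∀ x ∈ M,
      (LinearMap.range (fderiv ℂ H x : (Fin N → ℂ) →ₗ[ℂ] (Fin (N' + 1) → ℂ))).restrictScalars ℝ
        ⊔ X.tangentSpace (H x) = ⊤

/-! ### Partial derivatives in `(z, w)` -/

/-- The partial derivative `∂/∂z_i`. -/
noncomputable def derivZ {n : ℕ} (i : Fin n) (f : ZW n → ℂ) : ZW n → ℂ :=
  fun Z => fderiv ℂ f Z (Pi.single i 1, 0)

/-- The partial derivative `∂/∂w`. -/
noncomputable def derivW {n : ℕ} (f : ZW n → ℂ) : ZW n → ℂ :=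
  fun Z => fderiv ℂ f Z (0, 1)

/-- The mixed partial derivative
`f_{z^β w^s} = ∂^{|β|+s} f / ∂z_1^{β_1} ⋯ ∂z_n^{β_n} ∂w^s`. -/
noncomputable def mixedDeriv {n : ℕ} (β : Fin n → ℕ) (s : ℕ) (f : ZW n → ℂ) : ZW n → ℂ :=
  (List.finRange n).foldr (fun i g => (derivZ i)^[β i] g) (derivW^[s] f)

/-- The length `|β|` of a multiindex. -/
def multiLength {n : ℕ} (β : Fin n → ℕ) : ℕ := ∑ i, β i

/-- For a function `ρ(Z, χ)`, the derivative `ρ_{z^β w^s}(P, ζ̄)`, where the differentiation is in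
the variables `Z = (z, w)` only, and `b = (β, s)`. -/
noncomputable def rhoDeriv {n : ℕ} (ρ : ZW n × ZW n → ℂ) (P ζ : ZW n)
    (b : (Fin n → ℕ) × ℕ) : ℂ :=
  mixedDeriv b.1 b.2 (fun Z => ρ (Z, star ζ)) P

/-! ### Defining functions and Segre varieties -/

/-- `ρ(Z, Z̄)` is a real-analytic defining function of `M` at `p` in the local holomorphic
coordinates `Z = (z, w)` given by `Φ`, with `ρ_w(p, p̄) ≠ 0`. The function `ρ(Z, χ)` is the
complexification, holomorphic in `(Z, χ)` for `Z` and `χ̄` in the neighbourhood `U` of (the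
coordinates of) `p`. -/
structure IsDefiningFunction {n : ℕ} (M : Set (Fin (n + 1) → ℂ)) (p : Fin (n + 1) → ℂ)
    (Φ : OpenPartialHomeomorph (Fin (n + 1) → ℂ) (ZW n)) (U : Set (ZW n))
    (ρ : ZW n × ZW n → ℂ) : Prop where
  isOpen : IsOpen U
  mem : Φ p ∈ U
  subset : U ⊆ Φ.target
  holomorphic : AnalyticOnNhd ℂ ρ {x | x.1 ∈ U ∧ star x.2 ∈ U}
  real : ∀ᶠ Z in 𝓝 (Φ p), (ρ (Z, star Z)).im = 0
  defines : ∀ᶠ Z in 𝓝 (Φ p), Φ.symm Z ∈ M ↔ ρ (Z, star Z) = 0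
  deriv_w_ne_zero : rhoDeriv ρ (Φ p) (Φ p) (0, 1) ≠ 0

/-- The Segre variety `S_ζ = {Z ∈ U : ρ(Z, ζ̄) = 0}`. -/
def segreVariety {n : ℕ} (U : Set (ZW n)) (ρ : ZW n × ZW n → ℂ) (ζ : ZW n) : Set (ZW n) :=
  {Z ∈ U | ρ (Z, star ζ) = 0}

/-! ### Complex-analytic subvarieties -/

/-- `S` is a complex-analytic subvariety of the open set `U`: a subset of `U` that near each point
of `U` is the common zero set of finitely many holomorphic functions. -/
def IsAnalyticSubvariety {n : ℕ} (U S : Set (ZW n)) : Prop :=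
  S ⊆ U ∧ ∀ q ∈ U, ∃ V : Set (ZW n), IsOpen V ∧ q ∈ V ∧
    ∃ (r : ℕ) (g : Fin r → ZW n → ℂ), (∀ i, AnalyticOnNhd ℂ (g i) V) ∧
      S ∩ V = {Z ∈ V | ∀ i, g i Z = 0}

/-- The regular part of `S`: the points near which `S` is a complex submanifold. -/
def regularPart {n : ℕ} (S : Set (ZW n)) : Set (ZW n) :=
  {q ∈ S | ∃ V : Set (ZW n), IsOpen V ∧ q ∈ V ∧
    ∃ (r : ℕ) (g : ZW n → (Fin r → ℂ)), AnalyticOnNhd ℂ g V ∧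
      Function.Surjective (fderiv ℂ g q) ∧ S ∩ V = {Z ∈ V | g Z = 0}}

/-- `S` is an irreducible complex-analytic subvariety of `U`: the manifold of its regular points
is connected. -/
def IsIrreducibleSubvariety {n : ℕ} (U S : Set (ZW n)) : Prop :=
  IsAnalyticSubvariety U S ∧ IsConnected (regularPart S)

/-! ### Polynomials in the derivatives of `ρ`

These are polynomials in formal variables indexed by pairs `(β, s)`, the variable `(β, s)` standing
for `ρ_{z^β w^s}`. -/

/-- Polynomials in formal variables `ρ_{z^β w^s}`. -/
abbrev JetPoly (n : ℕ) : Type := MvPolynomial ((Fin n → ℕ) × ℕ) ℂ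

/-- `P` involves only the variables `ρ_{z^β w^s}` with `0 < |β| + s ≤ k` and `|β| < k`. -/
def JetPoly.InvolvesOnly {n : ℕ} (k : ℕ) (P : JetPoly n) : Prop :=
  ∀ b ∈ P.vars, 0 < multiLength b.1 + b.2 ∧ multiLength b.1 + b.2 ≤ k ∧ multiLength b.1 < k

/-- The weight of a polynomial, where `wt ρ_{z^β w^s} = 2|β| + s - 1` (for `(β, s) ≠ (0, 0)`):
the maximal weight of its monomials. -/
noncomputable def JetPoly.wt {n : ℕ} (P : JetPoly n) : ℕ :=
  MvPolynomial.weightedTotalDegree (fun b => 2 * multiLength b.1 + b.2 - 1) P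

/-- The degree of a polynomial in the variable `ρ_w`. -/
noncomputable def JetPoly.degRhoW {n : ℕ} (P : JetPoly n) : ℕ :=
  MvPolynomial.degreeOf (0, 1) P

/-! Let `T` be the embedding written in coordinates adapted to the hyperquadric. Complexifying the
equation of the hyperquadric gives, for each ζ near p, a function f_ζ(Z) = v_ζ(T(Z)) - e_ζ with v_ζ
a complex-linear functional on ℂ^(n+m+1). Near p it vanishes on the Segre variety of ζ, and for ζ in
the Segre variety of p the hermitian symmetry of ρ shows that p lies on that of ζ. The derivatives
of f_ζ at p are the values of the single functional v_ζ on the fixed vectors ∂^b T(p).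

Differentiating f_ζ = 0 along the graph ρ(·, ζ̄) = 0 and clearing denominators gives, for |α| = k ≥
2, an identity (R_α - ρ_w^(2k-2) ρ_{z^α}) ∂_w f_ζ + ρ_w ∑ D_{α,b} ∂^b f_ζ = 0 whose coefficients are
polynomials of controlled weight in admissible derivatives of ρ (`exists_segre_expansion`). The
first-order tangency relations express v_ζ on the image of dT(p) through ω = ∂_w f_ζ(p), which is
nonzero by transversality. Only m further values of v_ζ remain unknown, while the m + 1 multiindices
give m + 1 linear equations.

Those unknowns are eliminated by minors (`exists_minor_relation`). Taking k to be the first length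
at which the coefficient rows become dependent keeps longer multiindices out and leaves some
coefficient of length exactly k nonzero. Fewer than l rows enter each minor, each contributing at
most 2k - 2 to weight and degree, and this yields the bounds (`exists_jet_relation`).

Irreducibility of S enters twice through the identity theorem `IsIrreducibleSubvariety.eq_zero`:
polynomials in the derivatives of ρ, modulo those vanishing on S, form a domain, and relations
obtained near p extend to all of S. The core assembly is `exists_relation_of_map`. -/

/-! ### Smoothness of holomorphic maps of several variables. -/

section HolomorphicSmooth

open scoped ContDiff
open Metric Set Filter

variable {E F : Type*} [NormedAddCommGroup E] [NormedSpace ℂ E] [FiniteDimensional ℂ E]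
  [NormedAddCommGroup F] [NormedSpace ℂ F] [FiniteDimensional ℂ F]

/-- Cauchy's formula on the complex line x + ℂv writes the directional derivative as an integral of
f over a small circle, and this integral may be differentiated under the sign in x. -/
theorem differentiableAt_fderiv_apply {f : E → F} {V : Set E} (hV : IsOpen V)
    (hf : DifferentiableOn ℂ f V) {x₀ : E} (hx₀ : x₀ ∈ V) (v : E) :
    DifferentiableAt ℂ (fun x => fderiv ℂ f x v) x₀ := by
  borelize E
  borelize F
  have : CompleteSpace F := FiniteDimensional.complete ℂ F
  have : ProperSpace E := FiniteDimensional.proper ℂ E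
  have : ProperSpace F := FiniteDimensional.proper ℂ F
  have : ProperSpace (E →L[ℂ] F) := FiniteDimensional.proper ℂ _
  obtain ⟨ε, hε, hball⟩ := Metric.isOpen_iff.mp hV x₀ hx₀
  obtain ⟨δ, hδ, hδε⟩ : ∃ δ : ℝ, 0 < δ ∧ 4 * δ < ε := ⟨ε / 8, by positivity, by linarith⟩
  have hsub : closedBall x₀ (4 * δ) ⊆ V := (closedBall_subset_ball hδε).trans hball
  obtain ⟨C, hC⟩ := (isCompact_closedBall x₀ (4 * δ)).exists_bound_of_continuousOn
    (hf.continuousOn.mono hsub)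
  -- Cauchy estimate on the ball of radius δ about y, which stays inside radius 4δ; there f differs
  -- from f y by at most 2C.
  have hbound : ∀ y ∈ ball x₀ (2 * δ), ‖fderiv ℂ f y‖ ≤ (2 * C) / δ := by
    intro y hy
    have hy' : ball y δ ⊆ closedBall x₀ (4 * δ) := by
      intro z hz
      rw [mem_ball] at hz hy
      rw [mem_closedBall]
      linarith [dist_triangle z y x₀]
    apply Complex.norm_fderiv_le_div_of_mapsTo_ball (hf.mono (hy'.trans hsub)) _ hδ
    intro z hz
    rw [mem_closedBall, dist_eq_norm]
    have h1 := hC z (hy' hz)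
    have h2 := hC y (hy' (mem_ball_self hδ))
    linarith [norm_sub_le (f z) (f y)]
  obtain ⟨s, hs, hsv⟩ : ∃ s : ℝ, 0 < s ∧ s * ‖v‖ < δ := by
    refine ⟨δ / (‖v‖ + 1), by positivity, ?_⟩
    rw [div_mul_eq_mul_div, div_lt_iff₀ (by positivity)]
    nlinarith [norm_nonneg v]
  have hmem : ∀ x ∈ ball x₀ δ, ∀ t ∈ closedBall (0 : ℂ) s, x + t • v ∈ ball x₀ (2 * δ) := by
    intro x hx t ht
    rw [mem_ball, dist_eq_norm] at *
    rw [mem_closedBall_zero_iff] at ht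
    have : ‖t • v‖ ≤ s * ‖v‖ := by rw [norm_smul]; gcongr
    calc ‖x + t • v - x₀‖ = ‖(x - x₀) + t • v‖ := by congr 1; abel
      _ ≤ ‖x - x₀‖ + ‖t • v‖ := norm_add_le _ _
      _ < 2 * δ := by linarith
  have h2δ : ball x₀ (2 * δ) ⊆ V :=
    (ball_subset_closedBall.trans (closedBall_subset_closedBall (by linarith))).trans hsub
  have hdiff : ∀ y ∈ ball x₀ (2 * δ), DifferentiableAt ℂ f y := fun y hy =>
    hf.differentiableAt (hV.mem_nhds (h2δ hy))
  have hcauchy : ∀ x ∈ ball x₀ δ, fderiv ℂ f x v =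
      (2 * Real.pi * Complex.I : ℂ)⁻¹ • ∮ z in C(0, s), ((z - 0) ^ 2)⁻¹ • f (x + z • v) := by
    intro x hx
    have hUo : IsOpen {t : ℂ | x + t • v ∈ ball x₀ (2 * δ)} :=
      isOpen_ball.preimage (by fun_prop)
    rw [Complex.two_pi_I_inv_smul_circleIntegral_sub_sq_inv_smul_of_differentiable
      (f := fun z => f (x + z • v)) hUo (c := 0) (w₀ := 0) (R := s)
      (fun t ht => hmem x hx t ht) _ (mem_ball_self hs)]
    · have h1 : HasDerivAt (fun z : ℂ => x + z • v) v 0 := by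
        simpa using ((hasDerivAt_id (0 : ℂ)).smul_const v).const_add x
      have h2 : HasFDerivAt f (fderiv ℂ f x) (x + (0 : ℂ) • v) := by
        simpa using (hdiff x (by simpa using hmem x hx 0 (by simp [hs.le]))).hasFDerivAt
      exact (h2.comp_hasDerivAt 0 h1).deriv.symm
    · intro t ht
      exact ((hdiff _ ht).comp t (by fun_prop)).differentiableWithinAt
  have hev : (fun x => fderiv ℂ f x v) =ᶠ[𝓝 x₀] fun x =>
      (2 * Real.pi * Complex.I : ℂ)⁻¹ • ∮ z in C(0, s), ((z - 0) ^ 2)⁻¹ • f (x + z • v) := by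
    filter_upwards [ball_mem_nhds x₀ hδ] with x hx using hcauchy x hx
  refine DifferentiableAt.congr_of_eventuallyEq ?_ hev
  refine DifferentiableAt.const_smul ?_ _
  unfold circleIntegral
  have hc : Continuous (fun θ : ℝ => circleMap (0 : ℂ) s θ) := continuous_circleMap 0 s
  have hc' : Continuous (fun θ : ℝ => deriv (circleMap (0 : ℂ) s) θ) := by
    simp only [deriv_circleMap]; fun_prop
  have hcm : ∀ θ, circleMap (0 : ℂ) s θ ∈ closedBall (0 : ℂ) s := fun θ =>
    circleMap_mem_closedBall _ hs.le _
  have hc0 : ∀ θ, circleMap (0 : ℂ) s θ ≠ 0 := fun θ => circleMap_ne_center hs.ne'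
  have hk : Continuous (fun θ : ℝ => deriv (circleMap (0 : ℂ) s) θ *
      ((circleMap (0 : ℂ) s θ - 0) ^ 2)⁻¹) := by
    refine hc'.mul (Continuous.inv₀ (by fun_prop) fun θ => ?_)
    simpa using hc0 θ
  obtain ⟨B, hB⟩ : ∃ B, ∀ θ ∈ uIcc 0 (2 * Real.pi), ‖deriv (circleMap (0 : ℂ) s) θ *
      ((circleMap (0 : ℂ) s θ - 0) ^ 2)⁻¹‖ ≤ B :=
    isCompact_uIcc.exists_bound_of_continuousOn hk.continuousOn
  have hcont : ∀ x ∈ ball x₀ δ, Continuous (fun θ : ℝ => deriv (circleMap (0 : ℂ) s) θ •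
      ((circleMap (0 : ℂ) s θ - 0) ^ 2)⁻¹ • f (x + circleMap 0 s θ • v)) := by
    intro x hx
    simp only [smul_smul]
    refine hk.smul ?_
    refine continuous_iff_continuousAt.mpr fun θ => ?_
    have h1 : ContinuousAt f (x + circleMap 0 s θ • v) :=
      (hdiff _ (hmem x hx _ (hcm θ))).continuousAt
    exact ContinuousAt.comp (f := fun θ : ℝ => x + circleMap 0 s θ • v) h1 (by fun_prop)
  refine (intervalIntegral.hasFDerivAt_integral_of_dominated_of_fderiv_le
    (F := fun x θ => deriv (circleMap (0 : ℂ) s) θ •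
      ((circleMap (0 : ℂ) s θ - 0) ^ 2)⁻¹ • f (x + circleMap 0 s θ • v))
    (F' := fun x θ => (deriv (circleMap (0 : ℂ) s) θ *
      ((circleMap (0 : ℂ) s θ - 0) ^ 2)⁻¹) • fderiv ℂ f (x + circleMap 0 s θ • v))
    (s := ball x₀ δ) (bound := fun _ => B * ((2 * C) / δ)) (μ := MeasureTheory.volume)
    (ball_mem_nhds x₀ hδ) ?_ ?_ ?_ ?_ ?_ ?_).differentiableAt
  · filter_upwards [ball_mem_nhds x₀ hδ] with x hx using (hcont x hx).aestronglyMeasurable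
  · exact (hcont x₀ (mem_ball_self hδ)).intervalIntegrable _ _
  · refine MeasureTheory.AEStronglyMeasurable.smul hk.aestronglyMeasurable ?_
    refine Measurable.aestronglyMeasurable ?_
    exact (measurable_fderiv ℂ f).comp (by fun_prop : Continuous
      (fun θ : ℝ => x₀ + circleMap 0 s θ • v)).measurable
  · refine Eventually.of_forall fun θ hθ x hx => ?_
    rw [norm_smul]
    have h1 := hB θ (uIoc_subset_uIcc hθ)
    have h2 := hbound _ (hmem x hx _ (hcm θ))
    exact mul_le_mul h1 h2 (norm_nonneg _) ((norm_nonneg _).trans h1)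
  · exact intervalIntegrable_const
  · refine Eventually.of_forall fun θ hθ x hx => ?_
    have h1 : HasFDerivAt (fun x => f (x + circleMap 0 s θ • v))
        (fderiv ℂ f (x + circleMap 0 s θ • v)) x := by
      have := (hdiff _ (hmem x hx _ (hcm θ))).hasFDerivAt.comp x
        ((hasFDerivAt_id (𝕜 := ℂ) x).add_const (circleMap 0 s θ • v))
      simpa [Function.comp_def] using this
    simp only [smul_smul]
    exact h1.const_smul _

theorem contDiffOn_infty_of_differentiableOn {f : E → F} {V : Set E} (hV : IsOpen V)
    (hf : DifferentiableOn ℂ f V) : ContDiffOn ℂ ∞ f V := by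
  rw [contDiffOn_infty]
  intro n
  induction n generalizing f with
  | zero => exact contDiffOn_zero.mpr hf.continuousOn
  | succ n ih =>
    push_cast
    rw [contDiffOn_succ_iff_fderiv_of_isOpen hV]
    refine ⟨hf, by simp, contDiffOn_clm_apply.mpr fun v => ih fun x hx => ?_⟩
    exact (differentiableAt_fderiv_apply hV hf hx v).differentiableWithinAt

theorem contDiffAt_of_eventually_differentiableAt {f : E → F} {a : E}
    (hf : ∀ᶠ x in 𝓝 a, DifferentiableAt ℂ f x) : ContDiffAt ℂ ∞ f a := by
  obtain ⟨V, hV, hVo, ha⟩ := _root_.eventually_nhds_iff.mp hf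
  exact (contDiffOn_infty_of_differentiableOn hVo
    (fun x hx => (hV x hx).differentiableWithinAt)).contDiffAt (hVo.mem_nhds ha)

end HolomorphicSmooth

/-! ### Level sets of submersions and vanishing of holomorphic functions. -/

section ZeroSets

open scoped ContDiff
open Metric Set Filter

/-- A function vanishing on the level set of a submersion has its differential vanishing on the
tangent space of the level set. -/
theorem ker_le_ker_of_eventually_zero {𝕜 E F G : Type*} [NontriviallyNormedField 𝕜]
    [CompleteSpace 𝕜]
    [NormedAddCommGroup E] [NormedSpace 𝕜 E] [CompleteSpace E]
    [NormedAddCommGroup F] [NormedSpace 𝕜 F] [FiniteDimensional 𝕜 F] [FiniteDimensional 𝕜 E]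
    [NormedAddCommGroup G] [NormedSpace 𝕜 G]
    {g : E → F} {φ : E → G} {g' : E →L[𝕜] F} {φ' : E →L[𝕜] G} {q : E}
    (hg : HasStrictFDerivAt g g' q) (hsurj : Function.Surjective g')
    (hφ : HasFDerivAt φ φ' q) (hz : ∀ᶠ x in 𝓝 q, g x = g q → φ x = 0)
    {X : E} (hX : g' X = 0) : φ' X = 0 := by
  have : CompleteSpace F := FiniteDimensional.complete 𝕜 F
  have hr : (g' : E →ₗ[𝕜] F).range = ⊤ := LinearMap.range_eq_top.mpr hsurj
  -- The implicit function parametrizes the level set through q, and its derivative at 0 is the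
  -- inclusion of ker g'. The chain rule then computes φ' on the kernel.
  have h1 := hg.to_implicitFunction hr
  have h0 : hg.implicitFunction g g' hr (g q) 0 = q := by
    have := hg.implicitFunction_apply_image hr
    exact this
  have h2 : HasFDerivAt φ φ' (hg.implicitFunction g g' hr (g q) 0) := by rwa [h0]
  have h3 := h2.comp (0 : (g' : E →ₗ[𝕜] F).ker) h1.hasFDerivAt
  have hcont : Tendsto (hg.implicitFunction g g' hr (g q)) (𝓝 0) (𝓝 q) := by
    simpa [ContinuousAt, h0] using h1.hasFDerivAt.continuousAt
  have hz2 : ∀ᶠ y in 𝓝 (0 : (g' : E →ₗ[𝕜] F).ker),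
      (φ ∘ hg.implicitFunction g g' hr (g q)) y = 0 := by
    have h4 := (hg.map_implicitFunction_eq hr)
    have h5 : ∀ᶠ y in 𝓝 (0 : (g' : E →ₗ[𝕜] F).ker),
        g (hg.implicitFunction g g' hr (g q) y) = g q := by
      have : Tendsto (fun y : (g' : E →ₗ[𝕜] F).ker => (g q, y)) (𝓝 0) (𝓝 (g q, 0)) := by
        exact (Continuous.prodMk_right (g q)).tendsto 0
      exact this.eventually h4
    filter_upwards [hcont.eventually hz, h5] with y hy1 hy2 using hy1 hy2
  have h6 : HasFDerivAt (φ ∘ hg.implicitFunction g g' hr (g q))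
      (0 : (g' : E →ₗ[𝕜] F).ker →L[𝕜] G) 0 :=
    (hasFDerivAt_const (0 : G) _).congr_of_eventuallyEq hz2
  have h7 := h3.unique h6
  have := DFunLike.congr_fun h7 ⟨X, hX⟩
  simpa using this

variable {E F K : Type*} [NormedAddCommGroup E] [NormedSpace ℂ E] [FiniteDimensional ℂ E]
  [NormedAddCommGroup F] [NormedSpace ℂ F] [FiniteDimensional ℂ F]
  [NormedAddCommGroup K] [NormedSpace ℂ K]

/-- On the complex line from y₀ to a nearby y the function is given by its Taylor series; working on
the disc of radius 2 puts y, at parameter 1, inside the disc of convergence. -/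
theorem eventually_eq_zero_of_iteratedDeriv_line {h : K → ℂ} {y₀ : K}
    (hd : ∀ᶠ y in 𝓝 y₀, DifferentiableAt ℂ h y)
    (h0 : ∀ (v : K) (k : ℕ), iteratedDeriv k (fun t : ℂ => h (y₀ + t • v)) 0 = 0) :
    ∀ᶠ y in 𝓝 y₀, h y = 0 := by
  obtain ⟨δ, hδ, hball⟩ := Metric.eventually_nhds_iff_ball.mp hd
  filter_upwards [ball_mem_nhds y₀ (half_pos hδ)] with y hy
  have hdiff : DifferentiableOn ℂ (fun t : ℂ => h (y₀ + t • (y - y₀))) (ball 0 2) := by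
    intro t ht
    have hmem : y₀ + t • (y - y₀) ∈ ball y₀ δ := by
      rw [mem_ball, dist_eq_norm] at *
      rw [sub_zero] at ht
      rw [add_sub_cancel_left, norm_smul]
      nlinarith [norm_nonneg t, norm_nonneg (y - y₀)]
    exact ((hball _ hmem).comp t (by fun_prop)).differentiableWithinAt
  have := Complex.taylorSeries_eq_on_ball hdiff (z := 1) (by simp)
  simp only [h0] at this
  simpa using this.symm

/-- The complex line through y₁ and y meets a convex set in a convex, hence connected, set, so the
one-variable identity theorem applies. -/
theorem eqOn_zero_of_convex {h : K → ℂ} {B : Set K} (hB : IsOpen B) (hc : Convex ℝ B)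
    (hd : DifferentiableOn ℂ h B) {y₁ : K} (hy₁ : y₁ ∈ B) (h0 : ∀ᶠ y in 𝓝 y₁, h y = 0) :
    ∀ y ∈ B, h y = 0 := by
  intro y hy
  set l : ℂ → K := fun t => y₁ + t • (y - y₁) with hl
  have hlc : Continuous l := by fun_prop
  have hUo : IsOpen (l ⁻¹' B) := hB.preimage hlc
  have hUc : Convex ℝ (l ⁻¹' B) := by
    intro s hs t ht a b ha hb hab
    have : l (a • s + b • t) = a • l s + b • l t := by
      have hb' : (b : ℝ) = 1 - a := by linarith
      simp only [hl, hb', ← Complex.coe_smul, smul_eq_mul]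
      push_cast
      module
    rw [mem_preimage, this]
    exact hc hs ht ha hb hab
  have han : AnalyticOnNhd ℂ (h ∘ l) (l ⁻¹' B) := by
    refine DifferentiableOn.analyticOnNhd (fun t ht => ?_) hUo
    exact ((hd.differentiableAt (hB.mem_nhds ht)).comp t
      (by simp only [hl]; fun_prop)).differentiableWithinAt
  have hl0 : l 0 = y₁ := by simp [hl]
  have hl1 : l 1 = y := by simp [hl]
  have hz : h ∘ l =ᶠ[𝓝 0] 0 := by
    have : Tendsto l (𝓝 0) (𝓝 y₁) := by simpa [hl0] using hlc.tendsto 0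
    exact this.eventually h0
  have := han.eqOn_zero_of_preconnected_of_eventuallyEq_zero hUc.isPreconnected
    (by simpa [hl0] using hy₁) hz (x := 1) (by simpa [hl1] using hy)
  simpa [hl1] using this

/-- Local straightening of the zero set of a submersion. -/
theorem exists_straightening {n : ℕ∞ω} (hn : n ≠ 0) {g : E → F} {a : E}
    (hg : ContDiffAt ℂ n g a) (hsurj : Function.Surjective (fderiv ℂ g a)) :
    ∃ (π : E → (fderiv ℂ g a : E →ₗ[ℂ] F).ker)
      (e : OpenPartialHomeomorph E (F × (fderiv ℂ g a : E →ₗ[ℂ] F).ker)),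
      a ∈ e.source ∧ (∀ x, e x = (g x, π x)) ∧ ContDiffAt ℂ n e (a) ∧
      ContDiffAt ℂ n e.symm (e a) := by
  have : CompleteSpace F := FiniteDimensional.complete ℂ F
  have : CompleteSpace E := FiniteDimensional.complete ℂ E
  have hs := hg.hasStrictFDerivAt hn
  have hker : (fderiv ℂ g a : E →L[ℂ] F).ker.ClosedComplemented :=
    Submodule.ClosedComplemented.of_finiteDimensional_quotient
      (fderiv ℂ g a).isClosed_ker
  let D := hs.implicitFunctionDataOfComplemented g _ (LinearMap.range_eq_top.mpr hsurj) hker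
  have hpt : D.pt = a := rfl
  have hl : ContDiffAt ℂ n D.leftFun D.pt := hg
  have hr : ContDiffAt ℂ n D.rightFun D.pt := by
    simp only [D, HasStrictFDerivAt.implicitFunctionDataOfComplemented]
    fun_prop
  refine ⟨D.rightFun, D.toOpenPartialHomeomorph, D.pt_mem_toOpenPartialHomeomorph_source,
    fun x => rfl, hl.prodMk hr, ?_⟩
  exact D.contDiffAt_implicitFunction hl hr hn

end ZeroSets

/-! ### Uniqueness sets inside complex submanifolds. -/

section TangentialDerivatives

open scoped ContDiff
open Metric Set Filter

variable {E F K : Type*} [NormedAddCommGroup E] [NormedSpace ℂ E]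
  [NormedAddCommGroup F] [NormedSpace ℂ F]
  [NormedAddCommGroup K] [NormedSpace ℂ K]

/-- The derivative of `φ` along the coordinate vector field `v` of the chart `e`. -/
noncomputable def chartDeriv (e : OpenPartialHomeomorph E (F × K)) (v : K) (φ : E → ℂ) : E → ℂ :=
  fun x => fderiv ℂ (φ ∘ e.symm) (e x) (0, v)

theorem contDiffAt_chartDeriv {n : ℕ∞ω} (hn : n + 1 ≤ n) {e : OpenPartialHomeomorph E (F × K)}
    {a : E} (ha : a ∈ e.source) (he : ContDiffAt ℂ n e a) (he' : ContDiffAt ℂ n e.symm (e a))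
    (v : K) {φ : E → ℂ} (hφ : ContDiffAt ℂ n φ a) : ContDiffAt ℂ n (chartDeriv e v φ) a := by
  have h1 : ContDiffAt ℂ n (φ ∘ e.symm) (e a) :=
    ContDiffAt.comp (e a) (by rwa [e.left_inv ha]) he'
  have h2 : ContDiffAt ℂ n (fun y => fderiv ℂ (φ ∘ e.symm) y (0, v)) (e a) :=
    (h1.fderiv_right hn).clm_apply contDiffAt_const
  exact h2.comp a he

variable {A : Set E} {g : E → F} {a : E} {n : ℕ∞ω}

/-- In the straightened chart the K-directions are tangent to the level sets of g, so the hypothesis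
on differentials applies to these fields. -/
theorem eventually_chartDeriv_eq_zero (hn : n ≠ 0)
    {e : OpenPartialHomeomorph E (F × K)} {π : E → K}
    (ha : a ∈ e.source) (heq : ∀ x, e x = (g x, π x))
    (he' : ContDiffAt ℂ n e.symm (e a)) (hg : ContDiffAt ℂ n g a)
    (hyp : ∀ φ : E → ℂ, ContDiffAt ℂ n φ a → (∀ᶠ x in 𝓝 a, x ∈ A → φ x = 0) →
      ∀ᶠ x in 𝓝 a, x ∈ A → ∀ X, fderiv ℂ g x X = 0 → fderiv ℂ φ x X = 0)
    (v : K) {φ : E → ℂ} (hφ : ContDiffAt ℂ n φ a) (hz : ∀ᶠ x in 𝓝 a, x ∈ A → φ x = 0) :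
    ∀ᶠ x in 𝓝 a, x ∈ A → chartDeriv e v φ x = 0 := by
  have h1n : (1 : ℕ∞ω) ≤ n := ENat.one_le_iff_ne_zero_withTop.mpr hn
  have hd : ∀ {ψ : E → ℂ}, ContDiffAt ℂ n ψ a → ∀ᶠ x in 𝓝 a, DifferentiableAt ℂ ψ x :=
    fun h => ((h.of_le h1n).eventually (by simp)).mono fun x hx => hx.differentiableAt (by simp)
  have hdg : ∀ᶠ x in 𝓝 a, DifferentiableAt ℂ g x :=
    ((hg.of_le h1n).eventually (by simp)).mono fun x hx => hx.differentiableAt (by simp)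
  have hds : ∀ᶠ x in 𝓝 a, DifferentiableAt ℂ e.symm (e x) :=
    (e.continuousAt ha).eventually (((he'.of_le h1n).eventually (by simp)).mono
      fun x hx => hx.differentiableAt (by simp))
  filter_upwards [hyp φ hφ hz, hd hφ, hdg, hds, e.open_source.mem_nhds ha] with
    x hx hφx hgx hsx hxs hxA
  have hφx' : DifferentiableAt ℂ φ (e.symm (e x)) := by rwa [e.left_inv hxs]
  have hgx' : DifferentiableAt ℂ g (e.symm (e x)) := by rwa [e.left_inv hxs]
  have hgs : (g ∘ e.symm) =ᶠ[𝓝 (e x)] Prod.fst := by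
    filter_upwards [e.open_target.mem_nhds (e.map_source hxs)] with y hy
    have := congrArg Prod.fst (heq (e.symm y))
    rw [e.right_inv hy] at this
    exact this.symm
  have hX : fderiv ℂ g x (fderiv ℂ e.symm (e x) (0, v)) = 0 := by
    have h1 := hgs.fderiv_eq (𝕜 := ℂ)
    rw [fderiv_comp _ hgx' hsx, fderiv_fst, e.left_inv hxs] at h1
    simpa using DFunLike.congr_fun h1 ((0 : F), v)
  have h2 := hx hxA _ hX
  rw [chartDeriv, fderiv_comp _ hφx' hsx, e.left_inv hxs]
  exact h2

theorem iteratedDeriv_chart_line (hn1 : n ≠ 0) (hn : n + 1 ≤ n)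
    {e : OpenPartialHomeomorph E (F × K)}
    {y₀ : F × K} (ha : a ∈ e.source) (hy₀ : e a = y₀) (he : ContDiffAt ℂ n e a)
    (he' : ContDiffAt ℂ n e.symm (e a)) (v : K) {φ : E → ℂ} (hφ : ContDiffAt ℂ n φ a) (k : ℕ) :
    iteratedDeriv k (fun t : ℂ => φ (e.symm (y₀ + t • ((0 : F), v)))) =ᶠ[𝓝 0]
      fun t => ((chartDeriv e v)^[k] φ) (e.symm (y₀ + t • ((0 : F), v))) := by
  have h1n : (1 : ℕ∞ω) ≤ n := ENat.one_le_iff_ne_zero_withTop.mpr hn1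
  have hsm : ∀ k, ContDiffAt ℂ n ((chartDeriv e v)^[k] φ) a := by
    intro k
    induction k with
    | zero => exact hφ
    | succ k ih =>
      rw [Function.iterate_succ_apply']
      exact contDiffAt_chartDeriv hn ha he he' v ih
  have hl : Tendsto (fun t : ℂ => y₀ + t • ((0 : F), v)) (𝓝 0) (𝓝 (e a)) := by
    have : Continuous (fun t : ℂ => y₀ + t • ((0 : F), v)) := by fun_prop
    simpa [hy₀] using this.tendsto 0
  induction k with
  | zero => simp
  | succ k ih =>
    rw [iteratedDeriv_succ, Function.iterate_succ_apply']
    refine ih.deriv.trans ?_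
    have hcomp : ContDiffAt ℂ n ((chartDeriv e v)^[k] φ ∘ e.symm) (e a) :=
      ContDiffAt.comp (e a) (by rw [e.left_inv ha]; exact hsm k) he'
    have hdiff : ∀ᶠ y in 𝓝 (e a), DifferentiableAt ℂ ((chartDeriv e v)^[k] φ ∘ e.symm) y :=
      ((hcomp.of_le h1n).eventually (by simp)).mono fun x hx => hx.differentiableAt (by simp)
    filter_upwards [hl.eventually hdiff,
      hl.eventually (e.open_target.mem_nhds (e.map_source ha))] with t ht1 ht2
    have h1 : HasDerivAt (fun t : ℂ => y₀ + t • ((0 : F), v)) ((0 : F), v) t := by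
      simpa using ((hasDerivAt_id t).smul_const ((0 : F), v)).const_add y₀
    have h2 := (ht1.hasFDerivAt.comp_hasDerivAt t h1).deriv
    rw [chartDeriv, e.right_inv ht2, ← h2]
    rfl

/-- Let `A` be a subset of the zero set of a submersion `g`, such that the smooth functions that
vanish on `A` have differentials vanishing on the tangent spaces of `{g = 0}` at the points of `A`.
Then holomorphic functions that vanish on `A` vanish on `{g = 0}`, locally near points of `A`. -/
theorem eventually_eq_zero_of_tangential [FiniteDimensional ℂ E] [FiniteDimensional ℂ F]
    (hn1 : n ≠ 0) (hn : n + 1 ≤ n) (haA : a ∈ A)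
    (hg : ContDiffAt ℂ n g a) (hsurj : Function.Surjective (fderiv ℂ g a))
    (hA : ∀ᶠ x in 𝓝 a, x ∈ A → g x = 0)
    (hyp : ∀ φ : E → ℂ, ContDiffAt ℂ n φ a → (∀ᶠ x in 𝓝 a, x ∈ A → φ x = 0) →
      ∀ᶠ x in 𝓝 a, x ∈ A → ∀ X, fderiv ℂ g x X = 0 → fderiv ℂ φ x X = 0)
    {φ : E → ℂ} (hφ : ContDiffAt ℂ n φ a) (hz : ∀ᶠ x in 𝓝 a, x ∈ A → φ x = 0) :
    ∀ᶠ x in 𝓝 a, g x = 0 → φ x = 0 := by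
  obtain ⟨π, e, ha, heq, he, he'⟩ := exists_straightening hn1 hg hsurj
  have h1n : (1 : ℕ∞ω) ≤ n := ENat.one_le_iff_ne_zero_withTop.mpr hn1
  have hga : g a = 0 := hA.self_of_nhds haA
  have hea : e a = (0, π a) := by rw [heq, hga]
  -- The hypothesis `hyp` feeds itself: a tangential derivative of a function vanishing on A again
  -- vanishes on A, so all tangential derivatives vanish at a and the Taylor series along {g = 0} is
  -- zero.
  have hk : ∀ v k, ((chartDeriv e v)^[k] φ) a = 0 := by
    intro v k
    suffices h : ContDiffAt ℂ n ((chartDeriv e v)^[k] φ) a ∧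
        ∀ᶠ x in 𝓝 a, x ∈ A → ((chartDeriv e v)^[k] φ) x = 0 from h.2.self_of_nhds haA
    induction k with
    | zero => exact ⟨hφ, hz⟩
    | succ k ih =>
      rw [Function.iterate_succ_apply']
      exact ⟨contDiffAt_chartDeriv hn ha he he' v ih.1,
        eventually_chartDeriv_eq_zero hn1 ha heq he' hg hyp v ih.1 ih.2⟩
  have hcomp : ContDiffAt ℂ n (φ ∘ e.symm) (e a) :=
    ContDiffAt.comp (e a) (by rwa [e.left_inv ha]) he'
  have hdiff : ∀ᶠ y in 𝓝 (e a), DifferentiableAt ℂ (φ ∘ e.symm) y :=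
    ((hcomp.of_le h1n).eventually (by simp)).mono fun x hx => hx.differentiableAt (by simp)
  have hin : Tendsto (fun y => ((0 : F), y)) (𝓝 (π a)) (𝓝 (e a)) := by
    rw [hea]
    exact (Continuous.prodMk_right (0 : F)).tendsto _
  have h0 : ∀ᶠ y in 𝓝 (π a), φ (e.symm ((0 : F), y)) = 0 := by
    refine eventually_eq_zero_of_iteratedDeriv_line ?_ ?_
    · filter_upwards [hin.eventually hdiff] with y hy
      exact hy.comp y (by fun_prop)
    · intro v k
      have h := (iteratedDeriv_chart_line hn1 hn ha hea he he' v hφ k).self_of_nhds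
      have h2 : (fun t : ℂ => φ (e.symm ((0 : F), π a + t • v))) =
          fun t : ℂ => φ (e.symm ((0, π a) + t • ((0 : F), v))) := by
        ext t; simp
      rw [h2, h]
      simpa [← hea, e.left_inv ha] using hk v k
  have hπ : Tendsto π (𝓝 a) (𝓝 (π a)) := by
    have : ContinuousAt (fun x => (e x).2) a := continuous_snd.continuousAt.comp (e.continuousAt ha)
    simpa [ContinuousAt, heq] using this
  filter_upwards [hπ.eventually h0, e.open_source.mem_nhds ha] with x hx hxs hgx
  rw [← hgx, ← heq, e.left_inv hxs] at hx
  exact hx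

end TangentialDerivatives

/-! ### Regular points and the identity theorem on irreducible analytic sets. -/

section AnalyticSets

open scoped ContDiff
open Metric Set Filter

variable {n : ℕ}

theorem one_add_omega_le : (ω : ℕ∞ω) + 1 ≤ ω := le_top

theorem eventually_surjective_fderiv {E F : Type*} [NormedAddCommGroup E] [NormedSpace ℂ E]
    [NormedAddCommGroup F] [NormedSpace ℂ F] [FiniteDimensional ℂ F]
    {g : E → F} {a : E} (hg : AnalyticAt ℂ g a) (hs : Function.Surjective (fderiv ℂ g a)) :
    ∀ᶠ x in 𝓝 a, Function.Surjective (fderiv ℂ g x) := by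
  have : CompleteSpace F := FiniteDimensional.complete ℂ F
  obtain ⟨σ, hσ⟩ := (fderiv ℂ g a : E →L[ℂ] F).exists_rightInverse_of_surjective
    (LinearMap.range_eq_top.mpr hs)
  have hc : ContinuousAt (fun x => (fderiv ℂ g x).comp σ) a :=
    hg.fderiv.continuousAt.clm_comp continuousAt_const
  have hu : ∀ᶠ x in 𝓝 a, IsUnit ((fderiv ℂ g x).comp σ) := by
    refine hc.eventually (Units.isOpen.mem_nhds ?_)
    simp only [hσ]
    exact isUnit_one
  filter_upwards [hu] with x hx
  obtain ⟨u, hu⟩ := hx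
  intro y
  refine ⟨σ (u.inv y), ?_⟩
  have h1 : (u.val * u.inv) y = y := by rw [u.val_inv]; rfl
  rw [hu] at h1
  exact h1

/-- `S` lies, near `x`, in the zero set of an analytic submersion to `ℂʳ`. -/
def HasLocalRank (S : Set (ZW n)) (x : ZW n) (r : ℕ) : Prop :=
  ∃ g : ZW n → (Fin r → ℂ), AnalyticAt ℂ g x ∧ Function.Surjective (fderiv ℂ g x) ∧
    ∀ᶠ y in 𝓝 x, y ∈ S → g y = 0

theorem HasLocalRank.le {S : Set (ZW n)} {x : ZW n} {r : ℕ} (h : HasLocalRank S x r) :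
    r ≤ n + 1 := by
  obtain ⟨g, -, hs, -⟩ := h
  have := LinearMap.finrank_le_finrank_of_surjective
    (f := (fderiv ℂ g x).toLinearMap) hs
  simpa using this

/-- If a function vanishing on S had a differential nonzero on ker dg at a nearby point of S,
adjoining it to g would raise the rank. By maximality the tangential criterion applies, so the local
equations of S vanish on {g = 0}, and S coincides with this submanifold near x. -/
theorem mem_regularPart_of_maximal_rank {U S V : Set (ZW n)} (hS : IsAnalyticSubvariety U S)
    (hV : IsOpen V) {x : ZW n} (hxV : x ∈ V) (hxS : x ∈ S) {r : ℕ} (hr : HasLocalRank S x r)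
    (hmax : ∀ y ∈ S ∩ V, ¬ HasLocalRank S y (r + 1)) : x ∈ regularPart S := by
  obtain ⟨g, hg, hs, hz⟩ := hr
  have hvan : ∀ φ : ZW n → ℂ, AnalyticAt ℂ φ x → (∀ᶠ y in 𝓝 x, y ∈ S → φ y = 0) →
      ∀ᶠ y in 𝓝 x, g y = 0 → φ y = 0 := by
    intro φ hφ hφ0
    refine eventually_eq_zero_of_tangential (n := ω) (by simp) one_add_omega_le hxS hg.contDiffAt hs
      hz ?_ hφ.contDiffAt hφ0
    intro ψ hψ hψ0
    have hψa : AnalyticAt ℂ ψ x := hψ.analyticAt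
    filter_upwards [hg.eventually_analyticAt, hψa.eventually_analyticAt,
      eventually_surjective_fderiv hg hs, hz.eventually_nhds, hψ0.eventually_nhds,
      hV.mem_nhds hxV] with y hgy hψy hsy hzy hψ0y hyV hyS X hX
    by_contra hne
    refine hmax y ⟨hyS, hyV⟩ ⟨fun z => Fin.snoc (α := fun _ => ℂ) (g z) (ψ z), ?_, ?_, ?_⟩
    · rw [analyticAt_pi_iff]
      intro i
      refine Fin.lastCases ?_ (fun j => ?_) i
      · simpa using hψy
      · simpa using (analyticAt_pi_iff.mp hgy) j
    · have hd : fderiv ℂ (fun z => Fin.snoc (α := fun _ => ℂ) (g z) (ψ z)) y =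
          ContinuousLinearMap.pi fun i => Fin.snoc (α := fun _ => ZW n →L[ℂ] ℂ)
            (fun j => (ContinuousLinearMap.proj j).comp (fderiv ℂ g y)) (fderiv ℂ ψ y) i := by
        refine HasFDerivAt.fderiv (hasFDerivAt_pi.mpr fun i => ?_)
        refine Fin.lastCases ?_ (fun j => ?_) i
        · simpa using hψy.differentiableAt.hasFDerivAt
        · simpa using hasFDerivAt_pi'.mp hgy.differentiableAt.hasFDerivAt j
      rw [hd]
      intro w
      obtain ⟨Y, hY⟩ := hsy (fun j => w j.castSucc)
      refine ⟨Y + ((w (Fin.last r) - fderiv ℂ ψ y Y) / fderiv ℂ ψ y X) • X, ?_⟩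
      ext i
      refine Fin.lastCases ?_ (fun j => ?_) i
      · simp [hne]
      · simp [hX, hY]
    · filter_upwards [hzy, hψ0y] with z hz1 hz2 hzS
      ext i
      refine Fin.lastCases ?_ (fun j => ?_) i
      · simpa using hz2 hzS
      · simpa using congrFun (hz1 hzS) j
  obtain ⟨V₁, hV₁, hxV₁, s, q, hq, hSV₁⟩ := hS.2 x (hS.1 hxS)
  have hqz : ∀ᶠ y in 𝓝 x, ∀ i, g y = 0 → q i y = 0 := by
    refine eventually_all.mpr fun i => hvan (q i) (hq i x hxV₁) ?_
    filter_upwards [hV₁.mem_nhds hxV₁] with y hy hyS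
    have : y ∈ S ∩ V₁ := ⟨hyS, hy⟩
    rw [hSV₁] at this
    exact this.2 i
  obtain ⟨V₂, hV₂, hV₂o, hxV₂⟩ := _root_.eventually_nhds_iff.mp
    ((hqz.and hz).and (hg.eventually_analyticAt.and (hV₁.mem_nhds hxV₁)))
  refine ⟨hxS, V₂, hV₂o, hxV₂, r, g, fun y hy => (hV₂ y hy).2.1, hs, ?_⟩
  ext y
  constructor
  · rintro ⟨hyS, hy⟩
    exact ⟨hy, (hV₂ y hy).1.2 hyS⟩
  · rintro ⟨hy, hgy⟩
    have : y ∈ S ∩ V₁ := by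
      rw [hSV₁]
      exact ⟨(hV₂ y hy).2.2, fun i => (hV₂ y hy).1.1 i hgy⟩
    exact ⟨this.1, hy⟩

/-- The regular points of an analytic subvariety are dense in it. -/
theorem exists_mem_regularPart {U S V : Set (ZW n)} (hS : IsAnalyticSubvariety U S)
    (hV : IsOpen V) {q : ZW n} (hqV : q ∈ V) (hqS : q ∈ S) : ∃ x ∈ V, x ∈ regularPart S := by
  classical
  have hex : ∃ r, ∃ y ∈ S ∩ V, HasLocalRank S y r :=
    ⟨0, q, ⟨hqS, hqV⟩, fun _ => 0, analyticAt_const, fun w => ⟨0, Subsingleton.elim _ _⟩,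
      Eventually.of_forall fun _ _ => rfl⟩
  -- Ranks are bounded by n + 1, so a point of S ∩ V of largest rank exists.
  set P : ℕ → Prop := fun r => ∃ y ∈ S ∩ V, HasLocalRank S y r with hP
  obtain ⟨r₀, hr₀⟩ := hex
  have hb : ∀ r, P r → r ≤ n + 1 := fun r ⟨y, _, h⟩ => h.le
  have hr : P (Nat.findGreatest P (n + 1)) := Nat.findGreatest_spec (hb r₀ hr₀) hr₀
  obtain ⟨x, hx, hrank⟩ := hr
  refine ⟨x, hx.2, mem_regularPart_of_maximal_rank hS hV hx.2 hx.1 hrank fun y hy h => ?_⟩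
  have h1 : P (Nat.findGreatest P (n + 1) + 1) := ⟨y, hy, h⟩
  have := Nat.le_findGreatest (hb _ h1) h1
  omega

/-- Near a regular point of `S`, a holomorphic function that vanishes on `S` near points arbitrarily
close to the regular point vanishes on `S`. -/
theorem eventually_zero_of_frequently_eventually_zero {S : Set (ZW n)} {q : ZW n}
    (hq : q ∈ regularPart S) {f : ZW n → ℂ} (hf : ∀ᶠ x in 𝓝 q, DifferentiableAt ℂ f x)
    (hfr : ∃ᶠ x in 𝓝 q, x ∈ S ∧ ∀ᶠ y in 𝓝 x, y ∈ S → f y = 0) :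
    ∀ᶠ y in 𝓝 q, y ∈ S → f y = 0 := by
  obtain ⟨hqS, V, hV, hqV, r, g, hg, hs, hSV⟩ := hq
  have hgq : g q = 0 := by
    have : q ∈ S ∩ V := ⟨hqS, hqV⟩
    rw [hSV] at this
    exact this.2
  obtain ⟨π, e, ha, heq, he, he'⟩ := exists_straightening (n := ω) (by simp)
    (hg q hqV).contDiffAt hs
  have hea : e q = (0, π q) := by rw [heq, hgq]
  have hsd : ∀ᶠ y in 𝓝 (e q), DifferentiableAt ℂ e.symm y :=
    he'.analyticAt.eventually_analyticAt.mono fun y hy => hy.differentiableAt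
  have hsc : Tendsto e.symm (𝓝 (e q)) (𝓝 q) := by
    simpa [ContinuousAt, e.left_inv ha] using e.continuousAt_symm (e.map_source ha)
  have hin : Tendsto (fun y => ((0 : Fin r → ℂ), y)) (𝓝 (π q)) (𝓝 (e q)) := by
    rw [hea]
    exact (Continuous.prodMk_right (0 : Fin r → ℂ)).tendsto _
  obtain ⟨δ, hδ, hball⟩ := Metric.eventually_nhds_iff_ball.mp (hin.eventually
    ((hsd.and (hsc.eventually (hf.and (hV.mem_nhds hqV)))).and
      (e.open_target.mem_nhds (e.map_source ha))))
  have hdiff : DifferentiableOn ℂ (fun y => f (e.symm ((0 : Fin r → ℂ), y))) (ball (π q) δ) := by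
    intro y hy
    have h1 := (hball y hy).1
    have h2 : DifferentiableAt ℂ (fun y => e.symm ((0 : Fin r → ℂ), y)) y :=
      DifferentiableAt.comp y h1.1 (by fun_prop)
    exact (DifferentiableAt.comp y h1.2.1 h2).differentiableWithinAt
  have hπ : ∀ x ∈ e.source, ContinuousAt π x := by
    intro x hx
    have : ContinuousAt (fun x => (e x).2) x := continuous_snd.continuousAt.comp (e.continuousAt hx)
    simpa [heq] using this
  have hnear : ∀ᶠ x in 𝓝 q, x ∈ e.source ∧ x ∈ V ∧ π x ∈ ball (π q) δ :=
    (e.open_source.mem_nhds ha |> fun h => Filter.Eventually.and h ((hV.mem_nhds hqV) |> fun h =>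
      Filter.Eventually.and h ((hπ q ha).eventually (ball_mem_nhds _ hδ))))
  have hS0 : ∀ x ∈ V, (x ∈ S ↔ g x = 0) := by
    intro x hx
    have : x ∈ S ∩ V ↔ x ∈ {Z ∈ V | g Z = 0} := by rw [hSV]
    simpa [hx] using this
  obtain ⟨x, ⟨hxS, hx0⟩, hxs, hxV, hxb⟩ := (hfr.and_eventually hnear).exists
  have hex : e x = (0, π x) := by rw [heq, (hS0 x hxV).mp hxS]
  have hzero : ∀ᶠ y in 𝓝 (π x), f (e.symm ((0 : Fin r → ℂ), y)) = 0 := by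
    have hcx : Tendsto (fun y => e.symm ((0 : Fin r → ℂ), y)) (𝓝 (π x)) (𝓝 x) := by
      have h1 : Tendsto (fun y => ((0 : Fin r → ℂ), y)) (𝓝 (π x)) (𝓝 (e x)) := by
        rw [hex]
        exact (Continuous.prodMk_right (0 : Fin r → ℂ)).tendsto _
      have h2 : Tendsto e.symm (𝓝 (e x)) (𝓝 x) := by
        simpa [ContinuousAt, e.left_inv hxs] using e.continuousAt_symm (e.map_source hxs)
      exact h2.comp h1
    filter_upwards [hcx.eventually hx0, isOpen_ball.mem_nhds hxb] with y hy hyb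
    refine hy ?_
    obtain ⟨⟨-, -, hyV⟩, hyt⟩ := hball y hyb
    rw [hS0 _ hyV]
    have := congrArg Prod.fst (heq (e.symm (0, y)))
    rw [e.right_inv hyt] at this
    exact this.symm
  have hall := eqOn_zero_of_convex isOpen_ball (convex_ball _ _) hdiff hxb hzero
  filter_upwards [hnear] with y hy hyS
  have hey : e y = (0, π y) := by rw [heq, (hS0 y hy.2.1).mp hyS]
  have := hall (π y) hy.2.2
  rwa [← hey, e.left_inv hy.1] at this

/-- Identity theorem on an irreducible subvariety. -/
theorem IsIrreducibleSubvariety.eq_zero {U S : Set (ZW n)} (hS : IsIrreducibleSubvariety U S)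
    (hU : IsOpen U) {f : ZW n → ℂ} (hf : DifferentiableOn ℂ f U) {p : ZW n} (hp : p ∈ S)
    (h0 : ∀ᶠ y in 𝓝 p, y ∈ S → f y = 0) : ∀ y ∈ S, f y = 0 := by
  have hfe : ∀ q ∈ S, ∀ᶠ x in 𝓝 q, DifferentiableAt ℂ f x := fun q hq =>
    (hU.eventually_mem (hS.1.1 hq)).mono fun x hx => hf.differentiableAt (hU.mem_nhds hx)
  set Z : Set (ZW n) := {x | ∀ᶠ y in 𝓝 x, y ∈ S → f y = 0} with hZ
  have hZo : IsOpen Z := isOpen_iff_mem_nhds.mpr fun x hx => eventually_eventually_nhds.mpr hx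
  have hsub : regularPart S ⊆ Z := by
    -- Z and N are open and cover the regular part, because a regular point that is a limit of
    -- points of S ∩ Z lies in Z. Connectedness then leaves only Z.
    set N : Set (ZW n) := {x | ∀ᶠ y in 𝓝 x, y ∈ S → y ∉ Z} with hN
    have hNo : IsOpen N := isOpen_iff_mem_nhds.mpr fun x hx => eventually_eventually_nhds.mpr hx
    have hcov : regularPart S ⊆ Z ∪ N := by
      intro q hq
      refine or_iff_not_imp_right.mpr fun hqN => ?_
      refine eventually_zero_of_frequently_eventually_zero hq (hfe q hq.1) ?_
      refine (not_eventually.mp hqN).mono fun x hx => ?_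
      push Not at hx
      exact hx
    have hne : (regularPart S ∩ Z).Nonempty := by
      obtain ⟨V, hV, hVo, hpV⟩ := _root_.eventually_nhds_iff.mp h0
      obtain ⟨x, hxV, hx⟩ := exists_mem_regularPart hS.1 hVo hpV hp
      exact ⟨x, hx, _root_.eventually_nhds_iff.mpr ⟨V, hV, hVo, hxV⟩⟩
    intro q hq
    by_contra hqZ
    obtain ⟨x, hx, hxZ, hxN⟩ := hS.2.isPreconnected Z N hZo hNo hcov hne
      ⟨q, hq, (hcov hq).resolve_left hqZ⟩
    exact (show ∀ᶠ y in 𝓝 x, y ∈ S → y ∉ Z from hxN).self_of_nhds hx.1 hxZ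
  -- Vanishing passes from the regular part to all of S by density and continuity.
  intro y hy
  by_contra hne
  have hcont : ContinuousAt f y := (hfe y hy).self_of_nhds.continuousAt
  obtain ⟨V, hV, hVo, hyV⟩ := _root_.eventually_nhds_iff.mp (hcont.eventually_ne hne)
  obtain ⟨x, hxV, hx⟩ := exists_mem_regularPart hS.1 hVo hyV hy
  exact hV x hxV ((hsub hx).self_of_nhds hx.1)

/-- Where one factor is nonzero it stays nonzero nearby, so the other vanishes on S near that point
and hence on all of S. -/
theorem IsIrreducibleSubvariety.eq_zero_or_eq_zero {U S : Set (ZW n)}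
    (hS : IsIrreducibleSubvariety U S)
    (hU : IsOpen U) {f g : ZW n → ℂ} (hf : DifferentiableOn ℂ f U) (hg : DifferentiableOn ℂ g U)
    (h0 : ∀ y ∈ S, f y * g y = 0) : (∀ y ∈ S, f y = 0) ∨ (∀ y ∈ S, g y = 0) := by
  by_contra! h
  obtain ⟨⟨y, hy, hfy⟩, hg'⟩ := h
  have hcont : ContinuousAt f y := (hf.differentiableAt (hU.mem_nhds (hS.1.1 hy))).continuousAt
  obtain ⟨z, hz, hgz⟩ := hg'
  refine hgz (hS.eq_zero hU hg hy ?_ z hz)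
  filter_upwards [hcont.eventually_ne hfy] with x hx hxS
  exact (mul_eq_zero.mp (h0 x hxS)).resolve_left hx

end AnalyticSets

/-! ### Calculus of mixed partial derivatives. -/

section MixedDerivatives

open scoped ContDiff
open Metric Set Filter

variable {n : ℕ} {V : Set (ZW n)} {f g r : ZW n → ℂ}

/-- The derivative in the direction `u`. -/
noncomputable def dirDeriv (u : ZW n) (f : ZW n → ℂ) : ZW n → ℂ := fun Z => fderiv ℂ f Z u

theorem DifferentiableOn.dirDeriv (hV : IsOpen V) (hf : DifferentiableOn ℂ f V) (u : ZW n) :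
    DifferentiableOn ℂ (dirDeriv u f) V := fun _ hx =>
  (differentiableAt_fderiv_apply hV hf hx u).differentiableWithinAt

theorem Set.EqOn.dirDeriv (hV : IsOpen V) (h : EqOn f g V) (u : ZW n) :
    EqOn (dirDeriv u f) (dirDeriv u g) V := by
  intro x hx
  have : f =ᶠ[𝓝 x] g := h.eventuallyEq_of_mem (hV.mem_nhds hx)
  simp only [_root_.dirDeriv, this.fderiv_eq]

theorem dirDeriv_comm (hV : IsOpen V) (hf : DifferentiableOn ℂ f V) (u v : ZW n) :
    EqOn (dirDeriv u (dirDeriv v f)) (dirDeriv v (dirDeriv u f)) V := by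
  intro x hx
  have hc : ContDiffAt ℂ ∞ f x :=
    (contDiffOn_infty_of_differentiableOn hV hf).contDiffAt (hV.mem_nhds hx)
  have hd : DifferentiableAt ℂ (fderiv ℂ f) x :=
    ((hc.fderiv_right (m := 1) (WithTop.coe_le_coe.mpr le_top)).differentiableAt (by simp))
  have hsymm : IsSymmSndFDerivAt ℂ f x :=
    hc.isSymmSndFDerivAt (by simpa using WithTop.coe_le_coe.mpr (le_top (a := (2 : ℕ∞))))
  have key : ∀ u v : ZW n, fderiv ℂ (fun y => fderiv ℂ f y v) x u =
      fderiv ℂ (fderiv ℂ f) x u v := by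
    intro u v
    rw [fderiv_clm_apply hd (differentiableAt_const v)]
    simp
  exact (key u v).trans ((hsymm u v).trans (key v u).symm)

theorem DifferentiableOn.iterate_dirDeriv (hV : IsOpen V) (hf : DifferentiableOn ℂ f V) (u : ZW n)
    (k : ℕ) : DifferentiableOn ℂ ((_root_.dirDeriv u)^[k] f) V := by
  induction k with
  | zero => exact hf
  | succ k ih => rw [Function.iterate_succ_apply']; exact ih.dirDeriv hV u

theorem Set.EqOn.iterate_dirDeriv (hV : IsOpen V) (h : EqOn f g V) (u : ZW n) (k : ℕ) :
    EqOn ((_root_.dirDeriv u)^[k] f) ((_root_.dirDeriv u)^[k] g) V := by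
  induction k with
  | zero => exact h
  | succ k ih => simp only [Function.iterate_succ_apply']; exact ih.dirDeriv hV u

theorem dirDeriv_iterate_comm (hV : IsOpen V) (hf : DifferentiableOn ℂ f V) (u v : ZW n) (k : ℕ) :
    EqOn (dirDeriv u ((dirDeriv v)^[k] f)) ((dirDeriv v)^[k] (dirDeriv u f)) V := by
  induction k with
  | zero => exact fun _ _ => rfl
  | succ k ih =>
    simp only [Function.iterate_succ_apply']
    exact (dirDeriv_comm hV (hf.iterate_dirDeriv hV v k) u v).trans (ih.dirDeriv hV v)

/-- The mixed derivative in the variables `z_i`, for `i` in a list. -/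
noncomputable def listDeriv (β : Fin n → ℕ) (l : List (Fin n)) (f : ZW n → ℂ) : ZW n → ℂ :=
  l.foldr (fun i g => (dirDeriv (Pi.single i 1, 0))^[β i] g) f

theorem DifferentiableOn.listDeriv (hV : IsOpen V) (hf : DifferentiableOn ℂ f V) (β : Fin n → ℕ)
    (l : List (Fin n)) : DifferentiableOn ℂ (listDeriv β l f) V := by
  induction l with
  | nil => exact hf
  | cons i l ih => exact ih.iterate_dirDeriv hV _ _

theorem dirDeriv_listDeriv_comm (hV : IsOpen V) (hf : DifferentiableOn ℂ f V) (u : ZW n)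
    (β : Fin n → ℕ) (l : List (Fin n)) :
    EqOn (dirDeriv u (listDeriv β l f)) (listDeriv β l (dirDeriv u f)) V := by
  induction l with
  | nil => exact fun _ _ => rfl
  | cons i l ih =>
    exact (dirDeriv_iterate_comm hV (hf.listDeriv hV β l) u _ _).trans (ih.iterate_dirDeriv hV _ _)

theorem listDeriv_add_single_of_notMem (β : Fin n → ℕ) {i : Fin n} {l : List (Fin n)}
    (hi : i ∉ l) (f : ZW n → ℂ) : listDeriv (β + Pi.single i 1) l f = listDeriv β l f := by
  induction l with
  | nil => rfl
  | cons j l ih =>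
    have hij : j ≠ i := fun h => hi (by simp [h])
    have h1 := ih (fun h => hi (by simp [h]))
    simp only [listDeriv, List.foldr_cons] at h1 ⊢
    rw [h1]
    simp [hij]

/-- The extra derivative is commuted outward past the later variables; absence of repetition makes
it occur only once. -/
theorem listDeriv_add_single_of_mem (hV : IsOpen V) (hf : DifferentiableOn ℂ f V)
    (β : Fin n → ℕ) {i : Fin n} {l : List (Fin n)} (hl : l.Nodup) (hi : i ∈ l) :
    EqOn (listDeriv (β + Pi.single i 1) l f) (dirDeriv (Pi.single i 1, 0) (listDeriv β l f)) V := by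
  induction l with
  | nil => simp at hi
  | cons j l ih =>
    rw [List.nodup_cons] at hl
    by_cases hij : i = j
    · subst hij
      have h1 := listDeriv_add_single_of_notMem β hl.1 f
      simp only [listDeriv, List.foldr_cons] at h1 ⊢
      rw [h1]
      simp only [Pi.add_apply, Pi.single_eq_same, Function.iterate_succ_apply']
      exact fun _ _ => rfl
    · have hi' : i ∈ l := by simpa [hij] using hi
      have h1 := ih hl.2 hi'
      have h2 : (β + Pi.single i 1 : Fin n → ℕ) j = β j := by simp [Ne.symm hij]
      have h3 := (h1.iterate_dirDeriv hV (Pi.single j 1, 0) (β j)).trans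
        (dirDeriv_iterate_comm hV (hf.listDeriv hV β l) (Pi.single i 1, 0)
          (Pi.single j 1, 0) (β j)).symm
      intro x hx
      have h4 := h3 hx
      simp only [listDeriv, List.foldr_cons, h2] at h4 ⊢
      exact h4

theorem DifferentiableOn.mixedDeriv (hV : IsOpen V) (hf : DifferentiableOn ℂ f V) (β : Fin n → ℕ)
    (s : ℕ) : DifferentiableOn ℂ (mixedDeriv β s f) V :=
  (hf.iterate_dirDeriv hV _ _).listDeriv hV _ _

theorem mixedDeriv_add_single (hV : IsOpen V) (hf : DifferentiableOn ℂ f V) (β : Fin n → ℕ)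
    (s : ℕ) (i : Fin n) :
    EqOn (mixedDeriv (β + Pi.single i 1) s f) (derivZ i (mixedDeriv β s f)) V :=
  listDeriv_add_single_of_mem hV (hf.iterate_dirDeriv hV _ _) β (List.nodup_finRange n)
    (List.mem_finRange i)

theorem mixedDeriv_succ (hV : IsOpen V) (hf : DifferentiableOn ℂ f V) (β : Fin n → ℕ) (s : ℕ) :
    EqOn (mixedDeriv β (s + 1) f) (derivW (mixedDeriv β s f)) V := by
  have h := dirDeriv_listDeriv_comm hV (hf.iterate_dirDeriv hV (0, 1) s) (0, 1) β (List.finRange n)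
  rw [← Function.iterate_succ_apply' (f := dirDeriv ((0 : Fin n → ℂ), (1 : ℂ)))] at h
  exact h.symm

theorem mixedDeriv_zero (s : ℕ) (f : ZW n → ℂ) : mixedDeriv 0 s f = derivW^[s] f := by
  have : ∀ (l : List (Fin n)) (f : ZW n → ℂ), listDeriv 0 l f = f := by
    intro l
    induction l with
    | nil => exact fun _ => rfl
    | cons i l ih => intro f; simp [listDeriv]
  exact this _ _

/-- The family of all mixed derivatives of `f` at `Z`. -/
noncomputable def jet (f : ZW n → ℂ) (Z : ZW n) (b : (Fin n → ℕ) × ℕ) : ℂ :=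
  mixedDeriv b.1 b.2 f Z

theorem rhoDeriv_eq_jet (ρ : ZW n × ZW n → ℂ) (P ζ : ZW n) :
    rhoDeriv ρ P ζ = jet (fun Z => ρ (Z, star ζ)) P := rfl

theorem jet_zero_one (f : ZW n → ℂ) (Z : ZW n) : jet f Z (0, 1) = derivW f Z := by
  simp [jet, mixedDeriv_zero]

theorem jet_single (hV : IsOpen V) (hf : DifferentiableOn ℂ f V) {Z : ZW n} (hZ : Z ∈ V)
    (i : Fin n) : jet f Z (Pi.single i 1, 0) = derivZ i f Z := by
  have := mixedDeriv_add_single hV hf 0 0 i hZ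
  rw [zero_add, mixedDeriv_zero] at this
  exact this

end MixedDerivatives

/-! ### Polynomials in formal derivatives of ρ: derivations, weights and degrees. -/

section JetPolynomials

open scoped ContDiff
open Metric Set Filter

open MvPolynomial

variable {n : ℕ}

/-- The index of `∂/∂z_i`. -/
abbrev zIdx (i : Fin n) : (Fin n → ℕ) × ℕ := (Pi.single i 1, 0)

/-- The index of `∂/∂w`. -/
abbrev wIdx : (Fin n → ℕ) × ℕ := (0, 1)

/-- The formal derivative `∂/∂z_i` of polynomials in the jet variables. -/
noncomputable def jetDZ (i : Fin n) : Derivation ℂ (JetPoly n) (JetPoly n) :=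
  mkDerivation ℂ fun b => X (b.1 + Pi.single i 1, b.2)

/-- The formal derivative `∂/∂w` of polynomials in the jet variables. -/
noncomputable def jetDW : Derivation ℂ (JetPoly n) (JetPoly n) :=
  mkDerivation ℂ fun b => X (b.1, b.2 + 1)

/-- The formal derivation `ρ_w ∂/∂z_i - ρ_{z_i} ∂/∂w`, tangent to the Segre varieties. -/
noncomputable def jetL (i : Fin n) (P : JetPoly n) : JetPoly n :=
  X wIdx * jetDZ i P - X (zIdx i) * jetDW P

theorem jetL_mul (i : Fin n) (P Q : JetPoly n) : jetL i (P * Q) = jetL i P * Q + P * jetL i Q := by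
  simp only [jetL, Derivation.leibniz, smul_eq_mul]
  ring

theorem jetL_sub (i : Fin n) (P Q : JetPoly n) : jetL i (P - Q) = jetL i P - jetL i Q := by
  simp only [jetL, map_sub]
  ring

theorem jetL_X (i : Fin n) (b : (Fin n → ℕ) × ℕ) : jetL i (X b) =
    X wIdx * X (b.1 + Pi.single i 1, b.2) - X (zIdx i) * X (b.1, b.2 + 1) := by
  simp [jetL, jetDZ, jetDW, mkDerivation_X]

/-- Polynomials of weight at most `a` and total degree at most `d` in the variables
`ρ_{z^β w^s}` with `0 < |β| + s ≤ k` and `|β| < k`. -/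
inductive JetBound : ℕ → ℕ → ℕ → JetPoly n → Prop
  | const (k : ℕ) (c : ℂ) : JetBound k 0 0 (C c)
  | var (k : ℕ) (b : (Fin n → ℕ) × ℕ) (h0 : 0 < multiLength b.1 + b.2)
      (hk : multiLength b.1 + b.2 ≤ k) (hlt : multiLength b.1 < k) :
      JetBound k (2 * multiLength b.1 + b.2 - 1) 1 (X b)
  | add {k a d : ℕ} {P Q : JetPoly n} : JetBound k a d P → JetBound k a d Q →
      JetBound k a d (P + Q)
  | mul {k a d a' d' : ℕ} {P Q : JetPoly n} : JetBound k a d P → JetBound k a' d' Q →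
      JetBound k (a + a') (d + d') (P * Q)
  | mono {k a d k' a' d' : ℕ} {P : JetPoly n} : JetBound k a d P → k ≤ k' → a ≤ a' → d ≤ d' →
      JetBound k' a' d' P

namespace JetBound

variable {k a d : ℕ} {P Q : JetPoly n}

theorem zero : JetBound k a d (0 : JetPoly n) := by
  have := JetBound.const (n := n) k 0
  rw [C_0] at this
  exact this.mono le_rfl (Nat.zero_le _) (Nat.zero_le _)

theorem one : JetBound k a d (1 : JetPoly n) := by
  have := JetBound.const (n := n) k 1
  rw [C_1] at this
  exact this.mono le_rfl (Nat.zero_le _) (Nat.zero_le _)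

theorem const_mul (c : ℂ) (h : JetBound k a d P) : JetBound k a d (C c * P) := by
  have := (JetBound.const (n := n) k c).mul h
  rwa [zero_add, zero_add] at this

theorem neg (h : JetBound k a d P) : JetBound k a d (-P) := by
  have := h.const_mul (-1)
  simpa using this

theorem sub (h : JetBound k a d P) (h' : JetBound k a d Q) : JetBound k a d (P - Q) := by
  rw [sub_eq_add_neg]
  exact h.add h'.neg

theorem sum {ι : Type*} (s : Finset ι) {p : ι → JetPoly n} (h : ∀ i ∈ s, JetBound k a d (p i)) :
    JetBound k a d (∑ i ∈ s, p i) :=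
  Finset.sum_induction p _ (fun _ _ => JetBound.add) zero h

theorem listSum (l : List (JetPoly n)) (h : ∀ p ∈ l, JetBound k a d p) : JetBound k a d l.sum := by
  induction l with
  | nil => exact zero
  | cons p l ih =>
    rw [List.sum_cons]
    exact (h p (by simp)).add (ih fun q hq => h q (by simp [hq]))

theorem prod {ι : Type*} (s : Finset ι) {p : ι → JetPoly n} {w e : ι → ℕ}
    (h : ∀ i ∈ s, JetBound k (w i) (e i) (p i)) :
    JetBound k (∑ i ∈ s, w i) (∑ i ∈ s, e i) (∏ i ∈ s, p i) := by
  classical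
  induction s using Finset.induction_on with
  | empty => simpa using one
  | insert i s hi ih =>
    rw [Finset.sum_insert hi, Finset.sum_insert hi, Finset.prod_insert hi]
    exact (h i (by simp)).mul (ih fun j hj => h j (by simp [hj]))

theorem pow (h : JetBound k a d P) (m : ℕ) : JetBound k (m * a) (m * d) (P ^ m) := by
  simpa using prod (Finset.range m) (fun i _ => h)

theorem natCast_mul (c : ℕ) (h : JetBound k a d P) : JetBound k a d ((c : JetPoly n) * P) := by
  simpa using h.const_mul (c : ℂ)

/-- Both |β| and the order grow by one, so the strict condition |β| < k persists with k + 1; the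
weight of a variable grows by two. -/
theorem jetDZ (i : Fin n) (h : JetBound k a d P) :
    JetBound (k + 1) (a + 2) d (jetDZ i P) := by
  induction h with
  | const k c => simpa [_root_.jetDZ] using zero
  | var k b h0 hk hlt =>
    have hlen : multiLength (b.1 + Pi.single i 1) = multiLength b.1 + 1 := by
      simp [multiLength, Finset.sum_add_distrib]
    have := JetBound.var (k + 1) (b.1 + Pi.single i 1, b.2) (by simp only [hlen]; omega)
      (by simp only [hlen]; omega) (by simp only [hlen]; omega)
    simp only [hlen] at this
    simpa [_root_.jetDZ, mkDerivation_X] using this.mono le_rfl (by omega) le_rfl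
  | add _ _ ih1 ih2 => rw [map_add]; exact ih1.add ih2
  | mul h1 h2 ih1 ih2 =>
    rw [Derivation.leibniz, smul_eq_mul, smul_eq_mul]
    exact (((h1.mono (Nat.le_succ _) le_rfl le_rfl).mul ih2).mono le_rfl (by omega) le_rfl).add
      (((h2.mono (Nat.le_succ _) le_rfl le_rfl).mul ih1).mono le_rfl (by omega) (by omega))
  | mono _ hk ha hd ih => exact ih.mono (by omega) (by omega) hd

theorem jetDW (h : JetBound k a d P) : JetBound (k + 1) (a + 1) d (jetDW P) := by
  induction h with
  | const k c => simpa [_root_.jetDW] using zero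
  | var k b h0 hk hlt =>
    have := JetBound.var (k + 1) (b.1, b.2 + 1) (by simp only; omega)
      (by simp only; omega) (by simp only; omega)
    simpa [_root_.jetDW, mkDerivation_X] using this.mono le_rfl (by simp only; omega) le_rfl
  | add _ _ ih1 ih2 => rw [map_add]; exact ih1.add ih2
  | mul h1 h2 ih1 ih2 =>
    rw [Derivation.leibniz, smul_eq_mul, smul_eq_mul]
    exact (((h1.mono (Nat.le_succ _) le_rfl le_rfl).mul ih2).mono le_rfl (by omega) le_rfl).add
      (((h2.mono (Nat.le_succ _) le_rfl le_rfl).mul ih1).mono le_rfl (by omega) (by omega))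
  | mono _ hk ha hd ih => exact ih.mono (by omega) (by omega) hd

theorem X_wIdx (hk : 1 ≤ k) : JetBound k 0 1 (X wIdx : JetPoly n) := by
  have hlen : multiLength (0 : Fin n → ℕ) = 0 := by simp [multiLength]
  simpa [hlen] using JetBound.var k (wIdx (n := n)) (by simp [hlen]) (by simpa [hlen])
    (by simp only [hlen]; omega)

theorem X_zIdx (hk : 2 ≤ k) (i : Fin n) : JetBound k 1 1 (X (zIdx i) : JetPoly n) := by
  have hlen : multiLength (Pi.single i 1 : Fin n → ℕ) = 1 := by simp [multiLength]
  simpa [hlen] using JetBound.var k (zIdx i) (by simp [hlen]) (by simp only [hlen]; omega)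
    (by simp only [hlen]; omega)

/-- Both terms raise the weight by two: ρ_w has weight 0 and ∂_z adds 2, while ρ_{z_i} has weight 1
and ∂_w adds 1. The prefactors raise the degree by one. -/
theorem jetL (hk : 1 ≤ k) (i : Fin n) (h : JetBound k a d P) :
    JetBound (k + 1) (a + 2) (d + 1) (jetL i P) := by
  refine JetBound.sub ?_ ?_
  · exact ((X_wIdx (by omega)).mul (h.jetDZ i)).mono le_rfl (by omega) (by omega)
  · exact ((X_zIdx (by omega) i).mul h.jetDW).mono le_rfl (by omega) (by omega)

theorem wt_le (h : JetBound k a d P) : P.wt ≤ a := by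
  unfold JetPoly.wt
  induction h with
  | const k c =>
    refine Finset.sup_le fun m hm => ?_
    have := Finset.mem_singleton.mp (support_monomial_subset hm)
    simp [this]
  | var k b h0 hk hlt =>
    unfold weightedTotalDegree
    refine Finset.sup_le fun m hm => ?_
    rw [support_X, Finset.mem_singleton] at hm
    simp [hm, Finsupp.weight_single]
  | add _ _ ih1 ih2 =>
    refine Finset.sup_le fun m hm => ?_
    rcases Finset.mem_union.mp (support_add hm) with h | h
    · exact (le_weightedTotalDegree _ h).trans ih1
    · exact (le_weightedTotalDegree _ h).trans ih2
  | mul _ _ ih1 ih2 =>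
    classical
    refine Finset.sup_le fun m hm => ?_
    obtain ⟨m1, h1, m2, h2, rfl⟩ := Finset.mem_add.mp (support_mul _ _ hm)
    rw [map_add]
    exact add_le_add ((le_weightedTotalDegree _ h1).trans ih1)
      ((le_weightedTotalDegree _ h2).trans ih2)
  | mono _ hk ha hd ih => exact ih.trans ha

/-- The index d bounds the total degree, which dominates the degree in ρ_w. -/
theorem degRhoW_le (h : JetBound k a d P) : P.degRhoW ≤ d := by
  unfold JetPoly.degRhoW
  induction h with
  | const k c => simp
  | var k b h0 hk hlt =>
    classical
    rw [degreeOf_X]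
    split <;> simp
  | add _ _ ih1 ih2 => exact (degreeOf_add_le _ _ _).trans (max_le ih1 ih2)
  | mul _ _ ih1 ih2 => exact (degreeOf_mul_le _ _ _).trans (add_le_add ih1 ih2)
  | mono _ hk ha hd ih => exact ih.trans hd

theorem involvesOnly (h : JetBound k a d P) : P.InvolvesOnly k := by
  classical
  induction h with
  | const k c => intro b hb; simp at hb
  | var k b h0 hk hlt =>
    intro b' hb'
    simp only [vars_X, Finset.mem_singleton] at hb'
    subst hb'
    exact ⟨h0, hk, hlt⟩
  | add _ _ ih1 ih2 =>
    intro b hb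
    rcases Finset.mem_union.mp (vars_add_subset _ _ hb) with h | h
    exacts [ih1 b h, ih2 b h]
  | mul _ _ ih1 ih2 =>
    intro b hb
    rcases Finset.mem_union.mp (vars_mul _ _ hb) with h | h
    exacts [ih1 b h, ih2 b h]
  | mono _ hk ha hd ih =>
    intro b hb
    obtain ⟨h1, h2, h3⟩ := ih b hb
    exact ⟨h1, h2.trans hk, h3.trans_le hk⟩

end JetBound

end JetPolynomials

/-! ### Differential consequences of vanishing on a Segre variety. -/

section SegreExpansion

open scoped ContDiff
open Metric Set Filter

open MvPolynomial

variable {n : ℕ} {V : Set (ZW n)} {f g r : ZW n → ℂ}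

theorem multiLength_add_single (β : Fin n → ℕ) (i : Fin n) :
    multiLength (β + Pi.single i 1) = multiLength β + 1 := by
  simp [multiLength, Finset.sum_add_distrib]

theorem exists_eq_add_single {β : Fin n → ℕ} {k : ℕ} (h : multiLength β = k + 1) :
    ∃ (γ : Fin n → ℕ) (i : Fin n), β = γ + Pi.single i 1 ∧ multiLength γ = k := by
  have : ∃ i, β i ≠ 0 := by
    by_contra! h'
    simp [multiLength, h'] at h
  obtain ⟨i, hi⟩ := this
  have hβ : β = (β - Pi.single i 1) + Pi.single i 1 := by
    ext j
    by_cases hj : j = i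
    · subst hj
      simp
      omega
    · simp [hj]
  refine ⟨β - Pi.single i 1, i, hβ, ?_⟩
  rw [hβ, multiLength_add_single] at h
  omega

/-- The vector field `r_w ∂/∂z_i - r_{z_i} ∂/∂w` tangent to the level sets of `r`. -/
noncomputable def segreL (i : Fin n) (r h : ZW n → ℂ) (Z : ZW n) : ℂ :=
  derivW r Z * derivZ i h Z - derivZ i r Z * derivW h Z

/-- Since r_w ≠ 0, {r = 0} is a submanifold, and r_w ∂_{z_i} - r_{z_i} ∂_w is tangent to it. -/
theorem segreL_eq_zero (hV : IsOpen V) (hr : DifferentiableOn ℂ r V)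
    (hf : DifferentiableOn ℂ f V) (hz : ∀ Z ∈ V, r Z = 0 → f Z = 0) {Z : ZW n} (hZ : Z ∈ V)
    (hw : derivW r Z ≠ 0) (hrZ : r Z = 0) (i : Fin n) : segreL i r f Z = 0 := by
  have hs : HasStrictFDerivAt r (fderiv ℂ r Z) Z :=
    ((contDiffOn_infty_of_differentiableOn hV hr).contDiffAt (hV.mem_nhds hZ)).hasStrictFDerivAt
      (by simp)
  have hfd : HasFDerivAt f (fderiv ℂ f Z) Z := (hf.differentiableAt (hV.mem_nhds hZ)).hasFDerivAt
  have hsurj : Function.Surjective (fderiv ℂ r Z) := fun c => by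
    refine ⟨(c / derivW r Z) • ((0 : Fin n → ℂ), (1 : ℂ)), ?_⟩
    rw [map_smul, smul_eq_mul]
    exact div_mul_cancel₀ c hw
  have hev : ∀ᶠ x in 𝓝 Z, r x = r Z → f x = 0 := by
    filter_upwards [hV.mem_nhds hZ] with x hx hrx
    exact hz x hx (hrx.trans hrZ)
  have := ker_le_ker_of_eventually_zero hs hsurj hfd hev
    (X := derivW r Z • (Pi.single i (1 : ℂ), (0 : ℂ)) - derivZ i r Z • ((0 : Fin n → ℂ), (1 : ℂ)))
    (by
      rw [map_sub, map_smul, map_smul, smul_eq_mul, smul_eq_mul]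
      exact sub_eq_zero.mpr (mul_comm _ _))
  rw [map_sub, map_smul, map_smul, smul_eq_mul, smul_eq_mul] at this
  exact this

theorem segreL_mul {Z : ZW n} (i : Fin n) (hf : DifferentiableAt ℂ f Z)
    (hg : DifferentiableAt ℂ g Z) :
    segreL i r (fun Z => f Z * g Z) Z = segreL i r f Z * g Z + f Z * segreL i r g Z := by
  simp only [segreL, derivZ, derivW, fderiv_fun_mul hf hg, add_apply,
    smul_apply, smul_eq_mul]
  ring

theorem segreL_add {Z : ZW n} (i : Fin n) (hf : DifferentiableAt ℂ f Z)
    (hg : DifferentiableAt ℂ g Z) :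
    segreL i r (fun Z => f Z + g Z) Z = segreL i r f Z + segreL i r g Z := by
  simp only [segreL, derivZ, derivW, fderiv_fun_add hf hg, add_apply]
  ring

theorem segreL_const {Z : ZW n} (i : Fin n) (c : ℂ) : segreL i r (fun _ => c) Z = 0 := by
  simp [segreL, derivZ, derivW]

theorem segreL_jet (hV : IsOpen V) (hf : DifferentiableOn ℂ f V) {Z : ZW n} (hZ : Z ∈ V)
    (i : Fin n) (b : (Fin n → ℕ) × ℕ) : segreL i r (fun Z => jet f Z b) Z =
      derivW r Z * jet f Z (b.1 + Pi.single i 1, b.2) - derivZ i r Z * jet f Z (b.1, b.2 + 1) := by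
  simp only [segreL, jet, mixedDeriv_add_single hV hf b.1 b.2 i hZ, mixedDeriv_succ hV hf b.1 b.2 hZ]

theorem differentiableOn_jet (hV : IsOpen V) (hf : DifferentiableOn ℂ f V)
    (b : (Fin n → ℕ) × ℕ) : DifferentiableOn ℂ (fun Z => jet f Z b) V :=
  hf.mixedDeriv hV b.1 b.2

theorem differentiableOn_eval_jet (hV : IsOpen V) (hr : DifferentiableOn ℂ r V) (P : JetPoly n) :
    DifferentiableOn ℂ (fun Z => eval (jet r Z) P) V := by
  induction P using MvPolynomial.induction_on with
  | C c => simp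
  | add P Q hP hQ => simpa using hP.fun_add hQ
  | mul_X P b hP => simpa using hP.fun_mul (differentiableOn_jet hV hr b)

theorem segreL_eval_jet (hV : IsOpen V) (hr : DifferentiableOn ℂ r V) {Z : ZW n} (hZ : Z ∈ V)
    (i : Fin n) (P : JetPoly n) :
    segreL i r (fun Z => eval (jet r Z) P) Z = eval (jet r Z) (jetL i P) := by
  have hd : ∀ P : JetPoly n, DifferentiableAt ℂ (fun Z => eval (jet r Z) P) Z := fun P =>
    (differentiableOn_eval_jet hV hr P).differentiableAt (hV.mem_nhds hZ)
  induction P using MvPolynomial.induction_on with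
  | C c => simp [segreL_const, jetL]
  | add P Q hP hQ =>
    have h1 : jetL i (P + Q) = jetL i P + jetL i Q := by simp only [jetL, map_add]; ring
    simp only [map_add, h1]
    rw [segreL_add i (hd P) (hd Q), hP, hQ]
  | mul_X P b hP =>
    have hb := segreL_jet (r := r) hV hr hZ i b
    simp only [map_mul, eval_X, jetL_mul, jetL_X, map_add, map_sub]
    rw [segreL_mul i (hd P) ((differentiableOn_jet hV hr b).differentiableAt (hV.mem_nhds hZ)), hP,
      hb, jet_zero_one, jet_single hV hr hZ]

/-- The value at `Z` of the linear differential operator `∑ D_b(jet of r) ∂^b` applied to `f`. -/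
noncomputable def evalOp (r f : ZW n → ℂ) (L : List (((Fin n → ℕ) × ℕ) × JetPoly n)) (Z : ZW n) :
    ℂ :=
  (L.map fun x => eval (jet r Z) x.2 * jet f Z x.1).sum

/-- The composition of the operator `L` with `r_w (r_w ∂/∂z_i - r_{z_i} ∂/∂w)`, plus `L` times a
multiple of the derivative of `r_w`. -/
noncomputable def shiftOp (i : Fin n) (c : ℕ) (L : List (((Fin n → ℕ) × ℕ) × JetPoly n)) :
    List (((Fin n → ℕ) × ℕ) × JetPoly n) :=
  L.flatMap fun x => [(x.1, X wIdx * jetL i x.2 - (c : JetPoly n) * (jetL i (X wIdx) * x.2)),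
    ((x.1.1 + Pi.single i 1, x.1.2), X wIdx ^ 2 * x.2),
    ((x.1.1, x.1.2 + 1), -(X wIdx * X (zIdx i) * x.2))]

theorem differentiableOn_evalOp (hV : IsOpen V) (hr : DifferentiableOn ℂ r V)
    (hf : DifferentiableOn ℂ f V) (L : List (((Fin n → ℕ) × ℕ) × JetPoly n)) :
    DifferentiableOn ℂ (evalOp r f L) V := by
  induction L with
  | nil => exact (differentiableOn_const 0).congr fun _ _ => by simp [evalOp]
  | cons x L ih =>
    refine DifferentiableOn.congr (((differentiableOn_eval_jet hV hr x.2).fun_mul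
      (differentiableOn_jet hV hf x.1)).fun_add ih) fun Z _ => ?_
    simp [evalOp]

theorem evalOp_shiftOp (hV : IsOpen V) (hr : DifferentiableOn ℂ r V)
    (hf : DifferentiableOn ℂ f V) {Z : ZW n} (hZ : Z ∈ V) (i : Fin n) (c : ℕ)
    (L : List (((Fin n → ℕ) × ℕ) × JetPoly n)) :
    evalOp r f (shiftOp i c L) Z = derivW r Z * segreL i r (evalOp r f L) Z -
      c * (eval (jet r Z) (jetL i (X wIdx)) * evalOp r f L Z) := by
  induction L with
  | nil =>
    have : evalOp r f [] = fun _ => (0 : ℂ) := by ext; simp [evalOp]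
    simp [this, segreL_const, shiftOp]
  | cons x L ih =>
    have h1 : evalOp r f (x :: L) = fun Z => eval (jet r Z) x.2 * jet f Z x.1 + evalOp r f L Z := by
      ext; simp [evalOp]
    have hd1 := (differentiableOn_eval_jet hV hr x.2).differentiableAt (hV.mem_nhds hZ)
    have hd2 := (differentiableOn_jet hV hf x.1).differentiableAt (hV.mem_nhds hZ)
    have hd3 := (differentiableOn_evalOp hV hr hf L).differentiableAt (hV.mem_nhds hZ)
    have h2 : evalOp r f (shiftOp i c (x :: L)) Z =
        eval (jet r Z) (X wIdx * jetL i x.2 - (c : JetPoly n) * (jetL i (X wIdx) * x.2)) *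
          jet f Z x.1 + eval (jet r Z) (X wIdx ^ 2 * x.2) * jet f Z (x.1.1 + Pi.single i 1, x.1.2) +
        eval (jet r Z) (-(X wIdx * X (zIdx i) * x.2)) * jet f Z (x.1.1, x.1.2 + 1) +
        evalOp r f (shiftOp i c L) Z := by
      simp [evalOp, shiftOp]
      ring
    rw [h2, ih, h1, segreL_add i (hd1.fun_mul hd2) hd3, segreL_mul i hd1 hd2,
      segreL_eval_jet hV hr hZ, segreL_jet hV hf hZ]
    simp only [map_sub, map_mul, map_pow, map_neg, eval_X, jet_zero_one, jet_single hV hr hZ,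
      map_natCast]
    ring

/-- The operator with top coefficient `E` and lower order part `L` annihilates, along `{r = 0}`, the
functions that vanish on `{r = 0}`. -/
def IsSegreOp (E : JetPoly n) (L : List (((Fin n → ℕ) × ℕ) × JetPoly n)) : Prop :=
  ∀ (V : Set (ZW n)) (r f : ZW n → ℂ), IsOpen V → DifferentiableOn ℂ r V →
    DifferentiableOn ℂ f V → (∀ Z ∈ V, derivW r Z ≠ 0) → (∀ Z ∈ V, r Z = 0 → f Z = 0) →
    ∀ Z ∈ V, r Z = 0 →
      eval (jet r Z) E * derivW f Z + derivW r Z * evalOp r f L Z = 0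

/-- If H is the expression that vanishes on {r = 0}, the new one is r_w L_i H - (N + 1) L_i(r_w) H,
with L_i the tangential field. This is the numerator of the derivative of H / r_w^(N+1). One copy of
L_i(r_w) cancels against the derivative of the factor r_w in front of L, which leaves N in
`shiftOp`. -/
theorem IsSegreOp.succ {E : JetPoly n} {L : List (((Fin n → ℕ) × ℕ) × JetPoly n)}
    (h : IsSegreOp E L) (i : Fin n) (N : ℕ) :
    IsSegreOp (X wIdx * jetL i E - ((N + 1 : ℕ) : JetPoly n) * (jetL i (X wIdx) * E))
      (((Pi.single i 1, 1), E * X wIdx) :: ((0, 2), -(E * X (zIdx i))) :: shiftOp i N L) := by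
  intro V r f hV hr hf hw hz Z hZ hrZ
  set H : ZW n → ℂ := fun Z => eval (jet r Z) E * derivW f Z + derivW r Z * evalOp r f L Z with hH
  have hfw : DifferentiableOn ℂ (derivW f) V := hf.dirDeriv hV (0, 1)
  have hrw : DifferentiableOn ℂ (derivW r) V := hr.dirDeriv hV (0, 1)
  have hHd : DifferentiableOn ℂ H V :=
    ((differentiableOn_eval_jet hV hr E).fun_mul hfw).fun_add
      (hrw.fun_mul (differentiableOn_evalOp hV hr hf L))
  have hH0 : ∀ Z ∈ V, r Z = 0 → H Z = 0 := h V r f hV hr hf hw hz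
  have hd {g : ZW n → ℂ} (hg : DifferentiableOn ℂ g V) : DifferentiableAt ℂ g Z :=
    hg.differentiableAt (hV.mem_nhds hZ)
  have h1 := segreL_eq_zero hV hr hHd hH0 hZ (hw Z hZ) hrZ i
  have h2 := hH0 Z hZ hrZ
  have hE := differentiableOn_eval_jet hV hr E
  have hL := differentiableOn_evalOp hV hr hf L
  have hfw' : segreL i r (derivW f) Z = derivW r Z * jet f Z (Pi.single i 1, 1) -
      derivZ i r Z * jet f Z (0, 2) := by
    have := segreL_jet (r := r) hV hf hZ i wIdx
    simpa [jet_zero_one] using this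
  have hrw' : segreL i r (derivW r) Z = eval (jet r Z) (jetL i (X wIdx)) := by
    have := segreL_eval_jet hV hr hZ i (X wIdx)
    simpa [jet_zero_one] using this
  rw [hH, segreL_add i ((hd hE).fun_mul (hd hfw)) ((hd hrw).fun_mul (hd hL)),
    segreL_mul i (hd hE) (hd hfw), segreL_mul i (hd hrw) (hd hL), segreL_eval_jet hV hr hZ, hfw',
    hrw'] at h1
  have h3 : evalOp r f (((Pi.single i 1, 1), E * X wIdx) :: ((0, 2), -(E * X (zIdx i))) ::
      shiftOp i N L) Z = eval (jet r Z) (E * X wIdx) * jet f Z (Pi.single i 1, 1) +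
      eval (jet r Z) (-(E * X (zIdx i))) * jet f Z (0, 2) + evalOp r f (shiftOp i N L) Z := by
    simp [evalOp]
    ring
  rw [h3, evalOp_shiftOp hV hr hf hZ]
  simp only [hH] at h2
  simp only [map_sub, map_mul, map_neg, eval_X, jet_zero_one, jet_single hV hr hZ, map_natCast]
  push_cast
  linear_combination derivW r Z * h1 -
    ((N : ℂ) + 1) * eval (jet r Z) (jetL i (X wIdx)) * h2

/-- With H = r_w f_{z_i} - r_{z_i} f_w, the expression r_w L_j H - L_j(r_w) H vanishes on {r = 0};
the terms containing f_{z_i} cancel, and every remaining term other than that in f_w has a factor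
r_w. -/
theorem isSegreOp_two (i j : Fin n) :
    IsSegreOp (jetL j (X wIdx) * X (zIdx i) - X wIdx * jetL j (X (zIdx i)))
      [((Pi.single i 1 + Pi.single j 1, 0), X wIdx ^ 2),
        ((Pi.single i 1, 1), -(X wIdx * X (zIdx j))), ((Pi.single j 1, 1), -(X wIdx * X (zIdx i))),
        ((0, 2), X (zIdx i) * X (zIdx j))] := by
  intro V r f hV hr hf hw hz Z hZ hrZ
  have hfi : DifferentiableOn ℂ (derivZ i f) V := hf.dirDeriv hV _
  have hri : DifferentiableOn ℂ (derivZ i r) V := hr.dirDeriv hV _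
  have hfw : DifferentiableOn ℂ (derivW f) V := hf.dirDeriv hV (0, 1)
  have hrw : DifferentiableOn ℂ (derivW r) V := hr.dirDeriv hV (0, 1)
  have hd {g : ZW n → ℂ} (hg : DifferentiableOn ℂ g V) : DifferentiableAt ℂ g Z :=
    hg.differentiableAt (hV.mem_nhds hZ)
  set H : ZW n → ℂ := fun Z => derivW r Z * derivZ i f Z + -1 * (derivZ i r Z * derivW f Z) with hH
  have hHd : DifferentiableOn ℂ H V :=
    (hrw.fun_mul hfi).fun_add ((differentiableOn_const _).fun_mul (hri.fun_mul hfw))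
  have hH0 : ∀ Z ∈ V, r Z = 0 → H Z = 0 := by
    intro Z hZ hrZ
    have := segreL_eq_zero hV hr hf hz hZ (hw Z hZ) hrZ i
    rw [segreL] at this
    simp only [hH]
    linear_combination this
  have h1 := segreL_eq_zero hV hr hHd hH0 hZ (hw Z hZ) hrZ j
  have h2 := hH0 Z hZ hrZ
  have hfw' : segreL j r (derivW f) Z = derivW r Z * jet f Z (Pi.single j 1, 1) -
      derivZ j r Z * jet f Z (0, 2) := by
    have := segreL_jet (r := r) hV hf hZ j wIdx
    simpa [jet_zero_one] using this
  have hcong : ∀ {g₁ g₂ : ZW n → ℂ}, EqOn g₁ g₂ V → segreL j r g₁ Z = segreL j r g₂ Z := by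
    intro g₁ g₂ h
    have h1 := h.dirDeriv hV (Pi.single j 1, 0) hZ
    have h2 := h.dirDeriv hV (0, 1) hZ
    simp only [dirDeriv] at h1 h2
    simp only [segreL, derivZ, derivW, h1, h2]
  have hfi' : segreL j r (derivZ i f) Z = derivW r Z * jet f Z (Pi.single i 1 + Pi.single j 1, 0) -
      derivZ j r Z * jet f Z (Pi.single i 1, 1) := by
    rw [← segreL_jet (r := r) hV hf hZ j (zIdx i)]
    exact hcong fun Z hZ => (jet_single hV hf hZ i).symm
  have hrw' : segreL j r (derivW r) Z = eval (jet r Z) (jetL j (X wIdx)) := by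
    have := segreL_eval_jet hV hr hZ j (X wIdx)
    simpa [jet_zero_one] using this
  have hri' : segreL j r (derivZ i r) Z = eval (jet r Z) (jetL j (X (zIdx i))) := by
    rw [← segreL_eval_jet hV hr hZ]
    refine hcong fun Z hZ => ?_
    simp [jet_single hV hr hZ i]
  rw [hH, segreL_add j ((hd hrw).fun_mul (hd hfi))
    ((differentiableAt_const _).fun_mul ((hd hri).fun_mul (hd hfw))),
    segreL_mul j (hd hrw) (hd hfi), segreL_mul j (differentiableAt_const _)
    ((hd hri).fun_mul (hd hfw)), segreL_const, segreL_mul j (hd hri) (hd hfw), hfw', hfi', hrw',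
    hri'] at h1
  simp only [hH] at h2
  simp only [evalOp, List.map_cons, List.map_nil, List.sum_cons, List.sum_nil, map_sub, map_mul,
    map_neg, map_pow, eval_X, jet_zero_one, jet_single hV hr hZ]
  linear_combination derivW r Z * h1 - eval (jet r Z) (jetL j (X wIdx)) * h2

/-- For `|α| = k + 2` there is an operator of the form `E ∂_w + ρ_w ∑ D_b ∂^b` that annihilates the
functions vanishing on the Segre varieties, where `E` contains `ρ_{z^α}` linearly and otherwise
`E` and `D_b` are polynomials in lower derivatives of controlled weight and degree. -/
theorem exists_segre_expansion (k : ℕ) (α : Fin n → ℕ) (hα : multiLength α = k + 2) :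
    ∃ (R : JetPoly n) (L : List (((Fin n → ℕ) × ℕ) × JetPoly n)),
      JetBound (k + 2) (2 * k + 3) (2 * k + 3) R ∧
      (∀ x ∈ L, JetBound (k + 2) (2 * k + 2) (2 * k + 2) x.2 ∧ x.1 ≠ (0, 0)) ∧
      IsSegreOp (R - X wIdx ^ (2 * k + 2) * X (α, 0)) L := by
  induction k generalizing α with
  | zero =>
    obtain ⟨β, j, rfl, hβ⟩ := exists_eq_add_single hα
    obtain ⟨γ, i, rfl, hγ⟩ := exists_eq_add_single hβ
    have hγ0 : γ = 0 := by
      ext x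
      have : ∀ x ∈ Finset.univ, γ x = 0 := by simpa [multiLength] using hγ
      exact this x (by simp)
    subst hγ0
    have hlen : multiLength (Pi.single i 1 : Fin n → ℕ) = 1 := by simp [multiLength]
    have hiw : JetBound 2 2 1 (X (Pi.single i 1, 1) : JetPoly n) := by
      simpa [hlen] using JetBound.var 2 ((Pi.single i 1 : Fin n → ℕ), 1) (by simp)
        (by simp [hlen]) (by simp [hlen])
    have hw := JetBound.X_wIdx (n := n) (k := 2) (by norm_num)
    have hw1 := JetBound.X_wIdx (n := n) (k := 1) (by norm_num)
    have hz := fun i => JetBound.X_zIdx (n := n) (k := 2) (by norm_num) i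
    refine ⟨jetL j (X wIdx) * X (zIdx i) + X wIdx * (X (zIdx j) * X (Pi.single i 1, 1)),
      [((Pi.single i 1 + Pi.single j 1, 0), X wIdx ^ 2),
        ((Pi.single i 1, 1), -(X wIdx * X (zIdx j))), ((Pi.single j 1, 1), -(X wIdx * X (zIdx i))),
        ((0, 2), X (zIdx i) * X (zIdx j))], ?_, ?_, ?_⟩
    · exact (((hw1.jetL (by norm_num) j).mul (hz i)).mono le_rfl (by omega) (by omega)).add
        ((hw.mul ((hz j).mul hiw)).mono le_rfl (by omega) (by omega))
    rotate_left
    · convert isSegreOp_two i j using 1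
      rw [jetL_X j (zIdx i), zero_add]
      ring
    · have h1 : ∀ i : Fin n, (Pi.single i 1 : Fin n → ℕ) ≠ 0 := fun i => by simp
      intro x hx
      simp only [List.mem_cons, List.not_mem_nil, or_false] at hx
      rcases hx with rfl | rfl | rfl | rfl
      · refine ⟨(hw.pow 2).mono le_rfl (by omega) (by omega), ?_⟩
        intro h
        have := congrFun (congrArg Prod.fst h) i
        simp at this
      · exact ⟨(hw.mul (hz j)).neg.mono le_rfl (by omega) (by omega), by simp⟩
      · exact ⟨(hw.mul (hz i)).neg.mono le_rfl (by omega) (by omega), by simp⟩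
      · exact ⟨((hz i).mul (hz j)).mono le_rfl (by omega) (by omega), by simp⟩
  | succ k ih =>
    obtain ⟨β, i, rfl, hβ⟩ := exists_eq_add_single hα
    obtain ⟨R, L, hR, hL, hop⟩ := ih β hβ
    have hw := JetBound.X_wIdx (n := n) (k := k + 3) (by omega)
    have hw2 := JetBound.X_wIdx (n := n) (k := k + 2) (by omega)
    have hz := JetBound.X_zIdx (n := n) (k := k + 3) (by omega) i
    have hLw : JetBound (k + 3) 2 2 (jetL i (X wIdx : JetPoly n)) := hw2.jetL (by omega) i
    have hβ0 : JetBound (k + 3) (2 * k + 3) 1 (X (β, 0) : JetPoly n) :=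
      (JetBound.var (k + 3) (β, 0) (by simp [hβ]) (by simp [hβ]) (by simp [hβ])).mono le_rfl
        (by simp only [hβ]; omega) le_rfl
    have hβ1 : JetBound (k + 3) (2 * k + 4) 1 (X (β, 1) : JetPoly n) :=
      (JetBound.var (k + 3) (β, 1) (by simp [hβ]) (by simp [hβ]) (by simp [hβ])).mono le_rfl
        (by simp only [hβ]; omega) le_rfl
    have hR3 : JetBound (k + 3) (2 * k + 3) (2 * k + 3) R := hR.mono (by omega) le_rfl le_rfl
    have hE : JetBound (k + 3) (2 * k + 3) (2 * k + 3) (R - X wIdx ^ (2 * k + 2) * X (β, 0)) :=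
      hR3.sub (((hw.pow _).mul hβ0).mono le_rfl (by omega) (by omega))
    -- Tangential differentiation along the graph w = w(z) is L_i / r_w, and 2k + 3 = 2|β| - 1 is
    -- the power of r_w in the denominator after β. The term ρ_w^(2k+4) ρ_{z^(β+e_i)} comes from
    -- differentiating ρ_{z^β}; all other coefficients of f_w form the new R.
    refine ⟨X wIdx * jetL i R - ((2 * k + 2 + 1 : ℕ) : JetPoly n) * (jetL i (X wIdx) * R) -
        X wIdx * (jetL i (X wIdx ^ (2 * k + 2)) * X (β, 0)) +
        X wIdx ^ (2 * k + 3) * (X (zIdx i) * X (β, 1)) +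
        ((2 * k + 2 + 1 : ℕ) : JetPoly n) *
          (jetL i (X wIdx) * (X wIdx ^ (2 * k + 2) * X (β, 0))),
      ((Pi.single i 1, 1), (R - X wIdx ^ (2 * k + 2) * X (β, 0)) * X wIdx) ::
        ((0, 2), -((R - X wIdx ^ (2 * k + 2) * X (β, 0)) * X (zIdx i))) ::
        shiftOp i (2 * k + 2) L, ?_, ?_, ?_⟩
    · refine (((JetBound.sub ?_ ?_).sub ?_).add ?_).add ?_
      · exact (hw.mul (hR.jetL (by omega) i)).mono (by omega) (by omega) (by omega)
      · exact ((hLw.mul hR3).natCast_mul _).mono (by omega) (by omega) (by omega)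
      · exact (hw.mul (((hw2.pow (2 * k + 2)).jetL (by omega) i).mul hβ0)).mono (by omega)
          (by omega) (by omega)
      · exact ((hw.pow (2 * k + 3)).mul (hz.mul hβ1)).mono (by omega) (by omega) (by omega)
      · exact ((hLw.mul ((hw.pow (2 * k + 2)).mul hβ0)).natCast_mul _).mono (by omega) (by omega)
          (by omega)
    rotate_left
    · convert hop.succ i (2 * k + 2) using 1
      rw [jetL_sub, jetL_mul, jetL_X i (β, 0)]
      simp only
      ring
    · intro x hx
      simp only [List.mem_cons, shiftOp, List.mem_flatMap, List.not_mem_nil, or_false] at hx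
      rcases hx with rfl | rfl | ⟨y, hy, rfl | rfl | rfl⟩
      · exact ⟨(hE.mul hw).mono (by omega) (by omega) (by omega), by simp⟩
      · exact ⟨(hE.mul hz).neg.mono (by omega) (by omega) (by omega), by simp⟩
      · have hy1 := (hL y hy).1
        refine ⟨JetBound.sub ?_ ?_, (hL y hy).2⟩
        · exact (hw.mul (hy1.jetL (by omega) i)).mono (by omega) (by omega) (by omega)
        · exact ((hLw.mul (hy1.mono (Nat.le_succ _) le_rfl le_rfl)).natCast_mul _).mono (by omega)
            (by omega) (by omega)
      · refine ⟨((hw.pow 2).mul ((hL y hy).1.mono (Nat.le_succ _) le_rfl le_rfl)).mono (by omega)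
          (by omega) (by omega), fun h => ?_⟩
        have := congrFun (congrArg Prod.fst h) i
        simp at this
      · exact ⟨((hw.mul hz).mul ((hL y hy).1.mono (Nat.le_succ _) le_rfl le_rfl)).neg.mono (by omega)
          (by omega) (by omega), by simp⟩

end SegreExpansion

/-! ### Graded linear dependence expressed by minors. -/

section MinorRelation

open Matrix Finset

variable {R A : Type*} [CommRing R] [CommRing A]

/-- A square matrix whose rows are unit vectors, except for fewer than `#{len ≤ k}` of them, which
are taken among the rows `D j` with `len j ≤ k`. -/
def IsMixedMinor {m : ℕ} (len : Fin (m + 1) → ℕ) (D : Fin (m + 1) → Fin m → R) (k : ℕ)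
    (N : Matrix (Fin m) (Fin m) R) : Prop :=
  ∃ I : Finset (Fin m), I.card + 1 ≤ #{j | len j ≤ k} ∧
    (∀ i ∈ I, ∃ j, len j ≤ k ∧ N i = D j) ∧ ∀ i ∉ I, ∃ i', N i = Pi.single i' 1

/-- `m + 1` vectors of length `m` over a domain satisfy a relation whose coefficients are
combinations of minors; the vectors are graded by `len`, and only those up to the smallest grade
for which the vectors become dependent are involved. -/
theorem exists_minor_relation [IsDomain A] (π : R →+* A) {m : ℕ} (len : Fin (m + 1) → ℕ)
    (D : Fin (m + 1) → Fin m → R) :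
    ∃ (k : ℕ) (c : Fin (m + 1) → R), (∀ j, k < len j → c j = 0) ∧
      (∀ a, ∑ j, π (c j) * π (D j a) = 0) ∧ (∃ j, len j = k ∧ π (c j) ≠ 0) ∧
      ∀ j, c j ∈ AddSubgroup.closure {x | ∃ N, IsMixedMinor len D k N ∧ x = N.det} := by
  classical
  let row : Fin (m + 1) ⊕ Fin m → Fin m → R := Sum.elim D fun i => Pi.single i 1
  let mat : (Fin m → Fin (m + 1) ⊕ Fin m) → Matrix (Fin m) (Fin m) R := fun t i => row (t i)
  let good : ℕ → (Fin m → Fin (m + 1) ⊕ Fin m) → Prop := fun k t =>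
    (∀ i j, t i = Sum.inl j → len j ≤ k) ∧ π (mat t).det ≠ 0
  let I : (Fin m → Fin (m + 1) ⊕ Fin m) → Finset (Fin m) := fun t => {i | (t i).isLeft}
  -- `full k` means that the rows of grade at most k are independent over the fraction field:
  -- together they complete to a nonsingular square with unit rows or rows of the same grades. It
  -- fails eventually, since m + 1 rows do not fit into m places.
  let full : ℕ → Prop := fun k => ∃ t, good k t ∧ ∀ j, len j ≤ k → ∃ i, t i = Sum.inl j
  have hnf : ∃ k, ¬ full k := by
    refine ⟨univ.sup len, ?_⟩
    rintro ⟨t, -, ht⟩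
    choose q hq using fun j => ht j (le_sup (mem_univ j))
    have hinj : Function.Injective q := fun j j' h => by
      have := hq j
      rw [h, hq j'] at this
      exact (Sum.inl_injective this).symm
    have := Fintype.card_le_of_injective q hinj
    simp at this
  set k := Nat.find hnf with hk
  obtain ⟨t, htg, htmax⟩ : ∃ t, good k t ∧ ∀ t', good k t' → (I t').card ≤ (I t).card := by
    have hne : (univ.filter fun t => good k t).Nonempty := by
      refine ⟨Sum.inr, mem_filter.mpr ⟨mem_univ _, fun i j h => by simp at h, ?_⟩⟩
      have h1 : mat Sum.inr = 1 := by
        ext i j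
        simp [mat, row, Matrix.one_apply, Pi.single_apply, eq_comm]
      rw [h1, det_one, map_one]
      exact one_ne_zero
    obtain ⟨t, ht, hmax⟩ := exists_max_image _ (fun t => (I t).card) hne
    exact ⟨t, (mem_filter.mp ht).2, fun t' ht' => hmax t' (mem_filter.mpr ⟨mem_univ _, ht'⟩)⟩
  obtain ⟨j₀, hj₀, hj₀t⟩ : ∃ j, len j ≤ k ∧ ∀ i, t i ≠ Sum.inl j := by
    have := Nat.find_spec hnf
    by_contra! h
    exact this ⟨t, htg, h⟩
  set N := mat t with hN
  -- The rows D j that are used are distinct, as a repetition would kill the determinant, and they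
  -- omit `j₀`.
  have hIcard : (I t).card + 1 ≤ #{j | len j ≤ k} := by
    have hlt : (I t).card ≤ (({j | len j ≤ k} : Finset (Fin (m + 1))).erase j₀).card := by
      have hex : ∀ i ∈ I t, ∃ j, t i = Sum.inl j := fun i hi =>
        Sum.isLeft_iff.mp (mem_filter.mp hi).2
      refine card_le_card_of_injOn (fun i => Sum.elim id (fun _ => j₀) (t i)) ?_ ?_
      · intro i hi
        obtain ⟨j, hj⟩ := hex i hi
        have : j ≠ j₀ := fun h => hj₀t i (h ▸ hj)
        simpa [hj, this] using htg.1 i j hj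
      · intro i hi i' hi' h
        obtain ⟨j, hj⟩ := hex i hi
        obtain ⟨j', hj'⟩ := hex i' hi'
        simp only [hj, hj', Sum.elim_inl, id] at h
        by_contra hne
        refine htg.2 ?_
        rw [det_zero_of_row_eq hne, map_zero]
        simp [mat, hj, hj', h]
    rw [card_erase_of_mem (by simpa using hj₀)] at hlt
    have : 0 < #{j | len j ≤ k} := card_pos.mpr ⟨j₀, by simpa using hj₀⟩
    omega
  -- Cramer's rule: det N · D j₀ is the combination of the rows of N with coefficients det N[i ← D
  -- j₀].
  let c : Fin (m + 1) → R := fun j => (if j = j₀ then N.det else 0) -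
    ∑ i, if t i = Sum.inl j then (N.updateRow i (D j₀)).det else 0
  -- A nonzero value would allow D j₀ to replace a unit row, contradicting the maximal number of
  -- D-rows.
  have hinr : ∀ i i', t i = Sum.inr i' → π (N.updateRow i (D j₀)).det = 0 := by
    intro i i' hi
    by_contra hne
    have hmat : mat (Function.update t i (Sum.inl j₀)) = N.updateRow i (D j₀) := by
      funext x
      by_cases hx : x = i
      · subst hx
        simp [mat, row]
      · rw [updateRow_ne hx]
        simp [mat, hx, hN]
    have := htmax (Function.update t i (Sum.inl j₀)) ⟨?_, by rwa [hmat]⟩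
    · have hI : I (Function.update t i (Sum.inl j₀)) = insert i (I t) := by
        ext x
        by_cases hx : x = i
        · subst hx; simp [I]
        · simp [I, hx]
      rw [hI, card_insert_of_notMem (by simp [I, hi])] at this
      omega
    · intro x j hx
      by_cases hxi : x = i
      · subst hxi
        simp only [Function.update_self, Sum.inl.injEq] at hx
        exact hx ▸ hj₀
      · rw [Function.update_of_ne hxi] at hx
        exact htg.1 x j hx
  have hc₀ : c j₀ = N.det := by simp [c, hj₀t]
  have hcbig : ∀ j, k < len j → c j = 0 := by
    intro j hj
    have h1 : j ≠ j₀ := fun h => by subst h; omega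
    have h2 : ∀ i, t i ≠ Sum.inl j := fun i h => by have := htg.1 i j h; omega
    simp [c, h1, h2]
  have hrel : ∀ a, ∑ j, π (c j) * π (D j a) = 0 := by
    intro a
    have hcr : ∑ i, N i a * (N.updateRow i (D j₀)).det = N.det * D j₀ a := by
      have := congrFun (mulVec_cramer Nᵀ (D j₀)) a
      simp only [mulVec, dotProduct, transpose_apply, cramer_transpose_apply, det_transpose,
        Pi.smul_apply, smul_eq_mul] at this
      exact this
    have h1 : ∀ j, c j * D j a = (if j = j₀ then N.det * D j a else 0) -
        ∑ i, if t i = Sum.inl j then (N.updateRow i (D j₀)).det * D j a else 0 := by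
      intro j
      simp only [c, sub_mul, ite_mul, zero_mul, sum_mul]
    have h2 : ∑ j, c j * D j a = N.det * D j₀ a -
        ∑ i, ∑ j, if t i = Sum.inl j then (N.updateRow i (D j₀)).det * D j a else 0 := by
      simp only [h1, sum_sub_distrib, sum_ite_eq', mem_univ, if_true]
      rw [sum_comm]
    simp only [← map_mul]
    rw [← map_sum, h2, ← hcr, ← sum_sub_distrib, map_sum]
    refine sum_eq_zero fun i _ => ?_
    rcases hti : t i with j | i'
    · have : N i a = D j a := by simp [hN, mat, hti, row]
      simp [this, mul_comm]
    · simp [hinr i i' hti]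
  refine ⟨k, c, hcbig, hrel, ?_, ?_⟩
  -- Otherwise the relation would involve only rows of grade below k with nonzero coefficient at
  -- `j₀`, against their independence given by minimality of k.
  · by_contra! hall
    have hlt : len j₀ < k := by
      refine lt_of_le_of_ne hj₀ fun h => htg.2 ?_
      rw [← hN, ← hc₀]
      exact hall j₀ h
    have hfull : full (k - 1) := not_not.mp (Nat.find_min hnf (by omega))
    obtain ⟨s, hs, hsf⟩ := hfull
    obtain ⟨i₀, hi₀⟩ := hsf j₀ (by omega)
    set M := (mat s).map π with hM
    have hMdet : M.det ≠ 0 := by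
      have := hs.2
      rwa [RingHom.map_det] at this
    have hMrow : ∀ i j, s i = Sum.inl j → (fun a => π (D j a)) = M i := by
      intro i j h
      funext a
      rw [hM, map_apply]
      simp [mat, h, row]
    have h0 : ∑ j, π (c j) • (fun a => π (D j a)) = 0 := by
      funext a
      simpa using hrel a
    have h1 := congrFun (congrArg (cramer Mᵀ) h0) i₀
    simp only [map_sum, map_smul, map_zero, Finset.sum_apply, Pi.smul_apply, Pi.zero_apply,
      smul_eq_mul] at h1
    rw [sum_eq_single j₀, hMrow i₀ j₀ hi₀, cramer_transpose_row_self, Pi.single_eq_same, hc₀] at h1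
    · exact (mul_ne_zero htg.2 hMdet) h1
    · intro j _ hj
      by_cases hjk : len j < k
      · obtain ⟨i, hi⟩ := hsf j (by omega)
        have hii : i₀ ≠ i := fun h => by
          subst h
          rw [hi₀] at hi
          exact hj (Sum.inl_injective hi).symm
        rw [hMrow i j hi, cramer_transpose_row_self, Pi.single_eq_of_ne hii, mul_zero]
      · rcases eq_or_lt_of_le (not_lt.mp hjk) with h | h
        · rw [hall j h.symm, zero_mul]
        · rw [hcbig j h, map_zero, zero_mul]
    · simp
  · have hrows : ∀ i ∉ I t, ∃ i', N i = Pi.single i' 1 := by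
      intro i hi
      rcases hti : t i with j | i'
      · simp [I, hti] at hi
      · exact ⟨i', by simp [hN, mat, hti, row]⟩
    have hrowsI : ∀ i ∈ I t, ∃ j, len j ≤ k ∧ N i = D j := by
      intro i hi
      obtain ⟨j, hj⟩ := Sum.isLeft_iff.mp (mem_filter.mp hi).2
      exact ⟨j, htg.1 i j hj, by simp [hN, mat, hj, row]⟩
    intro j
    refine sub_mem ?_ (sum_mem fun i _ => ?_)
    · split_ifs
      · exact AddSubgroup.subset_closure ⟨N, ⟨I t, hIcard, hrowsI, hrows⟩, rfl⟩
      · exact zero_mem _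
    · split_ifs with hti
      · have hiI : i ∈ I t := by simp [I, hti]
        -- Only a D-row is replaced, so the set of non-unit positions is unchanged and the count
        -- still holds.
        refine AddSubgroup.subset_closure ⟨_, ⟨I t, hIcard, fun x hx => ?_, fun x hx => ?_⟩, rfl⟩
        · by_cases hxi : x = i
          · exact ⟨j₀, hj₀, by rw [hxi, updateRow_self]⟩
          · rw [updateRow_ne hxi]
            exact hrowsI x hx
        · rw [updateRow_ne fun h : x = i => hx (h ▸ hiI)]
          exact hrows x hx
      · exact zero_mem _

end MinorRelation

/-! ### Elimination with weight and degree bounds. -/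

section JetRelation

open MvPolynomial Finset

variable {n m : ℕ}

/-- Unit rows contribute nothing, and at most l - 1 other rows contribute 2k - 2 each. -/
theorem IsMixedMinor.jetBound_det {len : Fin (m + 1) → ℕ} {D : Fin (m + 1) → Fin m → JetPoly n}
    {k : ℕ} {N : Matrix (Fin m) (Fin m) (JetPoly n)} (hN : IsMixedMinor len D k N)
    (hD : ∀ j a, JetBound (len j) (2 * len j - 2) (2 * len j - 2) (D j a)) :
    JetBound k ((2 * k - 2) * (#{j | len j ≤ k} - 1)) ((2 * k - 2) * (#{j | len j ≤ k} - 1))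
      N.det := by
  classical
  obtain ⟨I, hI, hrow, hunit⟩ := hN
  set w : Fin m → ℕ := fun i => if i ∈ I then 2 * k - 2 else 0 with hw
  have hentry : ∀ i a, JetBound k (w i) (w i) (N i a) := by
    intro i a
    by_cases hi : i ∈ I
    · obtain ⟨j, hj, hNj⟩ := hrow i hi
      simp only [hw, hi, if_true, hNj]
      exact (hD j a).mono hj (by omega) (by omega)
    · obtain ⟨i', hi'⟩ := hunit i hi
      simp only [hw, hi, if_false, hi', Pi.single_apply]
      split_ifs
      exacts [JetBound.one, JetBound.zero]
  have hwsum : ∑ i, w i = (2 * k - 2) * I.card := by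
    simp [hw, mul_comm]
  have hle : (2 * k - 2) * I.card ≤ (2 * k - 2) * (#{j | len j ≤ k} - 1) :=
    Nat.mul_le_mul_left _ (by omega)
  rw [Matrix.det_apply]
  refine JetBound.sum _ fun σ _ => ?_
  have hprod : JetBound k (∑ i, w (σ i)) (∑ i, w (σ i)) (∏ i, N (σ i) i) :=
    JetBound.prod _ fun i _ => hentry _ _
  rw [Equiv.sum_comp σ w, hwsum] at hprod
  have hprod' := hprod.mono le_rfl hle hle
  rcases Int.units_eq_one_or (Equiv.Perm.sign σ) with h | h
  · rw [h, one_smul]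
    exact hprod'
  · rw [h, Units.neg_smul, one_smul]
    exact hprod'.neg

/-- The elimination argument: a linear dependence between jets on an irreducible set, in terms of
polynomials of controlled weight and degree. -/
theorem exists_jet_relation {S : Set (ZW n)} (hSne : S.Nonempty) (ev : ZW n → (Fin n → ℕ) × ℕ → ℂ)
    (hdom : ∀ P Q : JetPoly n, (∀ ζ ∈ S, eval (ev ζ) P * eval (ev ζ) Q = 0) →
      (∀ ζ ∈ S, eval (ev ζ) P = 0) ∨ ∀ ζ ∈ S, eval (ev ζ) Q = 0)
    (hw : ∃ ζ ∈ S, ev ζ wIdx ≠ 0)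
    (α : Fin (m + 1) → Fin n → ℕ) (hα : ∀ j, 2 ≤ multiLength (α j))
    (T : Fin (m + 1) → JetPoly n) (D : Fin (m + 1) → Fin m → JetPoly n)
    (hT : ∀ j, JetBound (multiLength (α j)) (2 * multiLength (α j) - 1)
      (2 * multiLength (α j) - 1) (T j))
    (hD : ∀ j a, JetBound (multiLength (α j)) (2 * multiLength (α j) - 2)
      (2 * multiLength (α j) - 2) (D j a))
    (hrel : ∀ c : Fin (m + 1) → JetPoly n,
      (∀ a, ∀ ζ ∈ S, ∑ j, eval (ev ζ) (c j) * eval (ev ζ) (D j a) = 0) →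
      ∀ ζ ∈ S, ∑ j, eval (ev ζ) (c j) *
        eval (ev ζ) (T j - X wIdx ^ (2 * multiLength (α j) - 2) * X (α j, 0)) = 0) :
    ∃ k : ℕ, (∃ j, multiLength (α j) = k) ∧
      ∃ (P : Fin (m + 1) → JetPoly n) (R : JetPoly n),
        (∀ j, multiLength (α j) = k → (P j).InvolvesOnly k) ∧ R.InvolvesOnly k ∧
        (∀ ζ ∈ S,
          ∑ j with multiLength (α j) = k, eval (ev ζ) (P j) * ev ζ (α j, 0) = eval (ev ζ) R) ∧
        (∃ j, multiLength (α j) = k ∧ ∃ ζ ∈ S, eval (ev ζ) (P j) ≠ 0) ∧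
        ∀ l : ℕ, l = Finset.card {j | multiLength (α j) ≤ k} →
          (∀ j, multiLength (α j) = k →
            (P j).wt ≤ (2 * k - 2) * (l - 1) ∧ (P j).degRhoW ≤ (2 * k - 2) * l) ∧
          R.wt ≤ (2 * k - 2) * l + 1 ∧ R.degRhoW ≤ (2 * k - 2) * l + 1 := by
  classical
  set len : Fin (m + 1) → ℕ := fun j => multiLength (α j) with hlen
  let Ev : JetPoly n →+* (S → ℂ) := RingHom.pi fun ζ => (eval (ev ζ) : JetPoly n →+* ℂ)
  have hker : ∀ P, P ∈ RingHom.ker Ev ↔ ∀ ζ ∈ S, eval (ev ζ) P = 0 := by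
    intro P
    rw [RingHom.mem_ker, funext_iff, Subtype.forall]
    exact Iff.rfl
  -- This is where irreducibility of S enters: the polynomial functions on S form a domain, over
  -- which the minor relation is taken.
  have hprime : (RingHom.ker Ev).IsPrime := by
    refine ⟨fun h => ?_, fun {P Q} h => ?_⟩
    · obtain ⟨ζ, hζ⟩ := hSne
      have := (hker 1).mp (h ▸ Submodule.mem_top) ζ hζ
      simp at this
    · rw [hker, hker]
      refine hdom P Q fun ζ hζ => ?_
      rw [← map_mul]
      exact (hker _).mp h ζ hζ
  obtain ⟨k, c, hc0, hcrel, ⟨j₁, hj₁, hcj₁⟩, hcm⟩ :=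
    exists_minor_relation (Ideal.Quotient.mk (RingHom.ker Ev)) len D
  have hcrel' : ∀ a, ∀ ζ ∈ S, ∑ j, eval (ev ζ) (c j) * eval (ev ζ) (D j a) = 0 := by
    intro a ζ hζ
    have := hcrel a
    simp only [← map_mul] at this
    rw [← map_sum, Ideal.Quotient.eq_zero_iff_mem, hker] at this
    simpa using this ζ hζ
  have hE := hrel c hcrel'
  set l := #{j | len j ≤ k} with hl
  have hl1 : 1 ≤ l := card_pos.mpr ⟨j₁, by simp [hj₁]⟩
  have hk2 : 2 ≤ k := hj₁ ▸ hα j₁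
  have hcb : ∀ j, JetBound k ((2 * k - 2) * (l - 1)) ((2 * k - 2) * (l - 1)) (c j) := by
    intro j
    refine AddSubgroup.closure_induction (p := fun x _ =>
      JetBound k ((2 * k - 2) * (l - 1)) ((2 * k - 2) * (l - 1)) x) ?_ JetBound.zero
      (fun _ _ _ _ => JetBound.add) (fun _ _ => JetBound.neg) (hcm j)
    rintro x ⟨N, hN, rfl⟩
    exact hN.jetBound_det hD
  have hww := JetBound.X_wIdx (n := n) (k := k) (by omega)
  have hmul : (2 * k - 2) * (l - 1) + (2 * k - 2) = (2 * k - 2) * l := by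
    obtain ⟨l', hl'⟩ : ∃ l', l = l' + 1 := ⟨l - 1, by omega⟩
    rw [hl', Nat.add_sub_cancel]
    ring
  -- The factor ρ_w^(2k-2) has weight 0, so it changes only the degree bound, from (2k-2)(l-1) to
  -- (2k-2)l.
  set P : Fin (m + 1) → JetPoly n := fun j => c j * X wIdx ^ (2 * k - 2) with hP
  -- For |α_j| < k the variable ρ_{z^(α_j)} is admissible and is absorbed into R.
  set low : Fin (m + 1) → JetPoly n := fun j =>
    if len j < k then X wIdx ^ (2 * len j - 2) * X (α j, 0) else 0 with hlow
  set R : JetPoly n := ∑ j with len j ≤ k, c j * (T j - low j) with hR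
  have hPb : ∀ j, JetBound k ((2 * k - 2) * (l - 1)) ((2 * k - 2) * l) (P j) := by
    intro j
    exact ((hcb j).mul (hww.pow _)).mono le_rfl (by simp) (by rw [mul_one, hmul])
  -- The bound is (2k-2)(l-1) for the minors plus 2k - 1 for `T j - low j`.
  have hRb : JetBound k ((2 * k - 2) * l + 1) ((2 * k - 2) * l + 1) R := by
    refine JetBound.sum _ fun j hj => ?_
    have hjk : len j ≤ k := (mem_filter.mp hj).2
    have h2 : 2 ≤ len j := hα j
    have hTl : JetBound k (2 * k - 1) (2 * k - 1) (T j - low j) := by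
      refine ((hT j).mono hjk (by simp only [hlen] at hjk; omega)
        (by simp only [hlen] at hjk; omega)).sub ?_
      simp only [hlow]
      split_ifs with hlt
      · have hv : JetBound k (2 * len j + 0 - 1) 1 (X (α j, 0) : JetPoly n) :=
          JetBound.var k (α j, 0) (by simp only [hlen] at h2; simp only; omega) hjk hlt
        exact ((hww.pow _).mul hv).mono le_rfl (by omega) (by omega)
      · exact JetBound.zero
    refine ((hcb j).mul hTl).mono le_rfl ?_ ?_ <;> omega
  have hRrel : ∀ ζ ∈ S, ∑ j with len j = k, eval (ev ζ) (P j) * ev ζ (α j, 0) =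
      eval (ev ζ) R := by
    intro ζ hζ
    have h := hE ζ hζ
    have hsub : ∑ j, eval (ev ζ) (c j) *
        eval (ev ζ) (T j - X wIdx ^ (2 * multiLength (α j) - 2) * X (α j, 0)) =
        ∑ j with len j ≤ k, (eval (ev ζ) (c j * (T j - low j)) -
          if len j = k then eval (ev ζ) (P j) * ev ζ (α j, 0) else 0) := by
      rw [sum_filter]
      refine sum_congr rfl fun j _ => ?_
      split_ifs with h1 h2
      · have hlow0 : low j = 0 := if_neg (by omega)
        have hPj : P j = c j * X wIdx ^ (2 * len j - 2) := by rw [h2]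
        simp only [hlow0, hPj, sub_zero, map_mul, map_sub, map_pow, eval_X]
        ring
      · have h3 : len j < k := by omega
        simp only [hlow, h3, if_true, map_mul, map_sub, map_pow, eval_X, sub_zero]
        rfl
      · rw [hc0 j (by omega), map_zero, zero_mul]
    rw [hsub, sum_sub_distrib, ← map_sum, ← hR, sub_eq_zero] at h
    rw [h, ← sum_filter, filter_filter]
    refine sum_congr ?_ fun _ _ => rfl
    ext j
    simp only [mem_filter, mem_univ, true_and]
    omega
  refine ⟨k, ⟨j₁, hj₁⟩, P, R, fun j _ => (hPb j).involvesOnly, hRb.involvesOnly, hRrel,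
    ⟨j₁, hj₁, ?_⟩, ?_⟩
  · by_contra! h
    have h1 : c j₁ * X wIdx ^ (2 * k - 2) ∈ RingHom.ker Ev := (hker _).mpr h
    rcases hprime.mem_or_mem h1 with h2 | h2
    · exact hcj₁ (Ideal.Quotient.eq_zero_iff_mem.mpr h2)
    · obtain ⟨ζ, hζ, hne⟩ := hw
      have := (hker _).mp (hprime.mem_of_pow_mem _ h2) ζ hζ
      rw [eval_X] at this
      exact hne this
  · rintro l' rfl
    exact ⟨fun j _ => ⟨(hPb j).wt_le, (hPb j).degRhoW_le⟩, hRb.wt_le, hRb.degRhoW_le⟩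

end JetRelation

/-! ### Complexification of real hypersurfaces. -/

section Complexification

open scoped ContDiff
open Metric Set Filter

variable {n : ℕ}

/-- The map `Z ↦ (Z, Z̄)`, as a real-linear map. -/
noncomputable def diagStar (n : ℕ) : ZW n →L[ℝ] ZW n × ZW n :=
  (ContinuousLinearMap.id ℝ (ZW n)).prod (starL' ℝ : ZW n ≃L[ℝ] ZW n).toContinuousLinearMap

@[simp] theorem diagStar_apply (Z : ZW n) : diagStar n Z = (Z, star Z) := rfl

theorem exists_diagStar_decomp (y : ZW n × ZW n) :
    ∃ U W : ZW n, y = diagStar n U + Complex.I • diagStar n W := by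
  have hI : Complex.I * Complex.I = -1 := Complex.I_mul_I
  refine ⟨(2⁻¹ : ℂ) • (y.1 + star y.2), (-(Complex.I * 2⁻¹) : ℂ) • (y.1 - star y.2), ?_⟩
  simp only [diagStar_apply, star_smul, star_add, star_sub, star_star, star_neg, star_mul',
    Complex.star_def, map_inv₀, Complex.conj_I, Complex.conj_ofNat]
  refine Prod.ext ?_ ?_
  · simp only [Prod.fst_add, Prod.smul_fst]
    rw [smul_smul]
    rw [show Complex.I * -(Complex.I * 2⁻¹) = 2⁻¹ by linear_combination (-(2⁻¹ : ℂ)) * hI]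
    module
  · simp only [Prod.snd_add, Prod.smul_snd]
    rw [smul_smul]
    rw [show Complex.I * -(-Complex.I * 2⁻¹) = -2⁻¹ by linear_combination (2⁻¹ : ℂ) * hI]
    module

/-- The set {(Z, Z̄)} is totally real of maximal dimension: it and its multiple by i span the whole
space. -/
theorem clm_eq_zero_of_diagStar {L : ZW n × ZW n →L[ℂ] ℂ} (h : ∀ X, L (diagStar n X) = 0) :
    L = 0 := by
  refine ContinuousLinearMap.ext fun y => ?_
  obtain ⟨U, W, rfl⟩ := exists_diagStar_decomp y
  simp [h, -diagStar_apply]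

/-- On the diagonal L is a real functional and M vanishes on its kernel, so M is a complex multiple
of L there, hence everywhere. -/
theorem ker_le_ker_of_diagStar {L M : ZW n × ZW n →L[ℂ] ℂ}
    (hL : ∀ X, (L (diagStar n X)).im = 0)
    (h : ∀ X, L (diagStar n X) = 0 → M (diagStar n X) = 0) {y : ZW n × ZW n} (hy : L y = 0) :
    M y = 0 := by
  by_cases hX : ∀ X, L (diagStar n X) = 0
  · rw [clm_eq_zero_of_diagStar fun X => h X (hX X)]
    rfl
  push Not at hX
  obtain ⟨X₀, hX₀⟩ := hX
  have hre : ∀ X, L (diagStar n X) = ((L (diagStar n X)).re : ℂ) := fun X =>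
    Complex.ext (by simp) (by simp [hL X, -diagStar_apply])
  set c := M (diagStar n X₀) / L (diagStar n X₀) with hc
  have hML : M = c • L := by
    rw [← sub_eq_zero]
    refine clm_eq_zero_of_diagStar fun X => ?_
    have h1 : L (diagStar n (X - ((L (diagStar n X)).re / (L (diagStar n X₀)).re) • X₀)) = 0 := by
      rw [map_sub, map_smul, map_sub, ← Complex.coe_smul, map_smul, smul_eq_mul]
      push_cast
      rw [← hre, ← hre, div_mul_cancel₀ _ hX₀, sub_self]
    have h2 := h _ h1
    rw [map_sub, map_smul, map_sub, ← Complex.coe_smul, map_smul, smul_eq_mul] at h2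
    push_cast at h2
    rw [← hre, ← hre] at h2
    rw [sub_apply, smul_apply, smul_eq_mul, hc]
    linear_combination h2
  rw [hML, smul_apply, hy, smul_zero]

theorem tendsto_diagStar (P : ZW n) : Tendsto (diagStar n) (𝓝 P) (𝓝 (P, star P)) :=
  (diagStar n).continuous.tendsto P

theorem fderiv_diagStar_eq_zero {ψ : ZW n × ZW n → ℂ} {Z : ZW n}
    (hd : DifferentiableAt ℂ ψ (Z, star Z)) (h0 : ∀ᶠ Z' in 𝓝 Z, ψ (Z', star Z') = 0) (X : ZW n) :
    fderiv ℂ ψ (Z, star Z) (diagStar n X) = 0 := by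
  have h1 : HasFDerivAt (fun Z' => ψ (diagStar n Z'))
      (((fderiv ℂ ψ (Z, star Z)).restrictScalars ℝ).comp (diagStar n)) Z :=
    (hd.hasFDerivAt.restrictScalars ℝ).comp Z (diagStar n).hasFDerivAt
  have h2 : HasFDerivAt (fun Z' => ψ (diagStar n Z')) (0 : ZW n →L[ℝ] ℂ) Z :=
    (hasFDerivAt_const (0 : ℂ) Z).congr_of_eventuallyEq h0
  exact DFunLike.congr_fun (h1.unique h2) X

theorem im_fderiv_diagStar_eq_zero {ψ : ZW n × ZW n → ℂ} {Z : ZW n}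
    (hd : DifferentiableAt ℂ ψ (Z, star Z)) (h0 : ∀ᶠ Z' in 𝓝 Z, (ψ (Z', star Z')).im = 0)
    (X : ZW n) : (fderiv ℂ ψ (Z, star Z) (diagStar n X)).im = 0 := by
  have h1 : HasFDerivAt (fun Z' => (ψ (diagStar n Z')).im)
      (Complex.imCLM.comp (((fderiv ℂ ψ (Z, star Z)).restrictScalars ℝ).comp (diagStar n))) Z :=
    Complex.imCLM.hasFDerivAt.comp Z
      ((hd.hasFDerivAt.restrictScalars ℝ).comp Z (diagStar n).hasFDerivAt)
  have h2 : HasFDerivAt (fun Z' => (ψ (diagStar n Z')).im) (0 : ZW n →L[ℝ] ℝ) Z :=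
    (hasFDerivAt_const (0 : ℝ) Z).congr_of_eventuallyEq h0
  exact DFunLike.congr_fun (h1.unique h2) X

/-- A holomorphic function of `(Z, χ)` vanishing for `χ = Z̄` vanishes identically. -/
theorem eventually_eq_zero_of_diagStar {φ : ZW n × ZW n → ℂ} {P : ZW n}
    (hφ : ∀ᶠ x in 𝓝 (P, star P), DifferentiableAt ℂ φ x)
    (h0 : ∀ᶠ Z in 𝓝 P, φ (Z, star Z) = 0) : ∀ᶠ x in 𝓝 (P, star P), φ x = 0 := by
  have h0' : ∀ᶠ x in 𝓝 (P, star P), x ∈ {x : ZW n × ZW n | x.2 = star x.1} → φ x = 0 := by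
    have := (continuous_fst.tendsto (P, star P)).eventually h0
    filter_upwards [this] with x hx hxA
    rw [← hx, ← hxA]
  -- The submersion to a point has the whole space as zero set; the totally real diagonal satisfies
  -- the tangential criterion there.
  have := eventually_eq_zero_of_tangential (n := ∞) (g := fun _ => (0 : Fin 0 → ℂ))
    (A := {x : ZW n × ZW n | x.2 = star x.1}) (a := (P, star P)) (by simp) le_rfl rfl
    contDiffAt_const (fun w => ⟨0, Subsingleton.elim _ _⟩) (Eventually.of_forall fun _ _ => rfl)
    ?_ (contDiffAt_of_eventually_differentiableAt hφ) h0'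
  · filter_upwards [this] with x hx using hx rfl
  · intro ψ hψ hψ0
    have hd : ∀ᶠ x in 𝓝 (P, star P), DifferentiableAt ℂ ψ x :=
      ((hψ.of_le (m := 1) (by exact_mod_cast le_top)).eventually (by simp)).mono
        fun x hx => hx.differentiableAt (by simp)
    filter_upwards [hd, hψ0.eventually_nhds] with x hdx hx hxA X _
    obtain ⟨Z, Z'⟩ := x
    obtain rfl : Z' = star Z := hxA
    have h1 : ∀ᶠ Y in 𝓝 Z, ψ (Y, star Y) = 0 :=
      ((tendsto_diagStar Z).eventually hx).mono fun Y hY => hY rfl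
    rw [clm_eq_zero_of_diagStar (fderiv_diagStar_eq_zero hdx h1)]
    rfl

/-- A holomorphic function of `(Z, χ)` vanishing on the real hypersurface `ρ(Z, Z̄) = 0` vanishes on
its complexification `ρ(Z, χ) = 0`. -/
theorem eventually_eq_zero_of_real_hypersurface {ρ φ : ZW n × ZW n → ℂ} {P : ZW n}
    (hρ : AnalyticAt ℂ ρ (P, star P)) (hreal : ∀ᶠ Z in 𝓝 P, (ρ (Z, star Z)).im = 0)
    (hP : ρ (P, star P) = 0) (hne : fderiv ℂ ρ (P, star P) ≠ 0)
    (hφ : ∀ᶠ x in 𝓝 (P, star P), DifferentiableAt ℂ φ x)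
    (h0 : ∀ᶠ Z in 𝓝 P, ρ (Z, star Z) = 0 → φ (Z, star Z) = 0) :
    ∀ᶠ x in 𝓝 (P, star P), ρ x = 0 → φ x = 0 := by
  set A : Set (ZW n × ZW n) := {x | x.2 = star x.1 ∧ ρ x = 0} with hA
  have h0' : ∀ᶠ x in 𝓝 (P, star P), x ∈ A → φ x = 0 := by
    have := (continuous_fst.tendsto (P, star P)).eventually h0
    filter_upwards [this] with x hx hxA
    obtain ⟨Z, Z'⟩ := x
    obtain ⟨hZ', hxρ⟩ := hxA
    obtain rfl : Z' = star Z := hZ'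
    exact hx hxρ
  have hsurj : Function.Surjective (fderiv ℂ ρ (P, star P)) := by
    obtain ⟨y, hy⟩ : ∃ y, fderiv ℂ ρ (P, star P) y ≠ 0 := by
      by_contra! h
      exact hne (ContinuousLinearMap.ext h)
    intro c
    exact ⟨(c / fderiv ℂ ρ (P, star P) y) • y, by simp [hy]⟩
  refine eventually_eq_zero_of_tangential (n := ∞) (A := A) (by simp) le_rfl ⟨rfl, hP⟩
    hρ.contDiffAt hsurj (Eventually.of_forall fun x hx => hx.2) ?_
    (contDiffAt_of_eventually_differentiableAt hφ) h0'
  intro ψ hψ hψ0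
  have hd : ∀ᶠ x in 𝓝 (P, star P), DifferentiableAt ℂ ψ x :=
    ((hψ.of_le (m := 1) (by exact_mod_cast le_top)).eventually (by simp)).mono
      fun x hx => hx.differentiableAt (by simp)
  have hreal' : ∀ᶠ x : ZW n × ZW n in 𝓝 (P, star P),
      ∀ᶠ Z in 𝓝 x.1, (ρ (Z, star Z)).im = 0 :=
    (continuous_fst.tendsto (P, star P)).eventually hreal.eventually_nhds
  filter_upwards [hd, hψ0.eventually_nhds, hρ.eventually_analyticAt, hreal',
    hρ.fderiv.continuousAt.eventually_ne hne] with x hdx hx hρx hrx hnex hxA X hX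
  obtain ⟨Z, Z'⟩ := x
  obtain ⟨hZ', hρ0⟩ := hxA
  obtain rfl : Z' = star Z := hZ'
  set L := fderiv ℂ ρ (Z, star Z) with hL
  have hLim : ∀ X, (L (diagStar n X)).im = 0 :=
    im_fderiv_diagStar_eq_zero hρx.differentiableAt hrx
  refine ker_le_ker_of_diagStar hLim (fun Y hY => ?_) hX
  -- Re ρ(Y, Ȳ) is a real defining function with nonzero differential, so ψ, vanishing on the real
  -- hypersurface, has differential zero on its tangent space.
  have hs : HasStrictFDerivAt (fun Y => (ρ (diagStar n Y)).re)
      (Complex.reCLM.comp ((L.restrictScalars ℝ).comp (diagStar n))) Z :=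
    Complex.reCLM.hasStrictFDerivAt.comp Z
      ((hρx.hasStrictFDerivAt.restrictScalars ℝ).comp Z (diagStar n).hasStrictFDerivAt)
  have hψ' : HasFDerivAt (fun Y => ψ (diagStar n Y))
      (((fderiv ℂ ψ (Z, star Z)).restrictScalars ℝ).comp (diagStar n)) Z :=
    (hdx.hasFDerivAt.restrictScalars ℝ).comp Z (diagStar n).hasFDerivAt
  refine ker_le_ker_of_eventually_zero hs ?_ hψ' ?_ (X := Y) ?_
  · obtain ⟨Y₀, hY₀⟩ : ∃ Y₀, L (diagStar n Y₀) ≠ 0 := by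
      by_contra! h
      exact hnex (clm_eq_zero_of_diagStar h)
    have hre : (L (diagStar n Y₀)).re ≠ 0 := fun h => hY₀ (Complex.ext h (hLim Y₀))
    intro c
    refine ⟨(c / (L (diagStar n Y₀)).re) • Y₀, ?_⟩
    rw [map_smul, smul_eq_mul]
    exact div_mul_cancel₀ c hre
  · filter_upwards [(tendsto_diagStar Z).eventually hx, hrx] with Y hY1 hY2 hY3
    refine hY1 ⟨rfl, ?_⟩
    refine Complex.ext ?_ hY2
    simpa [hρ0] using hY3
  · have : L (diagStar n Y) = 0 := hY
    simp [this, -diagStar_apply]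

/-- The hermitian symmetry of real-valued functions. -/
theorem eventually_hermitian {ρ : ZW n × ZW n → ℂ} {P : ZW n}
    (hρ : AnalyticAt ℂ ρ (P, star P)) (hreal : ∀ᶠ Z in 𝓝 P, (ρ (Z, star Z)).im = 0) :
    ∀ᶠ x in 𝓝 (P, star P), ρ x = star (ρ (star x.2, star x.1)) := by
  have hc : Tendsto (fun x : ZW n × ZW n => (star x.2, star x.1)) (𝓝 (P, star P))
      (𝓝 (P, star P)) := by
    have : Continuous (fun x : ZW n × ZW n => (star x.2, star x.1)) := by fun_prop
    simpa using this.tendsto (P, star P)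
  have hd : ∀ᶠ x in 𝓝 (P, star P), DifferentiableAt ℂ ρ x :=
    hρ.eventually_analyticAt.mono fun x hx => hx.differentiableAt
  have := eventually_eq_zero_of_diagStar (φ := fun x => ρ x - star (ρ (star x.2, star x.1)))
    (P := P) ?_ ?_
  · filter_upwards [this] with x hx using sub_eq_zero.mp hx
  · filter_upwards [hd, hc.eventually hd] with x hx hx'
    refine hx.fun_sub ?_
    have h1 : DifferentiableAt ℂ (fun y : ZW n × ZW n => ρ (y.2, y.1)) (star x) :=
      DifferentiableAt.comp (g := ρ) (star x) hx' (by fun_prop)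
    have h2 := h1.star_star
    rw [star_star] at h2
    exact h2
  · filter_upwards [hreal] with Z hZ
    rw [star_star, sub_eq_zero]
    exact Complex.ext (by simp) (by simp [hZ])

end Complexification

/-! ### Holomorphic dependence of derivatives on base point, parameter and functional. -/

section VectorJets

open scoped ContDiff
open Metric Set Filter

variable {n : ℕ}

theorem idx_induction {p : (Fin n → ℕ) → ℕ → Prop} (h0 : p 0 0)
    (hw : ∀ β s, p β s → p β (s + 1)) (hz : ∀ β s i, p β s → p (β + Pi.single i 1) s) :
    ∀ β s, p β s := by
  have h1 : ∀ s, p 0 s := fun s => by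
    induction s with
    | zero => exact h0
    | succ s ih => exact hw 0 s ih
  have h2 : ∀ k β s, multiLength β = k → p β s := by
    intro k
    induction k with
    | zero =>
      intro β s hβ
      have : β = 0 := by
        ext x
        have : ∀ x ∈ Finset.univ, β x = 0 := by simpa [multiLength] using hβ
        exact this x (by simp)
      exact this ▸ h1 s
    | succ k ih =>
      intro β s hβ
      obtain ⟨γ, i, rfl, hγ⟩ := exists_eq_add_single hβ
      exact hz γ s i (ih γ s hγ)
  exact fun β s => h2 _ β s rfl

/-- The jets of the affine functions of a vector-valued holomorphic map `T` come from the jets of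
`T`. -/
theorem exists_vector_jet {F : Type*} [NormedAddCommGroup F] [NormedSpace ℂ F]
    [FiniteDimensional ℂ F] {V : Set (ZW n)} (hV : IsOpen V) {T : ZW n → F}
    (hT : DifferentiableOn ℂ T V) (β : Fin n → ℕ) (s : ℕ) :
    ∃ τ : ZW n → F, DifferentiableOn ℂ τ V ∧ ∀ (v : F →L[ℂ] ℂ) (c : ℂ),
      EqOn (mixedDeriv β s fun Z => v (T Z) - c)
        (fun Z => v (τ Z) - if (β, s) = (0, 0) then c else 0) V := by
  have hd : ∀ (v : F →L[ℂ] ℂ) (c : ℂ), DifferentiableOn ℂ (fun Z => v (T Z) - c) V := fun v c =>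
    (v.differentiable.comp_differentiableOn hT).sub_const c
  have hstep : ∀ (τ : ZW n → F), DifferentiableOn ℂ τ V → ∀ (u : ZW n) (v : F →L[ℂ] ℂ) (c : ℂ),
      EqOn (dirDeriv u fun Z => v (τ Z) - c) (fun Z => v (fderiv ℂ τ Z u)) V := by
    intro τ hτ u v c Z hZ
    have h1 : HasFDerivAt (fun Z => v (τ Z) - c) (v.comp (fderiv ℂ τ Z)) Z :=
      (v.hasFDerivAt.comp Z (hτ.differentiableAt (hV.mem_nhds hZ)).hasFDerivAt).sub_const c
    simp [dirDeriv, h1.fderiv]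
  induction β, s using idx_induction with
  | h0 =>
    refine ⟨T, hT, fun v c Z _ => ?_⟩
    rw [mixedDeriv_zero]
    simp
  | hw β s ih =>
    obtain ⟨τ, hτ, h⟩ := ih
    refine ⟨fun Z => fderiv ℂ τ Z (0, 1),
      fun Z hZ => (differentiableAt_fderiv_apply hV hτ hZ _).differentiableWithinAt,
      fun v c => (mixedDeriv_succ hV (hd v c) β s).trans
        (((h v c).dirDeriv hV (0, 1)).trans ((hstep τ hτ (0, 1) v _).trans fun Z _ => ?_))⟩
    simp
  | hz β s i ih =>
    obtain ⟨τ, hτ, h⟩ := ih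
    refine ⟨fun Z => fderiv ℂ τ Z (Pi.single i 1, 0),
      fun Z hZ => (differentiableAt_fderiv_apply hV hτ hZ _).differentiableWithinAt,
      fun v c => (mixedDeriv_add_single hV (hd v c) β s i).trans
        (((h v c).dirDeriv hV (Pi.single i 1, 0)).trans
          ((hstep τ hτ (Pi.single i 1, 0) v _).trans fun Z _ => ?_))⟩
    have : (β + Pi.single i 1, s) ≠ (0, 0) := fun h => by
      have := congrFun (congrArg Prod.fst h) i
      simp at this
    rw [if_neg this, sub_zero]

/-- The derivatives of `ρ(Z, χ)` in `Z` are holomorphic in `(Z, χ)`. -/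
theorem exists_joint_jet {U : Set (ZW n)} (hU : IsOpen U) {ρ : ZW n × ZW n → ℂ}
    (hρ : AnalyticOnNhd ℂ ρ {x | x.1 ∈ U ∧ star x.2 ∈ U}) (β : Fin n → ℕ) (s : ℕ) :
    ∃ τ : ZW n × ZW n → ℂ, DifferentiableOn ℂ τ {x | x.1 ∈ U ∧ star x.2 ∈ U} ∧
      ∀ ζ ∈ U, EqOn (mixedDeriv β s fun Z => ρ (Z, star ζ)) (fun Z => τ (Z, star ζ)) U := by
  set Ω : Set (ZW n × ZW n) := {x | x.1 ∈ U ∧ star x.2 ∈ U} with hΩ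
  have hΩo : IsOpen Ω := (hU.preimage continuous_fst).inter
    (hU.preimage (continuous_star.comp continuous_snd))
  have hmem : ∀ ζ ∈ U, ∀ Z ∈ U, (Z, star ζ) ∈ Ω := fun ζ hζ Z hZ =>
    ⟨hZ, by simpa using hζ⟩
  have hslice : ∀ τ : ZW n × ZW n → ℂ, DifferentiableOn ℂ τ Ω → ∀ ζ ∈ U,
      DifferentiableOn ℂ (fun Z => τ (Z, star ζ)) U := fun τ hτ ζ hζ Z hZ =>
    (DifferentiableAt.comp (g := τ) Z (hτ.differentiableAt (hΩo.mem_nhds (hmem ζ hζ Z hZ)))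
      (by fun_prop)).differentiableWithinAt
  have hstep : ∀ τ : ZW n × ZW n → ℂ, DifferentiableOn ℂ τ Ω → ∀ ζ ∈ U, ∀ u : ZW n,
      EqOn (dirDeriv u fun Z => τ (Z, star ζ)) (fun Z => fderiv ℂ τ (Z, star ζ) (u, 0)) U := by
    intro τ hτ ζ hζ u Z hZ
    have h1 : HasFDerivAt (fun Z => τ (Z, star ζ))
        ((fderiv ℂ τ (Z, star ζ)).comp (ContinuousLinearMap.inl ℂ (ZW n) (ZW n))) Z :=
      (hτ.differentiableAt (hΩo.mem_nhds (hmem ζ hζ Z hZ))).hasFDerivAt.comp Z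
        (hasFDerivAt_prodMk_left Z (star ζ))
    simp only [dirDeriv, h1.fderiv]
    simp
  have hρd : DifferentiableOn ℂ ρ Ω := hρ.differentiableOn
  induction β, s using idx_induction with
  | h0 => exact ⟨ρ, hρd, fun ζ _ Z _ => by rw [mixedDeriv_zero]; rfl⟩
  | hw β s ih =>
    obtain ⟨τ, hτ, h⟩ := ih
    exact ⟨fun x => fderiv ℂ τ x ((0, 1), 0),
      fun x hx => (differentiableAt_fderiv_apply hΩo hτ hx _).differentiableWithinAt,
      fun ζ hζ => (mixedDeriv_succ hU (hslice ρ hρd ζ hζ) β s).trans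
        (((h ζ hζ).dirDeriv hU (0, 1)).trans (hstep τ hτ ζ hζ (0, 1)))⟩
  | hz β s i ih =>
    obtain ⟨τ, hτ, h⟩ := ih
    exact ⟨fun x => fderiv ℂ τ x ((Pi.single i 1, 0), 0),
      fun x hx => (differentiableAt_fderiv_apply hΩo hτ hx _).differentiableWithinAt,
      fun ζ hζ => (mixedDeriv_add_single hU (hslice ρ hρd ζ hζ) β s i).trans
        (((h ζ hζ).dirDeriv hU (Pi.single i 1, 0)).trans (hstep τ hτ ζ hζ (Pi.single i 1, 0)))⟩

/-- Polynomials in the derivatives `ρ_{z^β w^s}(P, ζ̄)` are antiholomorphic in `ζ`. -/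
theorem differentiableOn_star_eval_rhoDeriv {U : Set (ZW n)} (hU : IsOpen U)
    {ρ : ZW n × ZW n → ℂ} (hρ : AnalyticOnNhd ℂ ρ {x | x.1 ∈ U ∧ star x.2 ∈ U}) {P : ZW n}
    (hP : P ∈ U) (Q : JetPoly n) :
    DifferentiableOn ℂ (fun ζ => star (MvPolynomial.eval (rhoDeriv ρ P ζ) Q)) U := by
  induction Q using MvPolynomial.induction_on with
  | C c => simp
  | add p q hp hq => simpa using hp.fun_add hq
  | mul_X p b hp =>
    simp only [map_mul, MvPolynomial.eval_X, star_mul']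
    refine hp.fun_mul fun ζ hζ => ?_
    obtain ⟨τ, hτ, h⟩ := exists_joint_jet hU hρ b.1 b.2
    have hΩo : IsOpen {x : ZW n × ZW n | x.1 ∈ U ∧ star x.2 ∈ U} :=
      (hU.preimage continuous_fst).inter (hU.preimage (continuous_star.comp continuous_snd))
    have h1 : DifferentiableAt ℂ (fun χ => τ (P, χ)) (star ζ) :=
      DifferentiableAt.comp (g := τ) (star ζ)
        (hτ.differentiableAt (hΩo.mem_nhds ⟨hP, by simpa using hζ⟩)) (by fun_prop)
    have h2 := h1.star_star
    rw [star_star] at h2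
    refine (h2.differentiableWithinAt (s := U)).congr (fun ξ hξ => ?_) ?_
    · exact congrArg star (h ξ hξ hP)
    · exact congrArg star (h ζ hζ hP)

end VectorJets

/-! ### The complexified hyperquadric and its pullback. -/

section HyperquadricForm

open scoped ContDiff
open Metric Set Filter

variable {N : ℕ}

/-- The linear functional `x ↦ x_w / 2i - h(x_z, χ_z)`. -/
noncomputable def quadricFunctional (A : Matrix (Fin N) (Fin N) ℂ) (χ : ZW N) : ZW N →L[ℂ] ℂ :=
  LinearMap.toContinuousLinearMap
    { toFun := fun x => x.2 / (2 * Complex.I) - χ.1 ⬝ᵥ A.mulVec x.1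
      map_add' := fun x y => by
        simp only [Prod.snd_add, Prod.fst_add, Matrix.mulVec_add, dotProduct_add]
        ring
      map_smul' := fun c x => by
        simp only [Prod.smul_snd, Prod.smul_fst, Matrix.mulVec_smul, dotProduct_smul, smul_eq_mul,
          RingHom.id_apply]
        ring }

theorem quadricFunctional_apply (A : Matrix (Fin N) (Fin N) ℂ) (χ x : ZW N) :
    quadricFunctional A χ x = x.2 / (2 * Complex.I) - χ.1 ⬝ᵥ A.mulVec x.1 := rfl

/-- The complexification of the defining function of a hyperquadric. -/
noncomputable def quadricForm (A : Matrix (Fin N) (Fin N) ℂ) (x : ZW N × ZW N) : ℂ :=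
  quadricFunctional A x.2 x.1 - x.2.2 / (2 * Complex.I)

theorem differentiable_quadricForm (A : Matrix (Fin N) (Fin N) ℂ) :
    Differentiable ℂ (quadricForm A) := by
  have : quadricForm A = fun x : ZW N × ZW N => x.1.2 / (2 * Complex.I) -
      ∑ a, x.2.1 a * ∑ b, A a b * x.1.1 b - x.2.2 / (2 * Complex.I) := by
    ext x
    simp [quadricForm, quadricFunctional_apply, dotProduct, Matrix.mulVec]
  rw [this]
  fun_prop

theorem continuous_quadricFunctional (A : Matrix (Fin N) (Fin N) ℂ) (y : ZW N) :
    Continuous fun χ => quadricFunctional A χ y := by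
  simp only [quadricFunctional_apply, dotProduct]
  fun_prop

/-- The complexified defining function of a hyperquadric, pulled back by `T`. -/
noncomputable def pullbackForm {n : ℕ} (A : Matrix (Fin N) (Fin N) ℂ) (T : ZW n → ZW N)
    (x : ZW n × ZW n) : ℂ :=
  quadricForm A (T x.1, star (T (star x.2)))

theorem differentiableAt_pullbackForm {n : ℕ} (A : Matrix (Fin N) (Fin N) ℂ) {T : ZW n → ZW N}
    {x : ZW n × ZW n} (h1 : DifferentiableAt ℂ T x.1) (h2 : DifferentiableAt ℂ T (star x.2)) :
    DifferentiableAt ℂ (pullbackForm A T) x := by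
  have h3 : DifferentiableAt ℂ (fun χ => star (T (star χ))) x.2 := by
    have := h2.star_star
    rw [star_star] at this
    exact this
  have h4 : DifferentiableAt ℂ (fun x : ZW n × ZW n => (T x.1, star (T (star x.2)))) x :=
    (DifferentiableAt.comp (g := T) x h1 differentiableAt_fst).prodMk
      (DifferentiableAt.comp (g := fun χ => star (T (star χ))) x h3 differentiableAt_snd)
  exact DifferentiableAt.comp (g := quadricForm A) x (differentiable_quadricForm A _) h4

/-- For fixed ζ the pullback is an affine function of T(Z), which makes its derivatives linear in
one functional depending on ζ. -/
theorem pullbackForm_slice {n : ℕ} (A : Matrix (Fin N) (Fin N) ℂ) (T : ZW n → ZW N) (ζ : ZW n) :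
    (fun Z => pullbackForm A T (Z, star ζ)) =
      fun Z => quadricFunctional A (star (T ζ)) (T Z) - (star (T ζ)).2 / (2 * Complex.I) := by
  ext Z
  simp [pullbackForm, quadricForm]

/-- Here `a` is a left inverse of J, and `lam` are coordinates on its kernel, of dimension (n+m+1) -
(n+1) = m. These m directions carry the unknowns to be eliminated. -/
theorem exists_adapted_coordinates {n m : ℕ} {J : ZW n →ₗ[ℂ] ZW (n + m)}
    (hJ : Function.Injective J) :
    ∃ (a : ZW (n + m) →ₗ[ℂ] ZW n) (lam : ZW (n + m) →ₗ[ℂ] (Fin m → ℂ))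
      (σ : (Fin m → ℂ) →ₗ[ℂ] ZW (n + m)), ∀ x, x = J (a x) + σ (lam x) := by
  obtain ⟨a, ha⟩ := J.exists_leftInverse_of_injective (LinearMap.ker_eq_bot.mpr hJ)
  have haJ : ∀ y, a (J y) = y := fun y => DFunLike.congr_fun ha y
  have hsurj : Function.Surjective a := fun y => ⟨J y, haJ y⟩
  have hrank : Module.finrank ℂ a.ker = m := by
    have h1 := a.finrank_range_add_finrank_ker
    rw [LinearMap.range_eq_top.mpr hsurj, finrank_top] at h1
    simp at h1
    omega
  let e : a.ker ≃ₗ[ℂ] (Fin m → ℂ) := LinearEquiv.ofFinrankEq _ _ (by simp [hrank])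
  let q : ZW (n + m) →ₗ[ℂ] a.ker := (LinearMap.id - J.comp a).codRestrict a.ker fun x => by
    simp [haJ]
  refine ⟨a, e.toLinearMap.comp q, a.ker.subtype.comp e.symm.toLinearMap, fun x => ?_⟩
  simp [q]

end HyperquadricForm

/-! ### The overdetermined linear system at p and its elimination. -/

section Core

open scoped ContDiff
open Metric Set Filter

open MvPolynomial

variable {n m : ℕ}

/-- The coefficient of `∂_w` in the operator `L` after elimination of the `∂_{z_i}` directions. -/
noncomputable def wPart (L : List (((Fin n → ℕ) × ℕ) × JetPoly n))
    (a : (Fin n → ℕ) × ℕ → ZW n) : JetPoly n :=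
  (L.map fun x => x.2 * (C (a x.1).2 * X wIdx + ∑ i, C ((a x.1).1 i) * X (zIdx i))).sum

/-- The coefficients of the operator `L` in the directions complementary to the tangent space. -/
noncomputable def normalPart (L : List (((Fin n → ℕ) × ℕ) × JetPoly n))
    (lam : (Fin n → ℕ) × ℕ → Fin m → ℂ) (c : Fin m) : JetPoly n :=
  (L.map fun x => x.2 * C (lam x.1 c)).sum

theorem jetBound_wPart {L : List (((Fin n → ℕ) × ℕ) × JetPoly n)} {k a d : ℕ} (hk : 2 ≤ k)
    (hL : ∀ x ∈ L, JetBound k a d x.2) (q : (Fin n → ℕ) × ℕ → ZW n) :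
    JetBound k (a + 1) (d + 1) (wPart L q) := by
  refine JetBound.listSum _ fun p hp => ?_
  obtain ⟨x, hx, rfl⟩ := List.mem_map.mp hp
  refine (hL x hx).mul (JetBound.add ?_ (JetBound.sum _ fun i _ => ?_))
  · exact ((JetBound.X_wIdx (by omega)).const_mul _).mono le_rfl (by omega) le_rfl
  · exact (JetBound.X_zIdx hk i).const_mul _

theorem jetBound_normalPart {L : List (((Fin n → ℕ) × ℕ) × JetPoly n)} {k a d : ℕ}
    (hL : ∀ x ∈ L, JetBound k a d x.2) (lam : (Fin n → ℕ) × ℕ → Fin m → ℂ) (c : Fin m) :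
    JetBound k a d (normalPart L lam c) := by
  refine JetBound.listSum _ fun p hp => ?_
  obtain ⟨x, hx, rfl⟩ := List.mem_map.mp hp
  rw [mul_comm]
  exact (hL x hx).const_mul _

/-- The values u are known only through r_w u, since eliminating the ∂_{z_i} directions would divide
by r_w; the prefactor keeps all coefficients polynomial. -/
theorem mul_sum_eq_wPart_add_normalPart (L : List (((Fin n → ℕ) × ℕ) × JetPoly n))
    (jr u : (Fin n → ℕ) × ℕ → ℂ) (a : (Fin n → ℕ) × ℕ → ZW n)
    (lam : (Fin n → ℕ) × ℕ → Fin m → ℂ) (om : ℂ) (s : Fin m → ℂ)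
    (hu : ∀ x ∈ L, jr wIdx * u x.1 = ((a x.1).2 * jr wIdx + ∑ i, (a x.1).1 i * jr (zIdx i)) * om +
      jr wIdx * ∑ c, lam x.1 c * s c) :
    jr wIdx * (L.map fun x => eval jr x.2 * u x.1).sum =
      eval jr (wPart L a) * om + jr wIdx * ∑ c, eval jr (normalPart L lam c) * s c := by
  induction L with
  | nil => simp [wPart, normalPart]
  | cons x L ih =>
    have h1 := ih fun y hy => hu y (by simp [hy])
    have h2 := hu x (by simp)
    have h3 : eval jr (wPart (x :: L) a) = eval jr x.2 * ((a x.1).2 * jr wIdx +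
        ∑ i, (a x.1).1 i * jr (zIdx i)) + eval jr (wPart L a) := by
      simp [wPart]
    have h4 : ∀ c, eval jr (normalPart (x :: L) lam c) = eval jr x.2 * lam x.1 c +
        eval jr (normalPart L lam c) := by
      intro c
      simp [normalPart]
    have h5 : ∑ c, eval jr x.2 * lam x.1 c * s c = eval jr x.2 * ∑ c, lam x.1 c * s c := by
      rw [Finset.mul_sum]
      exact Finset.sum_congr rfl fun c _ => mul_assoc _ _ _
    simp only [h4, h3, add_mul, Finset.sum_add_distrib, h5, List.map_cons, List.sum_cons]
    linear_combination h1 + eval jr x.2 * h2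

theorem map_map_eq_sum_single {J : ZW n →L[ℂ] ZW (n + m)} (v : ZW (n + m) →L[ℂ] ℂ) (y : ZW n) :
    v (J y) = ∑ i, y.1 i * v (J (Pi.single i 1, 0)) + y.2 * v (J (0, 1)) := by
  have hy : y = ∑ i, y.1 i • ((Pi.single i 1 : Fin n → ℂ), (0 : ℂ)) + y.2 • ((0 : Fin n → ℂ), 1) := by
    refine Prod.ext ?_ ?_
    · ext j
      simp [Prod.fst_sum, Finset.sum_apply, Pi.single_apply]
    · simp [Prod.snd_sum]
  conv_lhs => rw [hy]
  simp only [map_add, map_sum, map_smul, smul_eq_mul]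

/-- The relations between the derivatives of `ρ` given by a holomorphic map `T` to the hyperquadric
with matrix `A`. -/
theorem exists_relation_of_map {U : Set (ZW n)} (hU : IsOpen U) {P : ZW n} (hP : P ∈ U)
    {ρ : ZW n × ZW n → ℂ} (hρ : AnalyticOnNhd ℂ ρ {x | x.1 ∈ U ∧ star x.2 ∈ U})
    (hreal : ∀ᶠ Z in 𝓝 P, (ρ (Z, star Z)).im = 0) (hρP : ρ (P, star P) = 0)
    (hρw : rhoDeriv ρ P P (0, 1) ≠ 0)
    {T : ZW n → ZW (n + m)} (hT : ∀ᶠ Z in 𝓝 P, DifferentiableAt ℂ T Z)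
    (hTinj : Function.Injective (fderiv ℂ T P))
    (A : Matrix (Fin (n + m)) (Fin (n + m)) ℂ)
    (hvan : ∀ᶠ Z in 𝓝 P, ρ (Z, star Z) = 0 → pullbackForm A T (Z, star Z) = 0)
    (htrans : fderiv ℂ (pullbackForm A T) (P, star P) ≠ 0)
    {S : Set (ZW n)} (hS : IsIrreducibleSubvariety U S)
    (hSsub : S ⊆ segreVariety U ρ P) (hPS : P ∈ S)
    (α : Fin (m + 1) → Fin n → ℕ) (hα : ∀ j, 2 ≤ multiLength (α j)) :
    ∃ k : ℕ, (∃ j, multiLength (α j) = k) ∧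
      ∃ (P' : Fin (m + 1) → JetPoly n) (R : JetPoly n),
        (∀ j, multiLength (α j) = k → (P' j).InvolvesOnly k) ∧ R.InvolvesOnly k ∧
        (∀ ζ ∈ S,
          ∑ j with multiLength (α j) = k,
              eval (rhoDeriv ρ P ζ) (P' j) * rhoDeriv ρ P ζ (α j, 0) = eval (rhoDeriv ρ P ζ) R) ∧
        (∃ j, multiLength (α j) = k ∧ ∃ ζ ∈ S, eval (rhoDeriv ρ P ζ) (P' j) ≠ 0) ∧
        ∀ l : ℕ, l = Finset.card {j | multiLength (α j) ≤ k} →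
          (∀ j, multiLength (α j) = k →
            (P' j).wt ≤ (2 * k - 2) * (l - 1) ∧ (P' j).degRhoW ≤ (2 * k - 2) * l) ∧
          R.wt ≤ (2 * k - 2) * l + 1 ∧ R.degRhoW ≤ (2 * k - 2) * l + 1 := by
  have hΩP : ∀ ζ ∈ U, ∀ Z ∈ U, (Z, star ζ) ∈ {x : ZW n × ZW n | x.1 ∈ U ∧ star x.2 ∈ U} :=
    fun ζ hζ Z hZ => ⟨hZ, by simpa using hζ⟩
  have hρPan : AnalyticAt ℂ ρ (P, star P) := hρ _ (hΩP P hP P hP)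
  have hslice : ∀ ζ ∈ U, DifferentiableOn ℂ (fun Z => ρ (Z, star ζ)) U := fun ζ hζ Z hZ =>
    (DifferentiableAt.comp (g := ρ) Z (hρ _ (hΩP ζ hζ Z hZ)).differentiableAt
      (by fun_prop)).differentiableWithinAt
  have hslice' : ∀ {ψ : ZW n × ZW n → ℂ} {ζ Z : ZW n}, DifferentiableAt ℂ ψ (Z, star ζ) →
      fderiv ℂ (fun Z => ψ (Z, star ζ)) Z (0, 1) = fderiv ℂ ψ (Z, star ζ) ((0, 1), 0) := by
    intro ψ ζ Z h
    have h1 : HasFDerivAt (fun Z => ψ (Z, star ζ))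
        ((fderiv ℂ ψ (Z, star ζ)).comp (ContinuousLinearMap.inl ℂ (ZW n) (ZW n))) Z :=
      h.hasFDerivAt.comp Z (hasFDerivAt_prodMk_left Z (star ζ))
    rw [h1.fderiv]
    simp
  have hρw' : fderiv ℂ ρ (P, star P) ((0, 1), 0) ≠ 0 := by
    rw [rhoDeriv_eq_jet, jet_zero_one] at hρw
    rwa [← hslice' hρPan.differentiableAt]
  have hρ'ne : fderiv ℂ ρ (P, star P) ≠ 0 := fun h => hρw' (by rw [h]; rfl)
  -- the pulled back equation vanishes on the complexification of the hypersurface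
  have hstar : Tendsto (fun x : ZW n × ZW n => star x.2) (𝓝 (P, star P)) (𝓝 P) := by
    have : Continuous (fun x : ZW n × ZW n => star x.2) := by fun_prop
    simpa using this.tendsto (P, star P)
  have hRd : ∀ᶠ x in 𝓝 (P, star P), DifferentiableAt ℂ (pullbackForm A T) x := by
    filter_upwards [(continuous_fst.tendsto (P, star P)).eventually hT, hstar.eventually hT] with
      x h1 h2 using differentiableAt_pullbackForm A h1 h2
  have hRz : ∀ᶠ x in 𝓝 (P, star P), ρ x = 0 → pullbackForm A T x = 0 :=
    eventually_eq_zero_of_real_hypersurface hρPan hreal hρP hρ'ne hRd hvan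
  -- transversality
  have hRw : fderiv ℂ (pullbackForm A T) (P, star P) ((0, 1), 0) ≠ 0 := by
    intro h0
    refine htrans (ContinuousLinearMap.ext fun y => ?_)
    have hsurj : Function.Surjective (fderiv ℂ ρ (P, star P)) := fun c =>
      ⟨(c / fderiv ℂ ρ (P, star P) ((0, 1), 0)) • ((0, 1), 0), by
        rw [map_smul, smul_eq_mul, div_mul_cancel₀ _ hρw']⟩
    -- Each y is corrected along ∂_w to lie in ker dρ, where the differential of the pullback
    -- vanishes; if its ∂_w part vanished too, it would be zero.
    have := ker_le_ker_of_eventually_zero (hρPan.hasStrictFDerivAt) hsurj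
      hRd.self_of_nhds.hasFDerivAt (by simpa [hρP] using hRz)
      (X := y - (fderiv ℂ ρ (P, star P) y / fderiv ℂ ρ (P, star P) ((0, 1), 0)) • ((0, 1), 0))
      (by rw [map_sub, map_smul, smul_eq_mul, div_mul_cancel₀ _ hρw', sub_self])
    rw [map_sub, map_smul, h0, smul_zero, sub_zero] at this
    simpa using this
  -- jets of `T` and adapted coordinates
  obtain ⟨V₀, hV₀, hV₀o, hPV₀⟩ := _root_.eventually_nhds_iff.mp hT
  have hTd : DifferentiableOn ℂ T V₀ := fun Z hZ => (hV₀ Z hZ).differentiableWithinAt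
  have hTP : HasFDerivAt T (fderiv ℂ T P) P := (hV₀ P hPV₀).hasFDerivAt
  choose τ _ hτ using fun b : (Fin n → ℕ) × ℕ => exists_vector_jet hV₀o hTd b.1 b.2
  set J := fderiv ℂ T P with hJ
  obtain ⟨a, lam, σ, hdec⟩ := exists_adapted_coordinates (J := J.toLinearMap) hTinj
  choose R₀ L hR₀ hL hop using fun j => exists_segre_expansion (multiLength (α j) - 2) (α j)
    (by have := hα j; omega)
  set TT : Fin (m + 1) → JetPoly n := fun j => R₀ j + wPart (L j) (fun b => a (τ b P)) with hTT
  set DD : Fin (m + 1) → Fin m → JetPoly n := fun j =>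
    normalPart (L j) (fun b => lam (τ b P)) with hDD
  -- continuity in the parameter
  have hwcont : ∀ᶠ ζ in 𝓝 P, rhoDeriv ρ P ζ wIdx ≠ 0 := by
    have h1 := differentiableOn_star_eval_rhoDeriv hU hρ hP (X wIdx)
    have h2 : ContinuousAt (fun ζ => star (eval (rhoDeriv ρ P ζ) (X wIdx))) P :=
      (h1.differentiableAt (hU.mem_nhds hP)).continuousAt
    have h3 : star (eval (rhoDeriv ρ P P) (X wIdx)) ≠ 0 := by
      rw [eval_X]
      exact star_ne_zero.mpr hρw
    filter_upwards [h2.eventually_ne h3] with ζ hζ h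
    exact hζ (by simp [h])
  -- At ζ = P this number is the ∂_w-derivative of the pulled back equation, nonzero by
  -- transversality; it stays nonzero by continuity.
  have hom : ∀ᶠ ζ in 𝓝 P, quadricFunctional A (star (T ζ)) (J (0, 1)) ≠ 0 := by
    have h1 : ContinuousAt (fun ζ => quadricFunctional A (star (T ζ)) (J (0, 1))) P :=
      ((continuous_quadricFunctional A (J (0, 1))).continuousAt).comp
        (continuous_star.continuousAt.comp hTP.continuousAt)
    refine h1.eventually_ne ?_
    rw [← hslice' hRd.self_of_nhds, pullbackForm_slice] at hRw
    have h2 : HasFDerivAt (fun Z => quadricFunctional A (star (T P)) (T Z) -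
        (star (T P)).2 / (2 * Complex.I)) ((quadricFunctional A (star (T P))).comp J) P :=
      ((quadricFunctional A (star (T P))).hasFDerivAt.comp P hTP).sub_const _
    rw [h2.fderiv] at hRw
    exact hRw
  have hpar : Tendsto (fun ζ : ZW n => (P, star ζ)) (𝓝 P) (𝓝 (P, star P)) := by
    have : Continuous (fun ζ : ZW n => (P, star ζ)) := by fun_prop
    exact this.tendsto P
  -- the relation at the points of `S` near `P`
  have hlocal : ∀ᶠ ζ in 𝓝 P, ζ ∈ S → ∃ s : Fin m → ℂ, ∃ om : ℂ, om ≠ 0 ∧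
      (∀ j, eval (rhoDeriv ρ P ζ)
        (TT j - X wIdx ^ (2 * multiLength (α j) - 2) * X (α j, 0)) * om +
        rhoDeriv ρ P ζ wIdx * ∑ c, eval (rhoDeriv ρ P ζ) (DD j c) * s c = 0) := by
    filter_upwards [hwcont, hom, hpar.eventually (eventually_hermitian hρPan hreal),
      hpar.eventually hRz.eventually_nhds] with ζ hw hom hherm hz hζS
    have hζU : ζ ∈ U := (hSsub hζS).1
    -- Symmetry of Segre varieties: ζ lies on that of P exactly when P lies on that of ζ.
    have hρ0 : ρ (P, star ζ) = 0 := by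
      rw [hherm, star_star, (hSsub hζS).2, star_zero]
    set r : ZW n → ℂ := fun Z => ρ (Z, star ζ) with hr
    set v := quadricFunctional A (star (T ζ)) with hv
    set e : ℂ := (star (T ζ)).2 / (2 * Complex.I) with he
    set f : ZW n → ℂ := fun Z => v (T Z) - e with hf
    have hfz : ∀ᶠ Z in 𝓝 P, r Z = 0 → f Z = 0 := by
      have h1 : Tendsto (fun Z : ZW n => (Z, star ζ)) (𝓝 P) (𝓝 (P, star ζ)) := by
        have : Continuous (fun Z : ZW n => (Z, star ζ)) := by fun_prop
        exact this.tendsto P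
      filter_upwards [h1.eventually hz] with Z hZ hrZ
      have h2 := congrFun (pullbackForm_slice A T ζ) Z
      rw [hZ hrZ] at h2
      exact h2.symm
    have hrw : ∀ᶠ Z in 𝓝 P, derivW r Z ≠ 0 := by
      have h1 : DifferentiableOn ℂ (derivW r) U := (hslice ζ hζU).dirDeriv hU (0, 1)
      refine (h1.differentiableAt (hU.mem_nhds hP)).continuousAt.eventually_ne ?_
      rwa [← jet_zero_one]
    obtain ⟨V, hV, hVo, hPV⟩ := _root_.eventually_nhds_iff.mp
      ((hfz.and hrw).and ((hU.eventually_mem hP).and (hV₀o.eventually_mem hPV₀)))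
    have hrV : DifferentiableOn ℂ r V := (hslice ζ hζU).mono fun Z hZ => (hV Z hZ).2.1
    have hfV : DifferentiableOn ℂ f V :=
      (v.differentiable.comp_differentiableOn (hTd.mono fun Z hZ => (hV Z hZ).2.2)).sub_const e
    have hjet : ∀ b, b ≠ (0, 0) → jet f P b = v (τ b P) := by
      intro b hb
      have := hτ b v e hPV₀
      rw [if_neg hb] at this
      exact this.trans (sub_zero _)
    have hfd : ∀ u : ZW n, fderiv ℂ f P u = v (J u) := by
      intro u
      have h2 : HasFDerivAt f (v.comp J) P := (v.hasFDerivAt.comp P hTP).sub_const _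
      rw [h2.fderiv]
      rfl
    -- First-order tangency determines v on the image of dT(P) from its value on the ∂_w direction.
    have htan : ∀ i, rhoDeriv ρ P ζ wIdx * v (J (Pi.single i 1, 0)) =
        rhoDeriv ρ P ζ (zIdx i) * v (J (0, 1)) := by
      intro i
      have h1 := segreL_eq_zero hVo hrV hfV (fun Z hZ => (hV Z hZ).1.1) hPV (hV P hPV).1.2 hρ0 i
      rw [segreL, ← jet_single hVo hrV hPV, ← jet_zero_one] at h1
      have h2 : derivZ i f P = v (J (Pi.single i 1, 0)) := hfd _
      have h3 : derivW f P = v (J (0, 1)) := hfd _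
      rw [h2, h3] at h1
      exact sub_eq_zero.mp h1
    refine ⟨fun c => v (σ (Pi.single c 1)), v (J (0, 1)), hom, fun j => ?_⟩
    have h1 := hop j V r f hVo hrV hfV (fun Z hZ => (hV Z hZ).1.2) (fun Z hZ => (hV Z hZ).1.1) P
      hPV hρ0
    have h2 := mul_sum_eq_wPart_add_normalPart (L j) (rhoDeriv ρ P ζ) (jet f P)
      (fun b => a (τ b P)) (fun b => lam (τ b P)) (v (J (0, 1)))
      (fun c => v (σ (Pi.single c 1))) ?_
    · have hk : 2 * (multiLength (α j) - 2) + 2 = 2 * multiLength (α j) - 2 := by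
        have := hα j; omega
      have h3 : derivW f P = v (J (0, 1)) := hfd _
      rw [hk, h3, ← jet_zero_one r] at h1
      change eval (rhoDeriv ρ P ζ) _ * _ + rhoDeriv ρ P ζ wIdx *
        ((L j).map fun x => eval (rhoDeriv ρ P ζ) x.2 * jet f P x.1).sum = 0 at h1
      rw [h2] at h1
      simp only [hTT, hDD, map_sub, map_add] at h1 ⊢
      linear_combination h1
    · intro x hx
      have h3 : v (σ (lam (τ x.1 P))) = ∑ c, lam (τ x.1 P) c * v (σ (Pi.single c 1)) := by
        conv_lhs => rw [pi_eq_sum_univ' (lam (τ x.1 P))]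
        simp only [map_sum, map_smul, smul_eq_mul]
      rw [hjet _ (hL j x hx).2, ← h3]
      conv_lhs => rw [hdec (τ x.1 P)]
      rw [map_add, ContinuousLinearMap.coe_coe, map_map_eq_sum_single v, mul_add, mul_add,
        Finset.mul_sum, add_mul, Finset.sum_mul]
      have h4 : ∀ i, rhoDeriv ρ P ζ wIdx * ((a (τ x.1 P)).1 i * v (J (Pi.single i 1, 0))) =
          (a (τ x.1 P)).1 i * rhoDeriv ρ P ζ (zIdx i) * v (J (0, 1)) := by
        intro i
        linear_combination (a (τ x.1 P)).1 i * htan i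
      simp only [h4]
      ring
  -- The values are antiholomorphic in ζ, so the identity theorem is applied to their conjugates.
  have hstarS : ∀ Q : JetPoly n, (∀ᶠ ζ in 𝓝 P, ζ ∈ S → eval (rhoDeriv ρ P ζ) Q = 0) →
      ∀ ζ ∈ S, eval (rhoDeriv ρ P ζ) Q = 0 := by
    intro Q hQ ζ hζ
    have := hS.eq_zero hU (differentiableOn_star_eval_rhoDeriv hU hρ hP Q) hPS
      (hQ.mono fun ξ hξ hξS => by rw [hξ hξS, star_zero]) ζ hζ
    exact star_eq_zero.mp this
  refine exists_jet_relation ⟨P, hPS⟩ (rhoDeriv ρ P) ?_ ⟨P, hPS, hρw⟩ α hα TT DD ?_ ?_ ?_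
  · intro Q₁ Q₂ h
    have := hS.eq_zero_or_eq_zero hU (differentiableOn_star_eval_rhoDeriv hU hρ hP Q₁)
      (differentiableOn_star_eval_rhoDeriv hU hρ hP Q₂) fun ζ hζ => by
        rw [← star_mul', h ζ hζ, star_zero]
    simpa only [star_eq_zero] using this
  · intro j
    have hj := hα j
    have h1 : multiLength (α j) - 2 + 2 = multiLength (α j) := by omega
    have h2 := jetBound_wPart (by omega) (fun x hx => (hL j x hx).1) (fun b => a (τ b P))
    exact ((hR₀ j).add h2).mono h1.le (by omega) (by omega)
  · intro j c
    have hj := hα j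
    have h1 : multiLength (α j) - 2 + 2 = multiLength (α j) := by omega
    exact (jetBound_normalPart (fun x hx => (hL j x hx).1) _ c).mono h1.le (by omega) (by omega)
  · intro c hc
    have hsum : ∀ ζ ∈ S, eval (rhoDeriv ρ P ζ)
        (∑ j, c j * (TT j - X wIdx ^ (2 * multiLength (α j) - 2) * X (α j, 0))) = 0 := by
      refine hstarS _ ?_
      filter_upwards [hlocal] with ζ hζ hζS
      obtain ⟨s, om, hom, h⟩ := hζ hζS
      have h1 : ∑ j, eval (rhoDeriv ρ P ζ) (c j) * (eval (rhoDeriv ρ P ζ)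
          (TT j - X wIdx ^ (2 * multiLength (α j) - 2) * X (α j, 0)) * om +
          rhoDeriv ρ P ζ wIdx * ∑ b, eval (rhoDeriv ρ P ζ) (DD j b) * s b) = 0 :=
        Finset.sum_eq_zero fun j _ => by rw [h j, mul_zero]
      -- The relation among the rows `DD j` removes the unknowns s; what is left is a multiple of
      -- the nonzero factor `om`.
      have h2 : ∑ j, eval (rhoDeriv ρ P ζ) (c j) *
          (rhoDeriv ρ P ζ wIdx * ∑ b, eval (rhoDeriv ρ P ζ) (DD j b) * s b) = 0 := by
        have h3 : ∀ j, eval (rhoDeriv ρ P ζ) (c j) *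
            (rhoDeriv ρ P ζ wIdx * ∑ b, eval (rhoDeriv ρ P ζ) (DD j b) * s b) =
            ∑ b, rhoDeriv ρ P ζ wIdx * s b *
              (eval (rhoDeriv ρ P ζ) (c j) * eval (rhoDeriv ρ P ζ) (DD j b)) := by
          intro j
          rw [Finset.mul_sum, Finset.mul_sum]
          exact Finset.sum_congr rfl fun b _ => by ring
        simp only [h3]
        rw [Finset.sum_comm]
        refine Finset.sum_eq_zero fun b _ => ?_
        rw [← Finset.mul_sum, hc b ζ hζS, mul_zero]
      simp only [mul_add, Finset.sum_add_distrib, h2, add_zero] at h1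
      simp only [← mul_assoc] at h1
      rw [← Finset.sum_mul] at h1
      have h4 := (mul_eq_zero.mp h1).resolve_right hom
      simpa using h4
    intro ζ hζ
    have := hsum ζ hζ
    rw [map_sum] at this
    simpa only [map_mul] using this

end Core

/-! ### Real hyperquadrics and application to a transversal embedding. -/

section Application

open scoped ContDiff
open Metric Set Filter

variable {N : ℕ}

/-- Hermitian symmetry makes h(z, z̄) real, and (w - w̄)/2i is Im w. -/
theorem Hyperquadric.quadricForm_diagStar (X : Hyperquadric N) (x : Fin (N + 1) → ℂ) :
    quadricForm X.form (X.coords x, star (X.coords x)) = X.defFun x := by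
  set y := X.coords x with hy
  have hreal : star (star y.1 ⬝ᵥ X.form.mulVec y.1) = star y.1 ⬝ᵥ X.form.mulVec y.1 := by
    conv_rhs => rw [Matrix.star_dotProduct, Matrix.star_mulVec, X.form_hermitian,
      ← Matrix.dotProduct_mulVec]
  have h1 : star y.1 ⬝ᵥ X.form.mulVec y.1 = ((star y.1 ⬝ᵥ X.form.mulVec y.1).re : ℂ) :=
    (Complex.conj_eq_iff_re.mp hreal).symm
  have h2 : y.2 / (2 * Complex.I) - star y.2 / (2 * Complex.I) = (y.2.im : ℂ) := by
    rw [← sub_div, Complex.star_def, Complex.sub_conj]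
    push_cast
    field_simp
  rw [quadricForm, quadricFunctional_apply, Hyperquadric.defFun, ← hy]
  push_cast
  rw [← h1, ← h2, Prod.fst_star, Prod.snd_star]
  ring

theorem Hyperquadric.defFun_add_smul (X : Hyperquadric N) (x : Fin (N + 1) → ℂ) (t : ℝ) :
    X.defFun (x + t • X.coords.symm (0, Complex.I)) = X.defFun x + t := by
  have h : X.coords (x + t • X.coords.symm (0, Complex.I)) =
      X.coords x + (0, (t : ℂ) * Complex.I) := by
    rw [map_add, ← Complex.coe_smul, map_smul, LinearEquiv.apply_symm_apply]
    simp
  simp only [Hyperquadric.defFun, h, Prod.fst_add, Prod.snd_add, add_zero]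
  simp
  ring

theorem Hyperquadric.defFun_eq (X : Hyperquadric N) :
    X.defFun = fun x => (quadricForm X.form (diagStar N (X.coords x))).re := by
  ext x
  rw [diagStar_apply, X.quadricForm_diagStar, Complex.ofReal_re]

theorem Hyperquadric.differentiable_defFun (X : Hyperquadric N) : Differentiable ℝ X.defFun := by
  rw [X.defFun_eq]
  intro x
  have h1 : DifferentiableAt ℝ (fun x => X.coords x) x :=
    (X.coords.toLinearMap.toContinuousLinearMap.differentiableAt (x := x)).restrictScalars ℝ
  have h2 : DifferentiableAt ℝ (quadricForm X.form) (diagStar N (X.coords x)) :=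
    (differentiable_quadricForm X.form _).restrictScalars ℝ
  have h3 : DifferentiableAt ℝ (fun x => diagStar N (X.coords x)) x :=
    (diagStar N).differentiableAt.comp x h1
  have h4 : DifferentiableAt ℝ (fun x => quadricForm X.form (diagStar N (X.coords x))) x :=
    DifferentiableAt.comp (g := quadricForm X.form) x h2 h3
  exact Complex.reCLM.differentiableAt.comp x h4

/-- Translation along (0, i) changes Im w - h at unit rate, so this direction is not tangent. -/
theorem Hyperquadric.tangentSpace_ne_top (X : Hyperquadric N) (x : Fin (N + 1) → ℂ) :
    X.tangentSpace x ≠ ⊤ := by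
  intro h
  set d := X.coords.symm (0, Complex.I) with hd
  have h0 : fderiv ℝ X.defFun x d = 0 := by
    have : d ∈ X.tangentSpace x := h ▸ Submodule.mem_top
    exact this
  have h1 : HasDerivAt (fun t : ℝ => x + t • d) d 0 := by
    simpa using ((hasDerivAt_id (0 : ℝ)).smul_const d).const_add x
  have h2 : HasDerivAt (fun t : ℝ => X.defFun (x + t • d)) (fderiv ℝ X.defFun x d) 0 := by
    refine HasFDerivAt.comp_hasDerivAt (l := X.defFun) (0 : ℝ) ?_ h1
    simpa using (X.differentiable_defFun x).hasFDerivAt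
  have h3 : HasDerivAt (fun t : ℝ => X.defFun (x + t • d)) 1 0 := by
    simp only [hd, X.defFun_add_smul]
    exact (hasDerivAt_id (0 : ℝ)).const_add _
  exact zero_ne_one (h0 ▸ h2.unique h3)

end Application

theorem theorem5p1 {n m : ℕ}
    (M : Set (Fin (n + 1) → ℂ)) (hM : IsRealAnalyticHypersurface M)
    (p : Fin (n + 1) → ℂ) (hp : p ∈ M)
    (X : Hyperquadric (n + m)) (hX : TransversallyEmbeddable M X)
    -- local holomorphic coordinates `(z, w)` near `p`
    (Φ : OpenPartialHomeomorph (Fin (n + 1) → ℂ) (ZW n)) (hpΦ : p ∈ Φ.source)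
    (hΦ : DifferentiableOn ℂ Φ Φ.source) (hΦsymm : DifferentiableOn ℂ Φ.symm Φ.target)
    -- a defining function in these coordinates
    (U : Set (ZW n)) (ρ : ZW n × ZW n → ℂ) (hρ : IsDefiningFunction M p Φ U ρ)
    -- an irreducible subvariety of the Segre variety through `p`
    (S : Set (ZW n)) (hS : IsIrreducibleSubvariety U S)
    (hSsub : S ⊆ segreVariety U ρ (Φ p)) (hpS : Φ p ∈ S)
    (α : Fin (m + 1) → Fin n → ℕ) (hα : ∀ j, 2 ≤ multiLength (α j)) :
    ∃ k : ℕ, (∃ j, multiLength (α j) = k) ∧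
      ∃ (P : Fin (m + 1) → JetPoly n) (R : JetPoly n),
        (∀ j, multiLength (α j) = k → (P j).InvolvesOnly k) ∧ R.InvolvesOnly k ∧
        (∀ ζ ∈ S,
          ∑ j with multiLength (α j) = k,
              MvPolynomial.eval (rhoDeriv ρ (Φ p) ζ) (P j) * rhoDeriv ρ (Φ p) ζ (α j, 0) =
            MvPolynomial.eval (rhoDeriv ρ (Φ p) ζ) R) ∧
        (∃ j, multiLength (α j) = k ∧
          ∃ ζ ∈ S, MvPolynomial.eval (rhoDeriv ρ (Φ p) ζ) (P j) ≠ 0) ∧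
        ∀ l : ℕ, l = Finset.card {j | multiLength (α j) ≤ k} →
          (∀ j, multiLength (α j) = k →
            (P j).wt ≤ (2 * k - 2) * (l - 1) ∧ (P j).degRhoW ≤ (2 * k - 2) * l) ∧
          R.wt ≤ (2 * k - 2) * l + 1 ∧ R.degRhoW ≤ (2 * k - 2) * l + 1 := by
  obtain ⟨W, H, hMW, hH, hmaps, htr⟩ := hX
  set P := Φ p with hP
  have hPt : P ∈ Φ.target := Φ.map_source hpΦ
  have hΦp : Φ.symm P = p := Φ.left_inv hpΦ
  let E : (Fin (n + m + 1) → ℂ) →L[ℂ] ZW (n + m) := LinearMap.toContinuousLinearMap X.coords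
  let T : ZW n → ZW (n + m) := fun Z => E (H (Φ.symm Z))
  have hΦsd : ∀ Z ∈ Φ.target, DifferentiableAt ℂ Φ.symm Z := fun Z hZ =>
    hΦsymm.differentiableAt (Φ.open_target.mem_nhds hZ)
  have hΦd : DifferentiableAt ℂ Φ p := hΦ.differentiableAt (Φ.open_source.mem_nhds hpΦ)
  have hΦsc : ContinuousAt Φ.symm P := (hΦsd P hPt).continuousAt
  have hWp : ∀ᶠ Z in 𝓝 P, Φ.symm Z ∈ W :=
    hΦsc.eventually_mem (hH.isOpen.mem_nhds (by rw [hΦp]; exact hMW hp))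
  have hHd : ∀ x ∈ W, DifferentiableAt ℂ H x := fun x hx =>
    hH.holomorphic.differentiableAt (hH.isOpen.mem_nhds hx)
  have hT : ∀ᶠ Z in 𝓝 P, DifferentiableAt ℂ T Z := by
    filter_upwards [hWp, Φ.open_target.eventually_mem hPt] with Z hZW hZt
    have h1 : DifferentiableAt ℂ (fun Z => H (Φ.symm Z)) Z :=
      DifferentiableAt.comp (g := H) Z (hHd _ hZW) (hΦsd Z hZt)
    exact E.differentiableAt.comp Z h1
  have hTp : HasFDerivAt T (E.comp ((fderiv ℂ H p).comp (fderiv ℂ Φ.symm P))) P := by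
    have h1 : HasFDerivAt H (fderiv ℂ H p) (Φ.symm P) := by
      rw [hΦp]
      exact (hHd p (hMW hp)).hasFDerivAt
    exact E.hasFDerivAt.comp P (HasFDerivAt.comp (g := H) P h1 (hΦsd P hPt).hasFDerivAt)
  have hinv : ∀ Y, fderiv ℂ Φ p (fderiv ℂ Φ.symm P Y) = Y := by
    intro Y
    have h1 : HasFDerivAt (fun Z => Φ (Φ.symm Z)) ((fderiv ℂ Φ p).comp (fderiv ℂ Φ.symm P)) P := by
      refine HasFDerivAt.comp (g := Φ) P ?_ (hΦsd P hPt).hasFDerivAt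
      rw [hΦp]
      exact hΦd.hasFDerivAt
    have h2 : HasFDerivAt (fun Z => Φ (Φ.symm Z)) (ContinuousLinearMap.id ℂ (ZW n)) P :=
      (hasFDerivAt_id P).congr_of_eventuallyEq
        ((Φ.open_target.eventually_mem hPt).mono fun Z hZ => Φ.right_inv hZ)
    exact DFunLike.congr_fun (h1.unique h2) Y
  have hTinj : Function.Injective (fderiv ℂ T P) := by
    rw [hTp.fderiv]
    refine X.coords.injective.comp ((hH.immersion p (hMW hp)).comp ?_)
    exact Function.LeftInverse.injective hinv
  have hpull : ∀ Z, pullbackForm X.form T (Z, star Z) = X.defFun (H (Φ.symm Z)) := by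
    intro Z
    rw [pullbackForm, star_star, ← X.quadricForm_diagStar]
    rfl
  have hvan : ∀ᶠ Z in 𝓝 P, ρ (Z, star Z) = 0 → pullbackForm X.form T (Z, star Z) = 0 := by
    filter_upwards [hρ.defines] with Z hZ hZ0
    have h1 : X.defFun (H (Φ.symm Z)) = 0 := hmaps (hZ.mpr hZ0)
    rw [hpull, h1, Complex.ofReal_zero]
  have hρP : ρ (P, star P) = 0 := hρ.defines.self_of_nhds.mp (by rw [← hP, hΦp]; exact hp)
  -- If this differential vanished, the image of dH would lie in the tangent space of the
  -- hyperquadric, and the transversality sum would be that proper subspace.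
  have htrans : fderiv ℂ (pullbackForm X.form T) (P, star P) ≠ 0 := by
    intro h0
    refine X.tangentSpace_ne_top (H p) (top_unique ?_)
    rw [← htr p hp]
    refine sup_le ?_ le_rfl
    rintro _ ⟨x, rfl⟩
    have hd : DifferentiableAt ℂ (pullbackForm X.form T) (P, star P) :=
      differentiableAt_pullbackForm _ hT.self_of_nhds (by simpa using hT.self_of_nhds)
    have h1 : HasFDerivAt (fun Z => (pullbackForm X.form T (diagStar n Z)).re)
        (0 : ZW n →L[ℝ] ℝ) P := by
      have h2 : HasFDerivAt (fun Z => (pullbackForm X.form T (diagStar n Z)).re)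
          (Complex.reCLM.comp (((fderiv ℂ (pullbackForm X.form T) (P, star P)).restrictScalars
            ℝ).comp (diagStar n))) P :=
        Complex.reCLM.hasFDerivAt.comp P
          (HasFDerivAt.comp (g := pullbackForm X.form T) P
            (hd.hasFDerivAt.restrictScalars ℝ) (diagStar n).hasFDerivAt)
      refine h2.congr_fderiv (ContinuousLinearMap.ext fun y => ?_)
      rw [h0]
      exact Complex.zero_re
    have h3 : HasFDerivAt (fun x => (pullbackForm X.form T (diagStar n (Φ x))).re)
        (0 : (Fin (n + 1) → ℂ) →L[ℝ] ℝ) p :=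
      (HasFDerivAt.comp (g := fun Z => (pullbackForm X.form T (diagStar n Z)).re) p h1
        (hΦd.hasFDerivAt.restrictScalars ℝ)).congr_fderiv (ContinuousLinearMap.zero_comp _)
    have h4 : HasFDerivAt (fun x => X.defFun (H x)) (0 : (Fin (n + 1) → ℂ) →L[ℝ] ℝ) p := by
      refine h3.congr_of_eventuallyEq ?_
      filter_upwards [Φ.open_source.eventually_mem hpΦ] with x hx
      rw [diagStar_apply, hpull, Φ.left_inv hx, Complex.ofReal_re]
    have h5 : HasFDerivAt (fun x => X.defFun (H x))
        ((fderiv ℝ X.defFun (H p)).comp ((fderiv ℂ H p).restrictScalars ℝ)) p :=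
      HasFDerivAt.comp (g := X.defFun) p (X.differentiable_defFun (H p)).hasFDerivAt
        ((hHd p (hMW hp)).hasFDerivAt.restrictScalars ℝ)
    exact DFunLike.congr_fun (h5.unique h4) x
  exact exists_relation_of_map hρ.isOpen hρ.mem hρ.holomorphic hρ.real hρP hρ.deriv_w_ne_zero hT
    hTinj X.form hvan htrans hS hSsub hpS α hα
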